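/- Let $G$ be a compact Lie group and $K\le G$ a closed subgroup such that $G/K$ is connected. Let $\mathfrak k\subset\mathfrak g$ be their Lie algebras, fix an $\mathrm{Ad}(G)$-invariant scalar product $Q$ on $\mathfrak g$, and let $\mathfrak p=\mathfrak k^{\perp}\cong T_{eK}(G/K)$ be the isotropy representation. Suppose that $\mathfrak p=\mathfrak p_1\oplus\mathfrak p_2$, where $\mathfrak p_1,\mathfrak p_2$ are inequivalent irreducible $\mathrm{Ad}(K)$-invariant subspaces, and that $K$ is maximal in $G$, in the sense that there is no $\mathrm{Ad}(K)$-invariant Lie algebra $\mathfrak h$ with $\mathfrak k\subsetneq\mathfrak h\subsetneq\mathfrak g$. Then every $G$-invariant Riemannian metric on $G/K$ has the form $x_1Q|_{\mathfrak p_1}\oplus x_2Q|_{\mathfrak p_2}$ with $x_1,x_2>0$; put $y=x_1/x_2$. Suppose finally that $G/K$ carries exactly one $G$-invariant Einstein metric up to scaling, and let $\bar y$ be its value of $y$. A homogeneous Ricci flow (HRF) is a one-parameter family $g(t)$ of $G$-invariant metrics on $G/K$ with $\partial_t g(t)=-2\,\mathrm{Ric}(g(t))$. Then: 1. For every $G$-invariant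 metric $g_0$ there are $0<T<\infty$ and an HRF $g(t)=x_1(t)Q|_{\mathfrak p_1}\oplus x_2(t)Q|_{\mathfrak p_2}$ on $[0,T)$ with $g(0)=g_0$, such that every HRF on an interval $[0,T')$ starting at $g_0$ satisfies $T'\le T$ and coincides with $g$ on $[0,T')$. Moreover $T$ is a type I singularity, that is, $\sup_{[0,T)}|\mathrm{Rm}(g(t))|_{g(t)}=\infty$ and $\sup_{[0,T)}(T-t)|\mathrm{Rm}(g(t))|_{g(t)}<\infty$. As $t\to T$, $(G/K,g(t))$ shrinks to a point, i.e. its diameter tends to $0$, and $x_1(t)\to0$, $x_2(t)\to0$; and $y(t)=x_1(t)/x_2(t)\to\bar y$. 2. There are no ancient solutions other than homothetically shrinking Einstein metrics: there is no HRF defined on an interval $(-\infty,T)$, $T<\infty$, with $y(t)\ne\bar y$ for some $t<T$. -/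

import Mathlib

open Set Filter Topology Manifold
open scoped ContDiff ENNReal

noncomputable section

/-! ### Scalar products on real vector spaces -/

/-- A scalar product: a symmetric positive definite bilinear form. -/
structure ScalarProduct (V : Type*) [AddCommGroup V] [Module ℝ V] where
  form : LinearMap.BilinForm ℝ V
  symm : ∀ X Y, form X Y = form Y X
  pos : ∀ X, X ≠ 0 → 0 < form X X

namespace ScalarProduct

variable {V : Type*} [AddCommGroup V] [Module ℝ V]

theorem eq_zero_of_self (g : ScalarProduct V) {X : V} (h : g.form X X = 0) : X = 0 := by
  by_contra hX
  exact absurd h (g.pos X hX).ne'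

theorem nondegenerate (g : ScalarProduct V) : g.form.Nondegenerate :=
  ⟨fun X h => g.eq_zero_of_self (h X), fun X h => g.eq_zero_of_self (h X)⟩

theorem isRefl (g : ScalarProduct V) : g.form.IsRefl := fun X Y h => by
  rw [g.symm, h]

/-- The restriction of a scalar product to a subspace. -/
def restrict (g : ScalarProduct V) (W : Submodule ℝ V) : ScalarProduct W where
  form := g.form.restrict W
  symm X Y := g.symm X Y
  pos X hX := g.pos X (fun h => hX (Subtype.ext h))

theorem isCompl_orthogonal [FiniteDimensional ℝ V] (g : ScalarProduct V) (W : Submodule ℝ V) :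
    IsCompl (g.form.orthogonal W) W :=
  (LinearMap.BilinForm.isCompl_orthogonal_of_restrict_nondegenerate g.isRefl
    (g.restrict W).nondegenerate).symm

/-- The inner product space structure determined by a scalar product. -/
@[reducible] def core (g : ScalarProduct V) : InnerProductSpace.Core ℝ V where
  inner X Y := g.form X Y
  conj_inner_symm X Y := by simpa using g.symm Y X
  re_inner_nonneg X := by
    by_cases h : X = 0
    · simp [h]
    · simpa using (g.pos X h).le
  add_left X Y Z := by simp
  smul_left X Y r := by simp
  definite X h := g.eq_zero_of_self h

theorem exists_orthonormal_basis [FiniteDimensional ℝ V] (g : ScalarProduct V) :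
    ∃ e : Module.Basis (Fin (Module.finrank ℝ V)) ℝ V,
      ∀ i j, g.form (e i) (e j) = if i = j then 1 else 0 := by
  let _ : NormedAddCommGroup V := g.core.toNormedAddCommGroup
  let _ : InnerProductSpace ℝ V := InnerProductSpace.ofCore g.core.toCore
  refine ⟨(stdOrthonormalBasis ℝ V).toBasis, fun i j => ?_⟩
  have h := orthonormal_iff_ite.mp (stdOrthonormalBasis ℝ V).orthonormal i j
  rw [OrthonormalBasis.coe_toBasis]
  exact h

/-- A basis of `V` that is orthonormal for `g`. -/
def onb [FiniteDimensional ℝ V] (g : ScalarProduct V) :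
    Module.Basis (Fin (Module.finrank ℝ V)) ℝ V :=
  g.exists_orthonormal_basis.choose

end ScalarProduct

/-! ### Curvature of an invariant metric on a reductive homogeneous space

Let `𝔤 = 𝔭 ⊕ 𝔨` be a reductive decomposition and let `g` be the value at the base point of an
invariant metric on `G/K`, a scalar product on `𝔭 = T_{eK}(G/K)`. The Levi-Civita connection and
the curvature tensor at the base point are given by the classical formulas of Nomizu. -/

section Curvature

variable {𝔤 : Type*} [LieRing 𝔤] [LieAlgebra ℝ 𝔤]
  {𝔭 𝔨 : Submodule ℝ 𝔤} (h : IsCompl 𝔭 𝔨)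

/-- `(X, Y) ↦ [X, Y]_𝔭`. -/
def bracketP : 𝔭 →ₗ[ℝ] 𝔭 →ₗ[ℝ] 𝔭 :=
  LinearMap.mk₂ ℝ (fun X Y => 𝔭.projectionOnto 𝔨 h ⁅(X : 𝔤), (Y : 𝔤)⁆)
    (by intros; simp) (by intros; simp) (by intros; simp) (by intros; simp)

/-- `(X, Y) ↦ [X, Y]_𝔨`, as an element of `𝔤`. -/
def bracketK (X Y : 𝔭) : 𝔤 :=
  ⁅(X : 𝔤), (Y : 𝔤)⁆ - (𝔭.projectionOnto 𝔨 h ⁅(X : 𝔤), (Y : 𝔤)⁆ : 𝔤)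

/-- `(X, Y) ↦ ad([X, Y]_𝔨)|_𝔭`. -/
def adBracketK : 𝔭 →ₗ[ℝ] 𝔭 →ₗ[ℝ] (𝔭 →ₗ[ℝ] 𝔭) :=
  LinearMap.mk₂ ℝ
    (fun X Y => (𝔭.projectionOnto 𝔨 h) ∘ₗ (LieAlgebra.ad ℝ 𝔤 (bracketK h X Y)) ∘ₗ 𝔭.subtype)
    (by intros; ext; simp [bracketK]; abel) (by intros; ext; simp [bracketK, smul_sub])
    (by intros; ext; simp [bracketK]; abel) (by intros; ext; simp [bracketK, smul_sub])

variable [FiniteDimensional ℝ 𝔤] (g : ScalarProduct 𝔭)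

/-- The symmetric bilinear map `U` with
`2 g(U(X, Y), Z) = g([Z, X]_𝔭, Y) + g(X, [Z, Y]_𝔭)` for all `Z`. -/
def symmPart : 𝔭 →ₗ[ℝ] 𝔭 →ₗ[ℝ] 𝔭 :=
  LinearMap.mk₂ ℝ
    (fun X Y => (g.form.toDual g.nondegenerate).symm
      ((1 / 2 : ℝ) • (g.form Y ∘ₗ (bracketP h).flip X + g.form X ∘ₗ (bracketP h).flip Y)))
    (by intros; rw [← map_add]; congr 1; ext; simp; ring)
    (by intros; rw [← map_smul]; congr 1; ext; simp; ring)
    (by intros; rw [← map_add]; congr 1; ext; simp; ring)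
    (by intros; rw [← map_smul]; congr 1; ext; simp; ring)

/-- The Levi-Civita connection: `Λ(X) Y = ½ [X, Y]_𝔭 + U(X, Y)`. -/
def leviCivita : 𝔭 →ₗ[ℝ] 𝔭 →ₗ[ℝ] 𝔭 :=
  (1 / 2 : ℝ) • bracketP h + symmPart h g

/-- The curvature tensor
`R(X, Y) = [Λ(X), Λ(Y)] - Λ([X, Y]_𝔭) - ad([X, Y]_𝔨)` at the base point. -/
def curvature : 𝔭 →ₗ[ℝ] 𝔭 →ₗ[ℝ] (𝔭 →ₗ[ℝ] 𝔭) :=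
  LinearMap.mk₂ ℝ
    (fun X Y => leviCivita h g X ∘ₗ leviCivita h g Y - leviCivita h g Y ∘ₗ leviCivita h g X
      - leviCivita h g (bracketP h X Y) - adBracketK h X Y)
    (by intros; ext; simp; abel) (by intros; ext; simp [smul_sub])
    (by intros; ext; simp; abel) (by intros; ext; simp [smul_sub])

/-- The Ricci tensor: `Ric(Y, Z)` is the trace of `X ↦ R(X, Y) Z`. -/
def ricci (Y Z : 𝔭) : ℝ :=
  LinearMap.trace ℝ 𝔭 (LinearMap.applyₗ Z ∘ₗ (curvature h g).flip Y)

/-- The norm `|Rm|` of the curvature tensor, computed in a `g`-orthonormal basis. -/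
def rmNorm : ℝ :=
  √(∑ i, ∑ j, ∑ k, ∑ l,
    g.form (curvature h g (g.onb i) (g.onb j) (g.onb k)) (g.onb l) ^ 2)

end Curvature

/-! ### Homogeneous spaces of a compact Lie group -/

section Homogeneous

variable {n : ℕ} {G : Type*} [TopologicalSpace G] [ChartedSpace (EuclideanSpace ℝ (Fin n)) G]
  [Group G]

/-- The Lie algebra `𝔤 = T₁G` of `G`. -/
abbrev LieAlg (n : ℕ) (G : Type*) [TopologicalSpace G]
    [ChartedSpace (EuclideanSpace ℝ (Fin n)) G] [Group G] : Type _ :=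
  GroupLieAlgebra (𝓡 n) G

instance instFiniteDimensionalLieAlg : FiniteDimensional ℝ (LieAlg n G) :=
  inferInstanceAs (FiniteDimensional ℝ (EuclideanSpace ℝ (Fin n)))

/-- A smooth Lie group is regular enough for its Lie algebra. -/
instance instLieGroupMinSmoothness [LieGroup (𝓡 n) ∞ G] :
    LieGroup (𝓡 n) (minSmoothness ℝ 3) G :=
  by
  rw [minSmoothness_of_isRCLikeNormedField]
  infer_instance

/-- The adjoint representation: `Ad(a)` is the derivative at `1` of `x ↦ a x a⁻¹`. -/
def Ad (a : G) : LieAlg n G →L[ℝ] LieAlg n G :=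
  mfderiv (𝓡 n) (𝓡 n) (fun x : G => a * x * a⁻¹) (1 : G)

/-- `W` is stable under `Ad(K)`. -/
def IsAdStable (K : Subgroup G) (W : Submodule ℝ (LieAlg n G)) : Prop :=
  ∀ a ∈ K, ∀ X ∈ W, Ad a X ∈ W

/-- `W` is an irreducible representation of `K` under `Ad`. -/
def IsAdIrreducible (K : Subgroup G) (W : Submodule ℝ (LieAlg n G)) : Prop :=
  W ≠ ⊥ ∧ IsAdStable K W ∧ ∀ U ≤ W, IsAdStable K U → U = ⊥ ∨ U = W

/-- The subspaces `W₁` and `W₂` are equivalent as representations of `K` under `Ad`. -/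
def AreAdEquivalent (K : Subgroup G) (W₁ W₂ : Submodule ℝ (LieAlg n G)) : Prop :=
  ∃ φ : W₁ ≃ₗ[ℝ] W₂, ∀ a ∈ K, ∀ X X' : W₁,
    (X' : LieAlg n G) = Ad a (X : LieAlg n G) →
      (φ X' : LieAlg n G) = Ad a (φ X : LieAlg n G)

/-- The Lie algebra `𝔨` of a closed subgroup `K`: the initial velocities of the one-parameter
subgroups of `G` that lie in `K`. (For closed `K` these already form a subspace.) -/
def isotropyAlgebra (n : ℕ) {G : Type*} [TopologicalSpace G]
    [ChartedSpace (EuclideanSpace ℝ (Fin n)) G] [Group G] (K : Subgroup G) :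
    Submodule ℝ (LieAlg n G) :=
  Submodule.span ℝ {X | ∃ γ : ℝ → G, (∀ s t, γ (s + t) = γ s * γ t) ∧ (∀ t, γ t ∈ K) ∧
    ContMDiff 𝓘(ℝ, ℝ) (𝓡 n) ∞ γ ∧ mfderiv 𝓘(ℝ, ℝ) (𝓡 n) γ 0 (1 : ℝ) = X}

/-- An `Ad(G)`-invariant scalar product on `𝔤`. -/
structure BiinvariantProduct (n : ℕ) (G : Type*) [TopologicalSpace G]
    [ChartedSpace (EuclideanSpace ℝ (Fin n)) G] [Group G] extends
    ScalarProduct (LieAlg n G) where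
  inv : ∀ (a : G) (X Y : LieAlg n G), form (Ad a X) (Ad a Y) = form X Y

/-- The isotropy representation `𝔭 = 𝔨^⊥`, identified with the tangent space of `G/K` at `eK`. -/
def isotropyRep (Q : BiinvariantProduct n G) (K : Subgroup G) : Submodule ℝ (LieAlg n G) :=
  Q.form.orthogonal (isotropyAlgebra n K)

theorem isCompl_isotropyRep (Q : BiinvariantProduct n G) (K : Subgroup G) :
    IsCompl (isotropyRep Q K) (isotropyAlgebra n K) :=
  Q.toScalarProduct.isCompl_orthogonal _

/-- There is no intermediate `Ad(K)`-stable Lie algebra strictly between `𝔨` and `𝔤`. -/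
def IsMaximalIsotropy [LieGroup (𝓡 n) ∞ G] (K : Subgroup G) : Prop :=
  ∀ 𝔥 : LieSubalgebra ℝ (LieAlg n G), isotropyAlgebra n K ≤ 𝔥.toSubmodule →
    IsAdStable K 𝔥.toSubmodule →
      𝔥.toSubmodule = isotropyAlgebra n K ∨ 𝔥.toSubmodule = ⊤

/-- A `G`-invariant Riemannian metric on `G/K`, given by its value at the base point:
an `Ad(K)`-invariant scalar product on `𝔭`. -/
structure InvariantMetric (Q : BiinvariantProduct n G) (K : Subgroup G) extends
    ScalarProduct (isotropyRep Q K) where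
  inv : ∀ a ∈ K, ∀ X Y X' Y' : isotropyRep Q K,
    (X' : LieAlg n G) = Ad a (X : LieAlg n G) → (Y' : LieAlg n G) = Ad a (Y : LieAlg n G) →
      form X' Y' = form X Y

namespace InvariantMetric

variable {Q : BiinvariantProduct n G} {K : Subgroup G}

/-- The Ricci tensor of an invariant metric at the base point. -/
def ric [LieGroup (𝓡 n) ∞ G] (g : InvariantMetric Q K) (X Y : isotropyRep Q K) : ℝ :=
  ricci (isCompl_isotropyRep Q K) g.toScalarProduct X Y

/-- The norm `|Rm(g)|_g` of the curvature tensor (by homogeneity, the same at every point). -/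
def rm [LieGroup (𝓡 n) ∞ G] (g : InvariantMetric Q K) : ℝ :=
  rmNorm (isCompl_isotropyRep Q K) g.toScalarProduct

/-- `g` is an Einstein metric. -/
def IsEinstein [LieGroup (𝓡 n) ∞ G] (g : InvariantMetric Q K) : Prop :=
  ∃ c : ℝ, ∀ X Y, g.ric X Y = c * g.form X Y

/-- `g = x₁ Q|_{𝔭₁} ⊕ x₂ Q|_{𝔭₂}`. -/
def HasComponents (g : InvariantMetric Q K) (𝔭₁ 𝔭₂ : Submodule ℝ (LieAlg n G))
    (x₁ x₂ : ℝ) : Prop :=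
  (∀ X Y : isotropyRep Q K, (X : LieAlg n G) ∈ 𝔭₁ → (Y : LieAlg n G) ∈ 𝔭₁ →
    g.form X Y = x₁ * Q.form X Y) ∧
  (∀ X Y : isotropyRep Q K, (X : LieAlg n G) ∈ 𝔭₂ → (Y : LieAlg n G) ∈ 𝔭₂ →
    g.form X Y = x₂ * Q.form X Y) ∧
  (∀ X Y : isotropyRep Q K, (X : LieAlg n G) ∈ 𝔭₁ → (Y : LieAlg n G) ∈ 𝔭₂ →
    g.form X Y = 0)

/-- `g = x₁ Q|_{𝔭₁} ⊕ x₂ Q|_{𝔭₂}` with `x₁, x₂ > 0` and `x₁ / x₂ = y`. -/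
def HasRatio (g : InvariantMetric Q K) (𝔭₁ 𝔭₂ : Submodule ℝ (LieAlg n G)) (y : ℝ) : Prop :=
  ∃ x₁ x₂ : ℝ, 0 < x₁ ∧ 0 < x₂ ∧ g.HasComponents 𝔭₁ 𝔭₂ x₁ x₂ ∧ x₁ / x₂ = y

/-- The velocity at time `t` of the curve `γ` in `G`, moved to `𝔤` by left translation. -/
def velocity (γ : ℝ → G) (t : ℝ) : LieAlg n G :=
  mfderiv (𝓡 n) (𝓡 n) (fun x : G => (γ t)⁻¹ * x) (γ t)
    (mfderiv 𝓘(ℝ, ℝ) (𝓡 n) γ t (1 : ℝ))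

/-- The length, for the invariant metric on `G/K` determined by `g`, of the curve
`t ↦ γ(t)K`, `0 ≤ t ≤ 1`. -/
def length (g : InvariantMetric Q K) (γ : ℝ → G) : ℝ≥0∞ :=
  ∫⁻ t in Icc (0 : ℝ) 1, ENNReal.ofReal
    √(g.form
      ((isotropyRep Q K).projectionOnto _ (isCompl_isotropyRep Q K) (velocity γ t))
      ((isotropyRep Q K).projectionOnto _ (isCompl_isotropyRep Q K) (velocity γ t)))

/-- The Riemannian distance on `G/K`. Every `C¹` curve in `G/K` is the projection of a `C¹` curve
in `G`. -/
def dist (g : InvariantMetric Q K) (p q : G ⧸ K) : ℝ≥0∞ :=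
  ⨅ (γ : ℝ → G) (_ : ContMDiff 𝓘(ℝ, ℝ) (𝓡 n) 1 γ)
    (_ : QuotientGroup.mk (γ 0) = p) (_ : QuotientGroup.mk (γ 1) = q), g.length γ

/-- The diameter of `G/K`. -/
def diam (g : InvariantMetric Q K) : ℝ≥0∞ :=
  ⨆ (p : G ⧸ K) (q : G ⧸ K), g.dist p q

end InvariantMetric

variable {Q : BiinvariantProduct n G} {K : Subgroup G}

/-- The homogeneous Ricci flow `∂g/∂t = -2 Ric(g)` on the set `S` of times. -/
def IsRicciFlowOn [LieGroup (𝓡 n) ∞ G] (g : ℝ → InvariantMetric Q K) (S : Set ℝ) : Prop :=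
  ∀ t ∈ S, ∀ X Y, HasDerivWithinAt (fun s => (g s).form X Y) (-2 * (g t).ric X Y) S t

/-- The flow `g` on `[0, T)` has a type I singularity at the finite time `T`. -/
def IsTypeISingularity [LieGroup (𝓡 n) ∞ G] (g : ℝ → InvariantMetric Q K) (T : ℝ) : Prop :=
  (∀ C : ℝ, ∃ t ∈ Ico 0 T, C < (g t).rm) ∧
  (∃ C : ℝ, ∀ t ∈ Ico 0 T, (T - t) * (g t).rm ≤ C)

/-- `(G/K, g(t))` shrinks to a point as `t → T⁻`: its diameter tends to `0`, equivalently it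
converges to a one-point space in the Gromov-Hausdorff sense. -/
def ShrinksToPoint (g : ℝ → InvariantMetric Q K) (T : ℝ) : Prop :=
  Tendsto (fun t => (g t).diam) (𝓝[<] T) (𝓝 0)

end Homogeneous

end

/-! Schur's lemma makes the problem two-dimensional. Since `𝔭₁` and `𝔭₂` are irreducible and
inequivalent, every invariant symmetric form on `𝔭`, metric or Ricci tensor, is diagonal, so the
flow becomes x₁' = -2 r₁(y), x₂' = -2 r₂(y) with y = x₁/x₂.

The functions r₁, r₂ come from Nomizu's formulas rewritten as traces on `𝔤` (`ricci_eq`): they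
combine the forms -tr(π ad_Y π' ad_Z), where π, π' project to `𝔭₁`, `𝔭₂` or `𝔨`. These forms are
nonnegative because ad is skew for Q. This gives r₁ = α₁ - β₁/y + γ₁y² and r₂ = α₂ - β₂y + γ₂/y².
Maximality of `K` makes all βᵢ and γᵢ positive, and αᵢ ≥ 2βᵢ (`exists_blockForm_eq`). Hence r₂ > 0
for y ≤ 2 and r₁ > 0 for y ≥ 1/2.

The ratio obeys y' = 2F(y)/x₂ with F(y) = y r₂(y) - r₁(y), and the positive zeros of F are the
ratios of Einstein metrics. So F has the single zero `yE`. As F tends to +∞ at 0, it is positive to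
the left of `yE`; exchanging the summands, it is negative to the right. Thus y is driven
monotonically to `yE`. There y r₂ = r₁ and at least one of r₁, r₂ is positive, so both are. In the
time s with dt = x₂ ds the ratio equation decouples and x₂ decays exponentially, hence total time T
is finite, both xᵢ vanish at T, and T - t is bounded by a multiple of x₂. Scaling of the curvature
then gives type I, and scaling of lengths the shrinking of the diameter.

Backwards in time y moves away from `yE`; by symmetry assume y < `yE`. If y becomes small, then r₁ ≤
-1 from there on into the past and x₁ reaches 0 after finite backward time. Otherwise y stays in a
compact interval where F has a positive minimum while x₂ grows at most linearly into the past, so y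
loses a divergent logarithm and cannot stay positive. Either way no ancient solution exists.

The hypotheses speak of Ad and of curves in `G`, so two links with the smooth structure are needed:
ad is the derivative of Ad at the identity (`hasDerivAt_Ad`), and points of `G/K` are reached by
curves from the identity of uniformly bounded speed (`exists_isJoinedWithSpeed_mk_eq`). -/

/-! ### The derivative of the adjoint representation in a chart -/

section ChartCalculus

variable {E : Type*} [NormedAddCommGroup E] [NormedSpace ℝ E] {M F : E × E → E} {e : E}

/-- If `M` is a group law near `(e, e)` and `F (a, y) = a y a⁻¹`, then the derivative of
`a ↦ D₂F(a, e) Y` at `e` is the commutator of the left invariant vector fields. -/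
theorem hasFDerivAt_conj_of_mul (hM : ContDiffAt ℝ 2 M (e, e)) (hF : ContDiffAt ℝ 2 F (e, e))
    (hFe : ∀ᶠ a in 𝓝 e, F (a, e) = e) (hFid : ∀ᶠ y in 𝓝 e, F (e, y) = y)
    (hMe : ∀ᶠ a in 𝓝 e, M (a, e) = a)
    (hcomm : ∀ᶠ p in 𝓝 (e, e), M (F p, p.1) = M p) (Y : E) :
    ∃ L : E →L[ℝ] E, HasFDerivAt (fun a => fderiv ℝ F (a, e) (0, Y)) L e ∧
      ∀ X, L X = fderiv ℝ (fun a => fderiv ℝ M (a, e) (0, Y)) e X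
        - fderiv ℝ (fun a => fderiv ℝ M (a, e) (0, X)) e Y := by
  have hM' : ContDiffAt ℝ 1 (fderiv ℝ M) (e, e) := hM.fderiv_right (by norm_num)
  have hF' : ContDiffAt ℝ 1 (fderiv ℝ F) (e, e) := hF.fderiv_right (by norm_num)
  have hMd := hM'.differentiableAt (by simp)
  have hFd := hF'.differentiableAt (by simp)
  set B := fderiv ℝ (fderiv ℝ M) (e, e) with hB
  have hsymm : ∀ u v, B u v = B v u :=
    fun u v => (hM.isSymmSndFDerivAt (by rw [minSmoothness_of_isRCLikeNormedField])).eq u v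
  have hl : HasFDerivAt (fun a : E => (a, e)) (ContinuousLinearMap.inl ℝ E E) e :=
    hasFDerivAt_prodMk_left e e
  have hr : HasFDerivAt (fun a : E => (e, a)) (ContinuousLinearMap.inr ℝ E E) e :=
    hasFDerivAt_prodMk_right e e
  have hMl : HasFDerivAt (fun a => fderiv ℝ M (a, e)) (B ∘L ContinuousLinearMap.inl ℝ E E) e :=
    hMd.hasFDerivAt.comp (g := fderiv ℝ M) (f := fun a : E => (a, e)) e hl
  have hMr : HasFDerivAt (fun a => fderiv ℝ M (e, a)) (B ∘L ContinuousLinearMap.inr ℝ E E) e :=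
    hMd.hasFDerivAt.comp (g := fderiv ℝ M) e hr
  have hFl : HasFDerivAt (fun a => fderiv ℝ F (a, e))
      (fderiv ℝ (fderiv ℝ F) (e, e) ∘L ContinuousLinearMap.inl ℝ E E) e :=
    hFd.hasFDerivAt.comp (g := fderiv ℝ F) (f := fun a : E => (a, e)) e hl
  have hMfd : ∀ Z X : E, fderiv ℝ (fun a => fderiv ℝ M (a, e) (0, Z)) e X = B (X, 0) (0, Z) := by
    intro Z X
    rw [(hMl.clm_apply (hasFDerivAt_const (0, Z) e)).fderiv]
    simp
  have hA := hFl.clm_apply (hasFDerivAt_const ((0 : E), Y) e)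
  set L := (fderiv ℝ F (e, e)) ∘L (0 : E →L[ℝ] E × E) +
    (fderiv ℝ (fderiv ℝ F) (e, e) ∘L ContinuousLinearMap.inl ℝ E E).flip ((0 : E), Y) with hL
  refine ⟨L, hA, fun X => ?_⟩
  rw [hMfd, hMfd]
  -- values at the base point
  have hFee : F (e, e) = e := hFe.self_of_nhds
  have hFY : fderiv ℝ F (e, e) (0, Y) = Y := by
    have h1 : HasFDerivAt (fun y => F (e, y)) (fderiv ℝ F (e, e) ∘L ContinuousLinearMap.inr ℝ E E) e :=
      (hF.differentiableAt (by simp)).hasFDerivAt.comp (g := F) e hr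
    have h2 : HasFDerivAt (fun y => F (e, y)) (ContinuousLinearMap.id ℝ E) e :=
      (hasFDerivAt_id e).congr_of_eventuallyEq hFid
    simpa using congrArg (fun T => T Y) (h1.unique h2)
  have hM1 : ∀ Z, fderiv ℝ M (e, e) (Z, 0) = Z := by
    intro Z
    have h1 : HasFDerivAt (fun y => M (y, e)) (fderiv ℝ M (e, e) ∘L ContinuousLinearMap.inl ℝ E E) e :=
      (hM.differentiableAt (by simp)).hasFDerivAt.comp (g := M) (f := fun a : E => (a, e)) e hl
    have h2 : HasFDerivAt (fun y => M (y, e)) (ContinuousLinearMap.id ℝ E) e :=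
      (hasFDerivAt_id e).congr_of_eventuallyEq hMe
    simpa using congrArg (fun T => T Z) (h1.unique h2)
  -- the derivative of `M (F (a, y), a) = M (a, y)` in `y`
  have hMev : ∀ᶠ p in 𝓝 (e, e), DifferentiableAt ℝ M p :=
    (hM.eventually (by simp)).mono fun p hp => hp.differentiableAt (by simp)
  have hFev : ∀ᶠ p in 𝓝 (e, e), DifferentiableAt ℝ F p :=
    (hF.eventually (by simp)).mono fun p hp => hp.differentiableAt (by simp)
  -- This is the y-derivative at `e` of (a y a⁻¹) a = a y, valid for all `a` near `e`.
  -- Differentiating it once more, in `a` at `e`, brings in the second derivative `B` of `M`; its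
  -- symmetry turns the result into the commutator.
  have key : ∀ᶠ a in 𝓝 e, fderiv ℝ M (e, a) (fderiv ℝ F (a, e) (0, Y), 0) =
      fderiv ℝ M (a, e) (0, Y) := by
    have hla : Tendsto (fun a : E => (a, e)) (𝓝 e) (𝓝 (e, e)) := hl.continuousAt
    have hra : Tendsto (fun a : E => (e, a)) (𝓝 e) (𝓝 (e, e)) := hr.continuousAt
    filter_upwards [hla.eventually hMev, hra.eventually hMev, hla.eventually hFev, hFe,
      hla.eventually hcomm.eventually_nhds] with a h1 h2 h3 h4 h5
    have hra' : HasFDerivAt (fun y : E => (a, y)) (ContinuousLinearMap.inr ℝ E E) e :=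
      hasFDerivAt_prodMk_right a e
    have d1 : HasFDerivAt (fun y => M (a, y)) _ e := h1.hasFDerivAt.comp (g := M) e hra'
    have d2 : HasFDerivAt (fun y => F (a, y)) _ e := h3.hasFDerivAt.comp (g := F) e hra'
    have d3 : HasFDerivAt (fun y => (F (a, y), a)) _ e := d2.prodMk (hasFDerivAt_const a e)
    have h2' : HasFDerivAt M (fderiv ℝ M (e, a)) (F (a, e), a) := by rw [h4]; exact h2.hasFDerivAt
    have d4 : HasFDerivAt (fun y => M (F (a, y), a)) _ e := h2'.comp (g := M) e d3
    have h6 : (fun y => M (F (a, y), a)) =ᶠ[𝓝 e] fun y => M (a, y) :=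
      hra'.continuousAt.tendsto.eventually h5
    have := congrArg (fun T => T Y) ((d4.congr_of_eventuallyEq h6.symm).unique d1)
    simpa using this
  have hl1 : HasFDerivAt (fun a => fderiv ℝ M (e, a) (fderiv ℝ F (a, e) (0, Y), 0)) _ e :=
    hMr.clm_apply ((ContinuousLinearMap.inl ℝ E E).hasFDerivAt.comp e hA)
  have hr1 := hMl.clm_apply (hasFDerivAt_const ((0 : E), Y) e)
  have := congrArg (fun T => T X) ((hl1.congr_of_eventuallyEq (key.mono fun a h => h.symm)).unique hr1)
  have h7 : fderiv ℝ M (e, e) (L X, 0) + B (0, X) (Y, 0) = B (X, 0) (0, Y) := by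
    simpa [hFY, hB, hL] using this
  rw [hM1, hsymm (0, X)] at h7
  exact eq_sub_of_add_eq h7

end ChartCalculus

/-! ### Chart expressions on a Lie group -/

section LieGroupChart

variable {n : ℕ} {G : Type*} [TopologicalSpace G] [ChartedSpace (EuclideanSpace ℝ (Fin n)) G]
  [Group G]

/-- The chart at the identity. -/
noncomputable abbrev chartOne (n : ℕ) (G : Type*) [TopologicalSpace G]
    [ChartedSpace (EuclideanSpace ℝ (Fin n)) G] [Group G] :
    PartialEquiv G (EuclideanSpace ℝ (Fin n)) :=
  extChartAt (𝓡 n) (1 : G)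

/-- The coordinates of the identity. -/
noncomputable abbrev coordOne (n : ℕ) (G : Type*) [TopologicalSpace G]
    [ChartedSpace (EuclideanSpace ℝ (Fin n)) G] [Group G] : EuclideanSpace ℝ (Fin n) :=
  chartOne n G 1

theorem eventually_chartOne_symm_chartOne {X : Type*} [TopologicalSpace X] {f : X → G} {x : X}
    (hf : ContinuousAt f x) (h1 : f x = 1) :
    ∀ᶠ y in 𝓝 x, (chartOne n G).symm (chartOne n G (f y)) = f y := by
  have : (chartOne n G).source ∈ 𝓝 (f x) := by rw [h1]; exact extChartAt_source_mem_nhds (1 : G)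
  filter_upwards [hf this] with y hy
  exact (chartOne n G).left_inv hy

theorem eventually_chartOne_chartOne_symm :
    ∀ᶠ x in 𝓝 (coordOne n G), chartOne n G ((chartOne n G).symm x) = x := by
  filter_upwards [extChartAt_target_mem_nhds (I := 𝓡 n) (1 : G)] with x hx
  exact (chartOne n G).right_inv hx

/-- Because `f` fixes the identity, the charts at source and target in the definition of `mfderiv`
are the same one. -/
theorem mfderiv_eq_fderiv_chartOne {f : G → G} (hf : MDifferentiableAt (𝓡 n) (𝓡 n) f 1)
    (h1 : f 1 = 1) (v : EuclideanSpace ℝ (Fin n)) :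
    (mfderiv (𝓡 n) (𝓡 n) f 1 v : EuclideanSpace ℝ (Fin n)) =
      fderiv ℝ (fun y => chartOne n G (f ((chartOne n G).symm y))) (coordOne n G) v := by
  have h2 : extChartAt (𝓡 n) (f 1) = chartOne n G := by rw [h1]
  have h3 : fderivWithin ℝ (writtenInExtChartAt (𝓡 n) (𝓡 n) 1 f) (range (𝓡 n))
      (extChartAt (𝓡 n) (1 : G) 1) =
      fderiv ℝ (fun y => chartOne n G (f ((chartOne n G).symm y))) (coordOne n G) := by
    simp only [writtenInExtChartAt, h2, ModelWithCorners.range_eq_univ, fderivWithin_univ]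
    rfl
  exact congrArg (fun T : EuclideanSpace ℝ (Fin n) →L[ℝ] EuclideanSpace ℝ (Fin n) => T v)
    ((MDifferentiableAt.mfderiv hf).trans h3)

theorem mfderiv_eq_deriv_chartOne {γ : ℝ → G} {t : ℝ} (hf : MDifferentiableAt 𝓘(ℝ, ℝ) (𝓡 n) γ t)
    (h1 : γ t = 1) :
    (mfderiv 𝓘(ℝ, ℝ) (𝓡 n) γ t (1 : ℝ) : EuclideanSpace ℝ (Fin n)) =
      deriv (fun s => chartOne n G (γ s)) t := by
  have h2 : extChartAt (𝓡 n) (γ t) = chartOne n G := by rw [h1]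
  have h3 : fderivWithin ℝ (writtenInExtChartAt 𝓘(ℝ, ℝ) (𝓡 n) t γ) (range 𝓘(ℝ, ℝ))
      (extChartAt 𝓘(ℝ, ℝ) t t) = fderiv ℝ (fun s => chartOne n G (γ s)) t := by
    simp only [writtenInExtChartAt, h2, ModelWithCorners.range_eq_univ, fderivWithin_univ]
    rfl
  exact (congrArg (fun T : ℝ →L[ℝ] EuclideanSpace ℝ (Fin n) => T 1)
    ((MDifferentiableAt.mfderiv hf).trans h3)).trans fderiv_apply_one_eq_deriv

variable [LieGroup (𝓡 n) ∞ G]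

theorem hasDerivAt_chartOne_comp {γ : ℝ → G} {t : ℝ}
    (hf : MDifferentiableAt 𝓘(ℝ, ℝ) (𝓡 n) γ t) (h1 : γ t = 1) :
    HasDerivAt (fun s => chartOne n G (γ s))
      (mfderiv 𝓘(ℝ, ℝ) (𝓡 n) γ t (1 : ℝ) : EuclideanSpace ℝ (Fin n)) t := by
  rw [mfderiv_eq_deriv_chartOne hf h1]
  refine DifferentiableAt.hasDerivAt ?_
  have h3 : MDifferentiableAt (𝓡 n) 𝓘(ℝ, EuclideanSpace ℝ (Fin n)) (chartOne n G) (γ t) :=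
    mdifferentiableAt_extChartAt (by rw [h1]; exact mem_chart_source _ _)
  exact (h3.comp t hf).differentiableAt

theorem contMDiffAt_chartOne_symm :
    ContMDiffAt 𝓘(ℝ, EuclideanSpace ℝ (Fin n)) (𝓡 n) ∞ (chartOne n G).symm (coordOne n G) :=
  (contMDiffOn_extChartAt_symm (1 : G)).contMDiffAt
    (extChartAt_target_mem_nhds (1 : G))

/-- A smooth binary operation on `G` fixing the identity is smooth in the chart. -/
theorem contDiffAt_chart_op {h : G × G → G} (hh : ContMDiff ((𝓡 n).prod (𝓡 n)) (𝓡 n) ∞ h)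
    (h1 : h (1, 1) = 1) :
    ContDiffAt ℝ ∞ (fun p : EuclideanSpace ℝ (Fin n) × EuclideanSpace ℝ (Fin n) =>
      chartOne n G (h ((chartOne n G).symm p.1, (chartOne n G).symm p.2)))
      (coordOne n G, coordOne n G) := by
  rw [← contMDiffAt_iff_contDiffAt]
  have hs : (chartOne n G).symm (coordOne n G) = 1 := extChartAt_to_inv (I := 𝓡 n) (1 : G)
  have a1 : ContMDiffAt 𝓘(ℝ, EuclideanSpace ℝ (Fin n) × EuclideanSpace ℝ (Fin n))
      (𝓡 n) ∞ (fun p : EuclideanSpace ℝ (Fin n) × EuclideanSpace ℝ (Fin n) =>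
        (chartOne n G).symm p.1) (coordOne n G, coordOne n G) :=
    contMDiffAt_chartOne_symm.comp (coordOne n G, coordOne n G) contDiff_fst.contMDiff.contMDiffAt
  have a2 : ContMDiffAt 𝓘(ℝ, EuclideanSpace ℝ (Fin n) × EuclideanSpace ℝ (Fin n))
      (𝓡 n) ∞ (fun p : EuclideanSpace ℝ (Fin n) × EuclideanSpace ℝ (Fin n) =>
        (chartOne n G).symm p.2) (coordOne n G, coordOne n G) :=
    contMDiffAt_chartOne_symm.comp (coordOne n G, coordOne n G) contDiff_snd.contMDiff.contMDiffAt
  have a3 := hh.contMDiffAt.comp (coordOne n G, coordOne n G) (a1.prodMk a2)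
  have a4 : ContMDiffAt (𝓡 n) 𝓘(ℝ, EuclideanSpace ℝ (Fin n)) ∞ (chartOne n G)
      (h ((chartOne n G).symm (coordOne n G), (chartOne n G).symm (coordOne n G))) := by
    rw [hs, h1]
    exact contMDiffAt_extChartAt
  exact a4.comp (coordOne n G, coordOne n G) a3

/-- The multiplication in the chart at the identity. -/
noncomputable def chartMul (n : ℕ) (G : Type*) [TopologicalSpace G]
    [ChartedSpace (EuclideanSpace ℝ (Fin n)) G] [Group G]
    (p : EuclideanSpace ℝ (Fin n) × EuclideanSpace ℝ (Fin n)) : EuclideanSpace ℝ (Fin n) :=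
  chartOne n G ((chartOne n G).symm p.1 * (chartOne n G).symm p.2)

/-- The conjugation `(a, y) ↦ a y a⁻¹` in the chart at the identity. -/
noncomputable def chartConj (n : ℕ) (G : Type*) [TopologicalSpace G]
    [ChartedSpace (EuclideanSpace ℝ (Fin n)) G] [Group G]
    (p : EuclideanSpace ℝ (Fin n) × EuclideanSpace ℝ (Fin n)) : EuclideanSpace ℝ (Fin n) :=
  chartOne n G ((chartOne n G).symm p.1 * (chartOne n G).symm p.2 * ((chartOne n G).symm p.1)⁻¹)

/-- The operation `(a, y) ↦ a⁻¹ y` in the chart at the identity. -/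
noncomputable def chartLeftDiv (n : ℕ) (G : Type*) [TopologicalSpace G]
    [ChartedSpace (EuclideanSpace ℝ (Fin n)) G] [Group G]
    (p : EuclideanSpace ℝ (Fin n) × EuclideanSpace ℝ (Fin n)) : EuclideanSpace ℝ (Fin n) :=
  chartOne n G (((chartOne n G).symm p.1)⁻¹ * (chartOne n G).symm p.2)

theorem contDiffAt_chartMul :
    ContDiffAt ℝ ∞ (chartMul n G) (coordOne n G, coordOne n G) :=
  contDiffAt_chart_op (h := fun p : G × G => p.1 * p.2) (contMDiff_fst.mul contMDiff_snd) (by simp)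

theorem contDiffAt_chartConj :
    ContDiffAt ℝ ∞ (chartConj n G) (coordOne n G, coordOne n G) :=
  contDiffAt_chart_op (h := fun p : G × G => p.1 * p.2 * p.1⁻¹)
    ((contMDiff_fst.mul contMDiff_snd).mul contMDiff_fst.inv) (by simp)

theorem contDiffAt_chartLeftDiv :
    ContDiffAt ℝ ∞ (chartLeftDiv n G) (coordOne n G, coordOne n G) :=
  contDiffAt_chart_op (h := fun p : G × G => p.1⁻¹ * p.2)
    (contMDiff_fst.inv.mul contMDiff_snd) (by simp)

theorem contMDiff_conj (a : G) : ContMDiff (𝓡 n) (𝓡 n) ∞ (fun x : G => a * x * a⁻¹) :=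
  (contMDiff_const.mul contMDiff_id).mul contMDiff_const

theorem fderiv_snd_apply {E F : Type*} [NormedAddCommGroup E] [NormedSpace ℝ E]
    [NormedAddCommGroup F] [NormedSpace ℝ F] {f : E × E → F} {a b : E}
    (hf : DifferentiableAt ℝ f (a, b)) (v : E) :
    fderiv ℝ (fun y => f (a, y)) b v = fderiv ℝ f (a, b) (0, v) := by
  have h : HasFDerivAt (fun y => f (a, y)) _ b :=
    hf.hasFDerivAt.comp (g := f) b (hasFDerivAt_prodMk_right a b)
  rw [h.fderiv]
  simp

theorem Ad_eq_fderiv (a : G) (v : LieAlg n G) :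
    (Ad a v : EuclideanSpace ℝ (Fin n)) =
      fderiv ℝ (fun y => chartOne n G (a * (chartOne n G).symm y * a⁻¹)) (coordOne n G) v :=
  mfderiv_eq_fderiv_chartOne (f := fun x : G => a * x * a⁻¹)
    ((contMDiff_conj a).mdifferentiable (by simp) 1) (by simp) v

theorem eventually_Ad_eq (v : LieAlg n G) : ∀ᶠ x in 𝓝 (coordOne n G),
    (Ad ((chartOne n G).symm x) v : EuclideanSpace ℝ (Fin n)) =
      fderiv ℝ (chartConj n G) (x, coordOne n G) (0, v) := by
  have h1 : ∀ᶠ p in 𝓝 (coordOne n G, coordOne n G), DifferentiableAt ℝ (chartConj n G) p :=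
    ((contDiffAt_chartConj.of_le (m := 1) (by norm_num)).eventually (by simp)).mono
      fun p hp => hp.differentiableAt (by simp)
  have h2 : Tendsto (fun a => (a, coordOne n G)) (𝓝 (coordOne n G))
      (𝓝 (coordOne n G, coordOne n G)) := by
    have : Continuous fun a : EuclideanSpace ℝ (Fin n) => (a, coordOne n G) := by fun_prop
    exact this.continuousAt
  filter_upwards [h2.eventually h1] with x hx
  exact (Ad_eq_fderiv _ v).trans (fderiv_snd_apply hx v)

end LieGroupChart

/-! ### The Lie bracket in the chart at the identity, and ad as the derivative of Ad -/

section LieGroupBracket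

variable {n : ℕ} {G : Type*} [TopologicalSpace G] [ChartedSpace (EuclideanSpace ℝ (Fin n)) G]
  [Group G] [LieGroup (𝓡 n) ∞ G]

/-- An element of the Lie algebra as a vector of the model space. -/
abbrev coords (X : LieAlg n G) : EuclideanSpace ℝ (Fin n) := X

theorem mfderivWithin_chartOne_symm_inverse {x : EuclideanSpace ℝ (Fin n)}
    (hx : x ∈ (chartOne n G).target) :
    (mfderivWithin 𝓘(ℝ, EuclideanSpace ℝ (Fin n)) (𝓡 n) (chartOne n G).symm (range (𝓡 n))
      x).inverse = mfderiv (𝓡 n) 𝓘(ℝ, EuclideanSpace ℝ (Fin n)) (chartOne n G)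
        ((chartOne n G).symm x) := by
  have : IsManifold (𝓡 n) 1 G := IsManifold.of_le (n := ∞) (by norm_num)
  apply ContinuousLinearMap.inverse_eq
  · exact mfderivWithin_extChartAt_symm_comp_mfderiv_extChartAt (I := 𝓡 n) hx
  · exact mfderiv_extChartAt_comp_mfderivWithin_extChartAt_symm (I := 𝓡 n) hx

/-- Chain rule for the chart composed with left multiplication: in coordinates a left invariant
field is a partial derivative of the group law. -/
theorem mpullbackWithin_mulInvariantVectorField {x : EuclideanSpace ℝ (Fin n)}
    (hx : x ∈ (chartOne n G).target) (hd : DifferentiableAt ℝ (chartMul n G) (x, coordOne n G))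
    (Y : LieAlg n G) :
    (VectorField.mpullbackWithin 𝓘(ℝ, EuclideanSpace ℝ (Fin n)) (𝓡 n) (chartOne n G).symm
      (mulInvariantVectorField Y) (range (𝓡 n)) x : EuclideanSpace ℝ (Fin n)) =
      fderiv ℝ (chartMul n G) (x, coordOne n G) (0, Y) := by
  have : IsManifold (𝓡 n) 1 G := IsManifold.of_le (n := ∞) (by norm_num)
  have hs : (chartOne n G).symm x * 1 ∈ (chartAt (EuclideanSpace ℝ (Fin n)) (1 : G)).source := by
    rw [mul_one, ← extChartAt_source (𝓡 n)]
    exact (chartOne n G).map_target hx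
  have h1 : MDifferentiableAt (𝓡 n) 𝓘(ℝ, EuclideanSpace ℝ (Fin n)) (chartOne n G)
      ((chartOne n G).symm x * 1) := mdifferentiableAt_extChartAt hs
  have h2 : MDifferentiableAt (𝓡 n) (𝓡 n) (fun y : G => (chartOne n G).symm x * y) 1 :=
    (contMDiff_mul_left (I := 𝓡 n) (n := ∞)).mdifferentiable (by simp) 1
  have h3 := mfderiv_comp (I' := 𝓡 n) (1 : G) h1 h2
  have h4 : mfderiv (𝓡 n) 𝓘(ℝ, EuclideanSpace ℝ (Fin n))
      (chartOne n G ∘ fun y : G => (chartOne n G).symm x * y) 1 =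
      fderiv ℝ (fun y => chartMul n G (x, y)) (coordOne n G) := by
    refine (MDifferentiableAt.mfderiv (h1.comp (1 : G) h2)).trans ?_
    simp only [writtenInExtChartAt, ModelWithCorners.range_eq_univ, fderivWithin_univ]
    rfl
  have h5 := congrArg (fun T : EuclideanSpace ℝ (Fin n) →L[ℝ] EuclideanSpace ℝ (Fin n) => T Y)
    (h3.symm.trans h4)
  refine Eq.trans ?_ (h5.trans (fderiv_snd_apply hd Y))
  refine Eq.trans (congrArg (fun T : EuclideanSpace ℝ (Fin n) →L[ℝ] EuclideanSpace ℝ (Fin n) =>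
    T (mulInvariantVectorField Y ((chartOne n G).symm x)))
    (mfderivWithin_chartOne_symm_inverse hx)) ?_
  -- The chain rule lives at the base point multiplied by 1, which equals the base point only
  -- propositionally. Quantifying over `z` lets the dependent tangent spaces be rewritten.
  have h6 : ∀ z : G, z = (chartOne n G).symm x →
      (mfderiv (𝓡 n) 𝓘(ℝ, EuclideanSpace ℝ (Fin n)) (chartOne n G) ((chartOne n G).symm x) :
        EuclideanSpace ℝ (Fin n) →L[ℝ] EuclideanSpace ℝ (Fin n)) =
      mfderiv (𝓡 n) 𝓘(ℝ, EuclideanSpace ℝ (Fin n)) (chartOne n G) z := by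
    rintro z rfl; rfl
  exact congrArg (fun T : EuclideanSpace ℝ (Fin n) →L[ℝ] EuclideanSpace ℝ (Fin n) =>
    T (mulInvariantVectorField Y ((chartOne n G).symm x))) (h6 _ (mul_one _))

/-- The bracket on the Lie algebra is by definition that of left invariant fields at 1, computed in
the chart. The chart has identity derivative at 1, so no correction appears, and the result has the
form delivered by `hasFDerivAt_conj_of_mul`. -/
theorem lie_eq_fderiv_chartMul (X Y : LieAlg n G) :
    coords ⁅X, Y⁆ =
      fderiv ℝ (fun a => fderiv ℝ (chartMul n G) (a, coordOne n G)
        (0, (Y : EuclideanSpace ℝ (Fin n)))) (coordOne n G) X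
      - fderiv ℝ (fun a => fderiv ℝ (chartMul n G) (a, coordOne n G)
        (0, (X : EuclideanSpace ℝ (Fin n)))) (coordOne n G) Y := by
  have : IsManifold (𝓡 n) 1 G := IsManifold.of_le (n := ∞) (by norm_num)
  have hd : ∀ᶠ x in 𝓝 (coordOne n G), DifferentiableAt ℝ (chartMul n G) (x, coordOne n G) := by
    have h1 : ∀ᶠ p in 𝓝 (coordOne n G, coordOne n G), DifferentiableAt ℝ (chartMul n G) p :=
      ((contDiffAt_chartMul.of_le (m := 1) (by norm_num)).eventually (by simp)).mono
        fun p hp => hp.differentiableAt (by simp)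
    have h2 : Continuous fun a : EuclideanSpace ℝ (Fin n) => (a, coordOne n G) := by fun_prop
    exact h2.continuousAt.eventually h1
  obtain ⟨W, hW⟩ : ∃ W : LieAlg n G → EuclideanSpace ℝ (Fin n) → EuclideanSpace ℝ (Fin n),
      W = fun Z => VectorField.mpullbackWithin 𝓘(ℝ, EuclideanSpace ℝ (Fin n)) (𝓡 n)
        (chartOne n G).symm (mulInvariantVectorField Z) (range (𝓡 n)) := ⟨_, rfl⟩
  have hV : ∀ Z : LieAlg n G, W Z =ᶠ[𝓝 (coordOne n G)]
      fun x => fderiv ℝ (chartMul n G) (x, coordOne n G) (0, coords Z) := by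
    subst hW
    intro Z
    filter_upwards [hd, extChartAt_target_mem_nhds (I := 𝓡 n) (1 : G)] with x hx hx'
    exact mpullbackWithin_mulInvariantVectorField hx' hx Z
  have hs : (chartOne n G).symm (coordOne n G) = 1 := extChartAt_to_inv (I := 𝓡 n) (1 : G)
  have hval : ∀ Z : EuclideanSpace ℝ (Fin n),
      fderiv ℝ (chartMul n G) (coordOne n G, coordOne n G) (0, Z) = Z := by
    intro Z
    rw [← fderiv_snd_apply hd.self_of_nhds]
    have h1 : (fun y => chartMul n G (coordOne n G, y)) =ᶠ[𝓝 (coordOne n G)] id := by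
      filter_upwards [eventually_chartOne_chartOne_symm (n := n) (G := G)] with y hy
      simp only [chartMul, hs, one_mul, hy, id]
    rw [h1.fderiv_eq]
    simp
  have h1 : (mfderiv (𝓡 n) 𝓘(ℝ, EuclideanSpace ℝ (Fin n)) (chartOne n G) 1).inverse =
      ContinuousLinearMap.id ℝ (EuclideanSpace ℝ (Fin n)) := by
    refine (congrArg (fun T : EuclideanSpace ℝ (Fin n) →L[ℝ] EuclideanSpace ℝ (Fin n) =>
      T.inverse) (mfderiv_extChartAt_self (I := 𝓡 n) (x := (1 : G)))).trans ?_
    exact ContinuousLinearMap.inverse_id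
  have h2 : coords ⁅X, Y⁆ =
      VectorField.lieBracketWithin ℝ (W X) (W Y)
        ((chartOne n G).symm ⁻¹' univ ∩ range (𝓡 n)) (coordOne n G) := by
    subst hW
    exact congrArg (fun T : EuclideanSpace ℝ (Fin n) →L[ℝ] EuclideanSpace ℝ (Fin n) => T _) h1
  rw [h2, preimage_univ, univ_inter, ModelWithCorners.range_eq_univ,
    VectorField.lieBracketWithin_univ]
  rw [VectorField.lieBracket_eq]
  simp only [(hV X).fderiv_eq, (hV Y).fderiv_eq, (hV X).self_of_nhds, (hV Y).self_of_nhds]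
  rw [hval, hval]

/-- The derivative of `Ad` at the identity is `ad`. -/
theorem hasDerivAt_Ad {γ : ℝ → G} {t : ℝ} (hγ : MDifferentiableAt 𝓘(ℝ, ℝ) (𝓡 n) γ t)
    (h1 : γ t = 1) {X : LieAlg n G}
    (hX : (mfderiv 𝓘(ℝ, ℝ) (𝓡 n) γ t (1 : ℝ) : EuclideanSpace ℝ (Fin n)) = X) (Y : LieAlg n G) :
    HasDerivAt (fun s => coords (Ad (γ s) Y)) (coords ⁅X, Y⁆) t := by
  have hs : (chartOne n G).symm (coordOne n G) = 1 := extChartAt_to_inv (I := 𝓡 n) (1 : G)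
  have hcont := continuousAt_extChartAt_symm (I := 𝓡 n) (1 : G)
  rw [← chartOne, ← coordOne, ContinuousAt, hs] at hcont
  obtain ⟨L, hL, hL'⟩ := hasFDerivAt_conj_of_mul (e := coordOne n G)
    ((contDiffAt_chartMul (n := n) (G := G)).of_le (by norm_cast))
    ((contDiffAt_chartConj (n := n) (G := G)).of_le (by norm_cast))
    (Eventually.of_forall fun a => by simp only [chartConj, hs, mul_one, mul_inv_cancel])
    (by
      filter_upwards [eventually_chartOne_chartOne_symm (n := n) (G := G)] with y hy
      simp only [chartConj, hs, inv_one, mul_one, one_mul, hy])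
    (by
      filter_upwards [eventually_chartOne_chartOne_symm (n := n) (G := G)] with y hy
      simp only [chartMul, hs, mul_one, hy])
    (by
      have hc : ContinuousAt (fun p : EuclideanSpace ℝ (Fin n) × EuclideanSpace ℝ (Fin n) =>
          (chartOne n G).symm p.1 * (chartOne n G).symm p.2 * ((chartOne n G).symm p.1)⁻¹)
          (coordOne n G, coordOne n G) := by
        have : IsTopologicalGroup G := topologicalGroup_of_lieGroup (𝓡 n) ∞
        have c0 := continuousAt_extChartAt_symm (I := 𝓡 n) (1 : G)
        have c1 : ContinuousAt (fun p : EuclideanSpace ℝ (Fin n) × EuclideanSpace ℝ (Fin n) =>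
          (chartOne n G).symm p.1) (coordOne n G, coordOne n G) :=
          ContinuousAt.comp (f := Prod.fst) c0 continuousAt_fst
        have c2 : ContinuousAt (fun p : EuclideanSpace ℝ (Fin n) × EuclideanSpace ℝ (Fin n) =>
          (chartOne n G).symm p.2) (coordOne n G, coordOne n G) :=
          ContinuousAt.comp (f := Prod.snd) c0 continuousAt_snd
        exact (c1.mul c2).mul c1.inv
      filter_upwards [eventually_chartOne_symm_chartOne (n := n) hc (by simp only [hs, mul_one, inv_one])] with p hp
      simp only [chartMul, chartConj, hp]
      simp)
    (Y : EuclideanSpace ℝ (Fin n))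
  have hc := hasDerivAt_chartOne_comp hγ h1
  have h2 : coordOne n G = chartOne n G (γ t) := by rw [h1]
  have hL2 : HasFDerivAt (fun a => coords (Ad ((chartOne n G).symm a) Y)) L
      (coordOne n G) := hL.congr_of_eventuallyEq (eventually_Ad_eq Y)
  rw [h2] at hL2
  have h3 := hL2.comp_hasDerivAt t hc
  rw [hX] at h3
  rw [hL' (coords X), ← lie_eq_fderiv_chartMul] at h3
  refine h3.congr_of_eventuallyEq ?_
  filter_upwards [eventually_chartOne_symm_chartOne (n := n) hγ.continuousAt h1] with s hs
  simp only [Function.comp_apply, hs]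

end LieGroupBracket

/-! ### The adjoint representation -/

section AdjointRepresentation

variable {n : ℕ} {G : Type*} [TopologicalSpace G] [ChartedSpace (EuclideanSpace ℝ (Fin n)) G]
  [Group G]

theorem Ad_one (v : LieAlg n G) : Ad (1 : G) v = v := by
  have h1 : (fun x : G => 1 * x * 1⁻¹) = id := by ext x; simp
  have h2 : ∀ f : G → G, f = id →
      (mfderiv (𝓡 n) (𝓡 n) f 1 v : EuclideanSpace ℝ (Fin n)) = v := by
    rintro f rfl
    rw [mfderiv_id]
    rfl
  exact h2 _ h1

variable [LieGroup (𝓡 n) ∞ G]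

/-- The derivative of `y ↦ a f(y) a⁻¹` at a point where `f = 1`. -/
theorem mfderiv_conj_comp {F H N : Type*} [NormedAddCommGroup F] [NormedSpace ℝ F]
    [TopologicalSpace H] {I : ModelWithCorners ℝ F H} [TopologicalSpace N] [ChartedSpace H N]
    {f : N → G} {x : N} (hf : MDifferentiableAt I (𝓡 n) f x) (h1 : f x = 1) (a : G)
    (v : TangentSpace I x) :
    (mfderiv I (𝓡 n) (fun y => a * f y * a⁻¹) x v : EuclideanSpace ℝ (Fin n)) =
      Ad a (mfderiv I (𝓡 n) f x v : EuclideanSpace ℝ (Fin n)) := by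
  have h2 := mfderiv_comp (I' := 𝓡 n) (I'' := 𝓡 n) x
    ((contMDiff_conj (n := n) a).mdifferentiable (by simp) (f x)) hf
  have h3 : ∀ z : G, z = 1 → (mfderiv (𝓡 n) (𝓡 n) (fun x : G => a * x * a⁻¹) z :
      EuclideanSpace ℝ (Fin n) →L[ℝ] EuclideanSpace ℝ (Fin n)) = Ad a := by
    rintro z rfl; rfl
  have h4 := congrArg (fun T : F →L[ℝ] EuclideanSpace ℝ (Fin n) => T v) h2
  exact h4.trans (congrArg (fun T : EuclideanSpace ℝ (Fin n) →L[ℝ] EuclideanSpace ℝ (Fin n) =>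
    T (mfderiv I (𝓡 n) f x v)) (h3 _ h1))

theorem Ad_mul (a b : G) (v : LieAlg n G) : Ad (a * b) v = Ad a (Ad b v) := by
  have h1 := mfderiv_conj_comp (x := (1 : G)) ((contMDiff_conj (n := n) b).mdifferentiable (by simp) 1)
    (by simp) a v
  have h2 : (fun y : G => a * (b * y * b⁻¹) * a⁻¹) = fun y => (a * b) * y * (a * b)⁻¹ := by
    ext y; simp [mul_assoc]
  have h3 : ∀ f g : G → G, f = g → (mfderiv (𝓡 n) (𝓡 n) f 1 v : EuclideanSpace ℝ (Fin n)) =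
      (mfderiv (𝓡 n) (𝓡 n) g 1 v : EuclideanSpace ℝ (Fin n)) := by
    rintro f g rfl; rfl
  exact (h3 _ _ h2).symm.trans h1

theorem Ad_inv_Ad (a : G) (v : LieAlg n G) : Ad a⁻¹ (Ad a v) = v := by
  rw [← Ad_mul, inv_mul_cancel, Ad_one]

theorem Ad_Ad_inv (a : G) (v : LieAlg n G) : Ad a (Ad a⁻¹ v) = v := by
  rw [← Ad_mul, mul_inv_cancel, Ad_one]

/-- Every element of the Lie algebra is the velocity of a curve through the identity. -/
theorem exists_curve_velocity (X : LieAlg n G) : ∃ γ : ℝ → G, γ 0 = 1 ∧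
    MDifferentiableAt 𝓘(ℝ, ℝ) (𝓡 n) γ 0 ∧
    (mfderiv 𝓘(ℝ, ℝ) (𝓡 n) γ 0 (1 : ℝ) : EuclideanSpace ℝ (Fin n)) = X := by
  set c : ℝ → EuclideanSpace ℝ (Fin n) := fun s => coordOne n G + s • coords X with hc
  have hc0 : c 0 = coordOne n G := by simp [hc]
  have hs : (chartOne n G).symm (coordOne n G) = 1 := extChartAt_to_inv (I := 𝓡 n) (1 : G)
  have hcd : HasDerivAt c (coords X) 0 := by
    have h := ((hasDerivAt_id (0 : ℝ)).smul_const (coords X)).const_add (coordOne n G)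
    rwa [one_smul] at h
  have h1 : (chartOne n G).symm (c 0) = 1 := by rw [hc0, hs]
  have h2 : MDifferentiableAt 𝓘(ℝ, ℝ) (𝓡 n) (fun s => (chartOne n G).symm (c s)) 0 := by
    have h3 : MDifferentiableAt 𝓘(ℝ, EuclideanSpace ℝ (Fin n)) (𝓡 n) (chartOne n G).symm (c 0) := by
      rw [hc0]
      exact contMDiffAt_chartOne_symm.mdifferentiableAt (by simp)
    exact h3.comp (0 : ℝ) hcd.differentiableAt.mdifferentiableAt
  refine ⟨_, h1, h2, ?_⟩
  rw [mfderiv_eq_deriv_chartOne h2 h1]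
  refine (HasDerivAt.congr_of_eventuallyEq hcd ?_).deriv
  have h4 := hcd.continuousAt
  rw [ContinuousAt, hc0] at h4
  exact h4.eventually (eventually_chartOne_chartOne_symm (n := n) (G := G))

/-- For a curve γ through 1 with velocity `X`, Ad(aγa⁻¹) Ad(a) Y = Ad(a) Ad(γ) Y; differentiate both
sides with `hasDerivAt_Ad`. -/
theorem Ad_lie (a : G) (X Y : LieAlg n G) : Ad a ⁅X, Y⁆ = ⁅Ad a X, Ad a Y⁆ := by
  obtain ⟨γ, h1, hd, hX⟩ := exists_curve_velocity X
  have hd' : MDifferentiableAt 𝓘(ℝ, ℝ) (𝓡 n) (fun s => a * γ s * a⁻¹) 0 :=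
    ((contMDiff_conj (n := n) a).mdifferentiable (by simp) _).comp (0 : ℝ) hd
  have hX' : (mfderiv 𝓘(ℝ, ℝ) (𝓡 n) (fun s => a * γ s * a⁻¹) 0 (1 : ℝ) :
      EuclideanSpace ℝ (Fin n)) = Ad a X :=
    (mfderiv_conj_comp hd h1 a (1 : ℝ)).trans (congrArg (fun v : LieAlg n G => Ad a v) hX)
  have d1 := hasDerivAt_Ad hd' (by simp [h1]) hX' (Ad a Y)
  have d2 := hasDerivAt_Ad hd h1 hX Y
  let T : EuclideanSpace ℝ (Fin n) →L[ℝ] EuclideanSpace ℝ (Fin n) := Ad a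
  have d3 := T.hasFDerivAt.comp_hasDerivAt (0 : ℝ) d2
  refine d3.unique (d1.congr_of_eventuallyEq (Eventually.of_forall fun s => ?_))
  change coords (Ad a (Ad (γ s) Y)) = coords (Ad (a * γ s * a⁻¹) (Ad a Y))
  rw [Ad_mul (a * γ s), Ad_inv_Ad, Ad_mul]

/-- The scalar product `Q` is `ad`-invariant. -/
theorem BiinvariantProduct.lie_skew (Q : BiinvariantProduct n G) (X Y Z : LieAlg n G) :
    Q.form ⁅X, Y⁆ Z = -Q.form Y ⁅X, Z⁆ := by
  obtain ⟨γ, h1, hd, hX⟩ := exists_curve_velocity X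
  let B : EuclideanSpace ℝ (Fin n) →L[ℝ] EuclideanSpace ℝ (Fin n) →L[ℝ] ℝ :=
    LinearMap.toContinuousLinearMap ((LinearMap.toContinuousLinearMap :
      (EuclideanSpace ℝ (Fin n) →ₗ[ℝ] ℝ) ≃ₗ[ℝ] EuclideanSpace ℝ (Fin n) →L[ℝ] ℝ).toLinearMap ∘ₗ
        (Q.form : EuclideanSpace ℝ (Fin n) →ₗ[ℝ] EuclideanSpace ℝ (Fin n) →ₗ[ℝ] ℝ))
  have hB : ∀ U V : LieAlg n G, B (coords U) (coords V) = Q.form U V := fun U V => rfl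
  have d1 := hasDerivAt_Ad hd h1 hX Y
  have d2 := hasDerivAt_Ad hd h1 hX Z
  have d3 := (B.hasFDerivAt.comp_hasDerivAt (0 : ℝ) d1).clm_apply d2
  -- Invariance of `Q` makes this function of `s` constant; the product rule gives its derivative in
  -- terms of ad.
  have d4 : HasDerivAt (fun s => B (coords (Ad (γ s) Y)) (coords (Ad (γ s) Z))) 0 0 :=
    (hasDerivAt_const (0 : ℝ) (Q.form Y Z)).congr_of_eventuallyEq
      (Eventually.of_forall fun s => Q.inv (γ s) Y Z)
  have h5 := d3.unique d4
  have h6 : Q.form ⁅X, Y⁆ (Ad (γ 0) Z) + Q.form (Ad (γ 0) Y) ⁅X, Z⁆ = 0 := h5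
  rw [h1, Ad_one, Ad_one] at h6
  exact eq_neg_of_add_eq_zero_left h6

variable {K : Subgroup G}

theorem isAdStable_isotropyAlgebra : IsAdStable K (isotropyAlgebra n K) := by
  intro a ha X hX
  induction hX using Submodule.span_induction with
  | mem X hX =>
    obtain ⟨γ, hadd, hmem, hsm, hv⟩ := hX
    have h1 : γ 0 = 1 := by simpa using hadd 0 0
    refine Submodule.subset_span ⟨fun t => a * γ t * a⁻¹, fun s t => ?_, fun t => ?_,
      (contMDiff_conj a).comp hsm, ?_⟩
    · simp [hadd, mul_assoc]
    · exact K.mul_mem (K.mul_mem ha (hmem t)) (K.inv_mem ha)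
    · exact (mfderiv_conj_comp (hsm.mdifferentiable (by simp) 0) h1 a (1 : ℝ)).trans
        (congrArg (fun v : LieAlg n G => Ad a v) hv)
  | zero => rw [map_zero]; exact Submodule.zero_mem _
  | add X Y _ _ hX hY => rw [map_add]; exact Submodule.add_mem _ hX hY
  | smul c X _ hX => rw [map_smul]; exact Submodule.smul_mem _ c hX

/-- For a generator `X`, the bracket is the derivative of a curve Ad(γ(s))Y that stays in `W`, and
`W` is closed; the rest is linearity. This passes from the group `K` to its Lie algebra. -/
theorem IsAdStable.lie_mem {W : Submodule ℝ (LieAlg n G)} (hW : IsAdStable K W)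
    {X Y : LieAlg n G} (hX : X ∈ isotropyAlgebra n K) (hY : Y ∈ W) : ⁅X, Y⁆ ∈ W := by
  induction hX using Submodule.span_induction with
  | mem X hX =>
    obtain ⟨γ, hadd, hmem, hsm, hv⟩ := hX
    have h1 : γ 0 = 1 := by simpa using hadd 0 0
    have hd := hasDerivAt_Ad (hsm.mdifferentiable (by simp) 0) h1 hv Y
    let W' : Submodule ℝ (EuclideanSpace ℝ (Fin n)) := W
    have hcl : IsClosed (W' : Set (EuclideanSpace ℝ (Fin n))) := W'.closed_of_finiteDimensional
    refine hcl.mem_of_tendsto (hasDerivAt_iff_tendsto_slope.mp hd) (Eventually.of_forall fun s => ?_)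
    exact W'.smul_mem _ (W'.sub_mem (hW _ (hmem s) Y hY) (hW _ (hmem 0) Y hY))
  | zero => rw [zero_lie]; exact Submodule.zero_mem _
  | add X Y _ _ hX hY => rw [add_lie]; exact Submodule.add_mem _ hX hY
  | smul c X _ hX => rw [smul_lie]; exact Submodule.smul_mem _ c hX

theorem isAdStable_isotropyRep (Q : BiinvariantProduct n G) : IsAdStable K (isotropyRep Q K) := by
  intro a ha X hX Y hY
  have h := hX (Ad a⁻¹ Y) (isAdStable_isotropyAlgebra _ (K.inv_mem ha) Y hY)
  change Q.form (Ad a⁻¹ Y) X = 0 at h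
  change Q.form Y (Ad a X) = 0
  rwa [← Q.inv a⁻¹, Ad_inv_Ad]

end AdjointRepresentation

/-! ### The norm of a scalar product -/

namespace ScalarProduct

variable {V : Type*} [AddCommGroup V] [Module ℝ V]

/-- The norm of a scalar product. -/
noncomputable def norm (g : ScalarProduct V) (X : V) : ℝ := √(g.form X X)

theorem self_nonneg (g : ScalarProduct V) (X : V) : 0 ≤ g.form X X := by
  by_cases h : X = 0
  · simp [h]
  · exact (g.pos X h).le

theorem norm_nonneg (g : ScalarProduct V) (X : V) : 0 ≤ g.norm X := Real.sqrt_nonneg _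

theorem norm_sq (g : ScalarProduct V) (X : V) : g.norm X ^ 2 = g.form X X :=
  Real.sq_sqrt (g.self_nonneg X)

theorem abs_form_le (g : ScalarProduct V) (X Y : V) : |g.form X Y| ≤ g.norm X * g.norm Y := by
  let _ : NormedAddCommGroup V := g.core.toNormedAddCommGroup
  let _ : InnerProductSpace ℝ V := InnerProductSpace.ofCore g.core.toCore
  exact abs_real_inner_le_norm X Y

theorem norm_add_le (g : ScalarProduct V) (X Y : V) : g.norm (X + Y) ≤ g.norm X + g.norm Y := by
  refine Real.sqrt_le_iff.mpr ⟨add_nonneg (g.norm_nonneg X) (g.norm_nonneg Y), ?_⟩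
  have h := (le_abs_self _).trans (g.abs_form_le X Y)
  have h2 : g.form (X + Y) (X + Y) = g.form X X + 2 * g.form X Y + g.form Y Y := by
    simp only [map_add, LinearMap.add_apply]
    rw [g.symm Y X]
    ring
  rw [h2, add_sq, g.norm_sq, g.norm_sq]
  linarith

theorem norm_smul (g : ScalarProduct V) (c : ℝ) (X : V) : g.norm (c • X) = |c| * g.norm X := by
  rw [norm, norm, ← Real.sqrt_sq_eq_abs, ← Real.sqrt_mul (sq_nonneg c)]
  congr 1
  simp
  ring

theorem norm_neg (g : ScalarProduct V) (X : V) : g.norm (-X) = g.norm X := by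
  simp [norm]

theorem norm_sub_le (g : ScalarProduct V) (X Y : V) : g.norm (X - Y) ≤ g.norm X + g.norm Y := by
  rw [sub_eq_add_neg, ← g.norm_neg Y]
  exact g.norm_add_le _ _

theorem norm_le_of_form_le (g : ScalarProduct V) {X : V} {c : ℝ} (hc : 0 ≤ c)
    (h : g.form X X ≤ c * g.norm X) : g.norm X ≤ c := by
  rw [← g.norm_sq, sq] at h
  by_contra! h'
  nlinarith [g.norm_nonneg X]

end ScalarProduct

/-! ### Velocities of curves -/

section Velocity

variable {n : ℕ} {G : Type*} [TopologicalSpace G] [ChartedSpace (EuclideanSpace ℝ (Fin n)) G]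
  [Group G]

/-- `a` can be joined to the identity by a `C¹` curve of speed at most `C` on `[0, 1]`. -/
def IsJoinedWithSpeed (Q : BiinvariantProduct n G) (C : ℝ) (a : G) : Prop :=
  ∃ γ : ℝ → G, ContMDiff 𝓘(ℝ, ℝ) (𝓡 n) 1 γ ∧ γ 0 = 1 ∧ γ 1 = a ∧
    ∀ t ∈ Icc (0 : ℝ) 1, Q.norm (InvariantMetric.velocity γ t) ≤ C

variable {Q : BiinvariantProduct n G}

theorem IsJoinedWithSpeed.mono {C C' : ℝ} {a : G} (h : IsJoinedWithSpeed Q C a) (hC : C ≤ C') :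
    IsJoinedWithSpeed Q C' a := by
  obtain ⟨γ, h1, h2, h3, h4⟩ := h
  exact ⟨γ, h1, h2, h3, fun t ht => (h4 t ht).trans hC⟩

theorem BiinvariantProduct.exists_norm_le (Q : BiinvariantProduct n G) : ∃ C, 0 ≤ C ∧
    ∀ X : LieAlg n G, Q.norm X ≤ C * ‖coords X‖ := by
  let B : EuclideanSpace ℝ (Fin n) →L[ℝ] EuclideanSpace ℝ (Fin n) →L[ℝ] ℝ :=
    LinearMap.toContinuousLinearMap ((LinearMap.toContinuousLinearMap :
      (EuclideanSpace ℝ (Fin n) →ₗ[ℝ] ℝ) ≃ₗ[ℝ] EuclideanSpace ℝ (Fin n) →L[ℝ] ℝ).toLinearMap ∘ₗ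
        (Q.form : EuclideanSpace ℝ (Fin n) →ₗ[ℝ] EuclideanSpace ℝ (Fin n) →ₗ[ℝ] ℝ))
  refine ⟨√‖B‖, Real.sqrt_nonneg _, fun X => ?_⟩
  rw [← Real.sqrt_sq (_root_.norm_nonneg (coords X)), ← Real.sqrt_mul (_root_.norm_nonneg B)]
  refine Real.sqrt_le_sqrt ?_
  have h := (le_abs_self _).trans (B.le_opNorm₂ (coords X) (coords X))
  rw [sq, ← mul_assoc]
  exact h

variable [LieGroup (𝓡 n) ∞ G]

theorem velocity_eq_mfderiv {γ : ℝ → G} {t : ℝ} (hγ : MDifferentiableAt 𝓘(ℝ, ℝ) (𝓡 n) γ t) :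
    coords (InvariantMetric.velocity γ t) =
      (mfderiv 𝓘(ℝ, ℝ) (𝓡 n) (fun s => (γ t)⁻¹ * γ s) t (1 : ℝ) : EuclideanSpace ℝ (Fin n)) := by
  have h := mfderiv_comp (I' := 𝓡 n) (I'' := 𝓡 n) (g := fun x : G => (γ t)⁻¹ * x) t
    ((contMDiff_mul_left (I := 𝓡 n) (n := ∞)).mdifferentiable (by simp) (γ t)) hγ
  exact (congrArg (fun T : ℝ →L[ℝ] EuclideanSpace ℝ (Fin n) => T 1) h).symm

theorem mdifferentiableAt_const_mul {γ : ℝ → G} {t : ℝ}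
    (hγ : MDifferentiableAt 𝓘(ℝ, ℝ) (𝓡 n) γ t) (a : G) :
    MDifferentiableAt 𝓘(ℝ, ℝ) (𝓡 n) (fun s => a * γ s) t :=
  ((contMDiff_mul_left (I := 𝓡 n) (n := ∞)).mdifferentiable (by simp) (γ t)).comp t hγ

theorem hasDerivAt_velocity {γ : ℝ → G} {t : ℝ} (hγ : MDifferentiableAt 𝓘(ℝ, ℝ) (𝓡 n) γ t) :
    HasDerivAt (fun s => chartOne n G ((γ t)⁻¹ * γ s))
      (coords (InvariantMetric.velocity γ t)) t := by
  rw [velocity_eq_mfderiv hγ]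
  exact hasDerivAt_chartOne_comp (mdifferentiableAt_const_mul hγ _) (by simp)

theorem velocity_const_mul {γ : ℝ → G} {t : ℝ} (hγ : MDifferentiableAt 𝓘(ℝ, ℝ) (𝓡 n) γ t)
    (a : G) : coords (InvariantMetric.velocity (n := n) (fun s => a * γ s) t) =
      coords (InvariantMetric.velocity γ t) := by
  have h1 := hasDerivAt_velocity (mdifferentiableAt_const_mul hγ a)
  simp only [mul_inv_rev, mul_assoc, inv_mul_cancel_left] at h1
  exact h1.unique (hasDerivAt_velocity hγ)

theorem hasFDerivAt_chartMul_one : HasFDerivAt (chartMul n G)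
    (ContinuousLinearMap.fst ℝ (EuclideanSpace ℝ (Fin n)) (EuclideanSpace ℝ (Fin n)) +
      ContinuousLinearMap.snd ℝ (EuclideanSpace ℝ (Fin n)) (EuclideanSpace ℝ (Fin n)))
    (coordOne n G, coordOne n G) := by
  have hs : (chartOne n G).symm (coordOne n G) = 1 := extChartAt_to_inv (I := 𝓡 n) (1 : G)
  have hd := ((contDiffAt_chartMul (n := n) (G := G)).differentiableAt (by simp)).hasFDerivAt
  refine hd.congr_fderiv ?_
  have h1 : HasFDerivAt (fun y => chartMul n G (y, coordOne n G))
      (ContinuousLinearMap.id ℝ (EuclideanSpace ℝ (Fin n))) (coordOne n G) := by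
    refine (hasFDerivAt_id _).congr_of_eventuallyEq ?_
    filter_upwards [eventually_chartOne_chartOne_symm (n := n) (G := G)] with y hy
    simp only [chartMul, hs, mul_one, hy, id]
  have h2 : HasFDerivAt (fun y => chartMul n G (coordOne n G, y))
      (ContinuousLinearMap.id ℝ (EuclideanSpace ℝ (Fin n))) (coordOne n G) := by
    refine (hasFDerivAt_id _).congr_of_eventuallyEq ?_
    filter_upwards [eventually_chartOne_chartOne_symm (n := n) (G := G)] with y hy
    simp only [chartMul, hs, one_mul, hy, id]
  have h3 := h1.unique (hd.comp (f := fun y => (y, coordOne n G)) (coordOne n G)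
    (hasFDerivAt_prodMk_left _ _))
  have h4 := h2.unique (hd.comp (f := fun y => (coordOne n G, y)) (coordOne n G)
    (hasFDerivAt_prodMk_right _ _))
  apply ContinuousLinearMap.ext
  intro p
  have h5 : p.1 = fderiv ℝ (chartMul n G) (coordOne n G, coordOne n G) (p.1, 0) :=
    congrArg (fun T : EuclideanSpace ℝ (Fin n) →L[ℝ] EuclideanSpace ℝ (Fin n) => T p.1) h3
  have h6 : p.2 = fderiv ℝ (chartMul n G) (coordOne n G, coordOne n G) (0, p.2) :=
    congrArg (fun T : EuclideanSpace ℝ (Fin n) →L[ℝ] EuclideanSpace ℝ (Fin n) => T p.2) h4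
  have h7 : fderiv ℝ (chartMul n G) (coordOne n G, coordOne n G) p = p.1 + p.2 := by
    conv_rhs => rw [h5, h6, ← map_add]
    simp
  exact h7

/-- Leibniz rule. Relative to its value at `t`, the product curve is the conjugate by δ(t)⁻¹ of
γ(t)⁻¹γ(s), times δ(t)⁻¹δ(s); both factors equal 1 at s = t, where the derivative of multiplication
is addition. -/
theorem velocity_mul {γ δ : ℝ → G} {t : ℝ} (hγ : MDifferentiableAt 𝓘(ℝ, ℝ) (𝓡 n) γ t)
    (hδ : MDifferentiableAt 𝓘(ℝ, ℝ) (𝓡 n) δ t)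
    (hγδ : MDifferentiableAt 𝓘(ℝ, ℝ) (𝓡 n) (fun s => γ s * δ s) t) :
    InvariantMetric.velocity (n := n) (fun s => γ s * δ s) t =
      Ad (δ t)⁻¹ (InvariantMetric.velocity γ t) + InvariantMetric.velocity δ t := by
  have hu := mdifferentiableAt_const_mul hγ (γ t)⁻¹
  have hv := mdifferentiableAt_const_mul hδ (δ t)⁻¹
  have hw : MDifferentiableAt 𝓘(ℝ, ℝ) (𝓡 n)
      (fun s => (δ t)⁻¹ * ((γ t)⁻¹ * γ s) * ((δ t)⁻¹)⁻¹) t :=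
    ((contMDiff_conj (n := n) (δ t)⁻¹).mdifferentiable (by simp) _).comp t hu
  have hw1 : (δ t)⁻¹ * ((γ t)⁻¹ * γ t) * ((δ t)⁻¹)⁻¹ = 1 := by simp
  have d1 := hasDerivAt_chartOne_comp hw hw1
  have e1 : (mfderiv 𝓘(ℝ, ℝ) (𝓡 n) (fun s => (δ t)⁻¹ * ((γ t)⁻¹ * γ s) * ((δ t)⁻¹)⁻¹) t (1 : ℝ) :
      EuclideanSpace ℝ (Fin n)) = coords (Ad (δ t)⁻¹ (InvariantMetric.velocity γ t)) :=
    (mfderiv_conj_comp hu (by simp) (δ t)⁻¹ (1 : ℝ)).trans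
      (congrArg (fun v : LieAlg n G => Ad (δ t)⁻¹ v) (velocity_eq_mfderiv hγ).symm)
  rw [e1] at d1
  have d2 := hasDerivAt_velocity hδ
  have hM := hasFDerivAt_chartMul_one (n := n) (G := G)
  have e2 : (coordOne n G, coordOne n G) =
      (chartOne n G ((δ t)⁻¹ * ((γ t)⁻¹ * γ t) * ((δ t)⁻¹)⁻¹), chartOne n G ((δ t)⁻¹ * δ t)) := by
    rw [hw1, inv_mul_cancel]
  rw [e2] at hM
  have d3 := hM.comp_hasDerivAt t (d1.prodMk d2)
  refine (hasDerivAt_velocity hγδ).unique (d3.congr_of_eventuallyEq ?_)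
  filter_upwards [eventually_chartOne_symm_chartOne (n := n) hw.continuousAt hw1,
    eventually_chartOne_symm_chartOne (n := n) hv.continuousAt (inv_mul_cancel _)] with s h1 h2
  simp only [Function.comp_apply, chartMul, h1, h2]
  congr 1
  simp [mul_assoc]

/-- Multiply the curves pointwise: by invariance of `Q`, the Ad factor in `velocity_mul` does not
change the speed. This avoids concatenation, which would destroy differentiability. -/
theorem IsJoinedWithSpeed.mul {C C' : ℝ} {a b : G} (ha : IsJoinedWithSpeed Q C a)
    (hb : IsJoinedWithSpeed Q C' b) : IsJoinedWithSpeed Q (C + C') (a * b) := by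
  obtain ⟨γ, h1, h2, h3, h4⟩ := ha
  obtain ⟨δ, k1, k2, k3, k4⟩ := hb
  have : LieGroup (𝓡 n) 1 G := LieGroup.of_le (n := ∞) (by norm_num)
  refine ⟨fun s => γ s * δ s, h1.mul k1, by simp [h2, k2], by simp [h3, k3], fun t ht => ?_⟩
  rw [velocity_mul (h1.mdifferentiable (by simp) t) (k1.mdifferentiable (by simp) t)
    ((h1.mul k1).mdifferentiable (by simp) t)]
  refine (Q.norm_add_le _ _).trans (add_le_add ?_ (k4 t ht))
  rw [ScalarProduct.norm, Q.inv]
  exact h4 t ht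

/-- Nearby points are joined to 1 by a straight segment in the chart, whose left-translated velocity
is bounded through the derivative of (a, y) ↦ a⁻¹y near the diagonal. -/
theorem exists_eventually_isJoinedWithSpeed (Q : BiinvariantProduct n G) :
    ∃ C, 0 ≤ C ∧ ∀ᶠ a in 𝓝 (1 : G), IsJoinedWithSpeed Q C a := by
  obtain ⟨CQ, hCQ, hQ⟩ := Q.exists_norm_le
  have hf := contDiffAt_chartLeftDiv (n := n) (G := G)
  have hfd : ∀ᶠ p in 𝓝 (coordOne n G, coordOne n G), DifferentiableAt ℝ (chartLeftDiv n G) p :=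
    ((hf.of_le (m := 1) (by norm_num)).eventually (by simp)).mono
      fun p hp => hp.differentiableAt (by simp)
  have hfb : ∀ᶠ p in 𝓝 (coordOne n G, coordOne n G), ‖fderiv ℝ (chartLeftDiv n G) p‖ <
      ‖fderiv ℝ (chartLeftDiv n G) (coordOne n G, coordOne n G)‖ + 1 := by
    have h1 : ContinuousAt (fderiv ℝ (chartLeftDiv n G)) (coordOne n G, coordOne n G) :=
      ((hf.of_le (m := 1) (by norm_num)).fderiv_right (m := 0) (by norm_num)).continuousAt
    exact h1.norm.eventually (gt_mem_nhds (lt_add_one _))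
  set C₁ := ‖fderiv ℝ (chartLeftDiv n G) (coordOne n G, coordOne n G)‖ + 1 with hC₁
  have hdiag : Tendsto (fun x : EuclideanSpace ℝ (Fin n) => (x, x)) (𝓝 (coordOne n G))
      (𝓝 (coordOne n G, coordOne n G)) := by
    have : Continuous fun x : EuclideanSpace ℝ (Fin n) => (x, x) := by fun_prop
    exact this.continuousAt
  obtain ⟨r, hr, hball⟩ := Metric.eventually_nhds_iff_ball.mp
    ((hdiag.eventually (hfd.and hfb)).and (extChartAt_target_mem_nhds (I := 𝓡 n) (1 : G)))
  obtain ⟨D, hD⟩ := (isCompact_Icc (a := (0 : ℝ)) (b := 1)).exists_bound_of_continuousOn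
    (f := deriv Real.smoothTransition)
    ((Real.smoothTransition.contDiff (n := 1)).continuous_deriv (by simp)).continuousOn
  have hD0 : 0 ≤ D := (_root_.norm_nonneg _).trans (hD 0 (by simp))
  have hC₁0 : 0 ≤ C₁ := by positivity
  refine ⟨CQ * (C₁ * (D * r)), by positivity, ?_⟩
  have hnear : ∀ᶠ a in 𝓝 (1 : G), chartOne n G a ∈ Metric.ball (coordOne n G) r :=
    (continuousAt_extChartAt (I := 𝓡 n) (1 : G)) (Metric.ball_mem_nhds _ hr)
  filter_upwards [hnear, extChartAt_source_mem_nhds (I := 𝓡 n) (1 : G)] with a ha hsrc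
  set w := chartOne n G a - coordOne n G with hw
  have hwr : ‖w‖ < r := by rw [hw, ← dist_eq_norm]; exact ha
  -- The curve must be C¹ on all of ℝ and remain in the chart; the smooth transition, with values in
  -- [0, 1], keeps it on the segment for every `s`.
  set c : ℝ → EuclideanSpace ℝ (Fin n) := fun s => coordOne n G + Real.smoothTransition s • w with hc
  have hcball : ∀ s, c s ∈ Metric.ball (coordOne n G) r := by
    intro s
    have h1 := Real.smoothTransition.le_one s
    have h2 := Real.smoothTransition.nonneg s
    rw [Metric.mem_ball, dist_eq_norm, hc, add_sub_cancel_left, _root_.norm_smul,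
      Real.norm_of_nonneg h2]
    nlinarith [_root_.norm_nonneg w]
  have hcs : ContDiff ℝ 1 c := contDiff_const.add
    ((Real.smoothTransition.contDiff (n := 1)).smul contDiff_const)
  have hcd : ∀ s, HasDerivAt c (deriv Real.smoothTransition s • w) s := fun s =>
    ((((Real.smoothTransition.contDiff (n := 1)).differentiable (by simp)) s).hasDerivAt.smul_const
      w).const_add _
  have hγ : ContMDiff 𝓘(ℝ, ℝ) (𝓡 n) 1 fun s => (chartOne n G).symm (c s) := by
    have h1 : ContMDiffOn 𝓘(ℝ, EuclideanSpace ℝ (Fin n)) (𝓡 n) 1 (chartOne n G).symm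
        (chartOne n G).target :=
      (contMDiffOn_extChartAt_symm (I := 𝓡 n) (n := ∞) (1 : G)).of_le (by norm_num)
    exact h1.comp_contMDiff hcs.contMDiff fun s => (hball _ (hcball s)).2
  refine ⟨_, hγ, ?_, ?_, fun t ht => ?_⟩
  · simp only [hc, Real.smoothTransition.zero, zero_smul, add_zero]
    exact extChartAt_to_inv (I := 𝓡 n) (1 : G)
  · simp only [hc, Real.smoothTransition.one, one_smul, hw, add_sub_cancel]
    exact (chartOne n G).left_inv hsrc
  · obtain ⟨⟨h1, h2⟩, -⟩ := hball _ (hcball t)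
    have d1 : HasDerivAt (fun s => chartLeftDiv n G (c t, c s))
        (fderiv ℝ (chartLeftDiv n G) (c t, c t) (0, deriv Real.smoothTransition t • w)) t :=
      h1.hasFDerivAt.comp_hasDerivAt (f := fun s => (c t, c s)) t
        ((hasDerivAt_const t (c t)).prodMk (hcd t))
    have d2 := (hasDerivAt_velocity (hγ.mdifferentiable (by simp) t)).unique d1
    refine (hQ _).trans (mul_le_mul_of_nonneg_left ?_ hCQ)
    rw [d2]
    refine (ContinuousLinearMap.le_opNorm _ _).trans (mul_le_mul h2.le ?_ (_root_.norm_nonneg _) hC₁0)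
    rw [Prod.norm_mk, norm_zero, max_eq_right (_root_.norm_nonneg _), _root_.norm_smul]
    exact mul_le_mul (hD t ht) hwr.le (_root_.norm_nonneg _) hD0

end Velocity

/-! ### The diameter of a homogeneous space -/

section Diameter

theorem eventually_nhds_quotient_mk {G : Type*} [TopologicalSpace G]
    [Group G] [IsTopologicalGroup G] {K : Subgroup G} {V : Set G} (hV : V ∈ 𝓝 (1 : G)) (b : G) :
    ∀ᶠ q in 𝓝 (QuotientGroup.mk b : G ⧸ K), ∃ v ∈ V, q = QuotientGroup.mk (v * b) := by
  have h1 : (fun v => v * b) '' V ∈ 𝓝 b := by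
    have := (Homeomorph.mulRight b).isOpenMap.image_mem_nhds hV
    simpa using this
  filter_upwards [(QuotientGroup.isOpenMap_coe (N := K)).image_mem_nhds h1] with q hq
  obtain ⟨_, ⟨v, hv, rfl⟩, rfl⟩ := hq
  exact ⟨v, hv, rfl⟩

variable {n : ℕ} {G : Type*} [TopologicalSpace G] [ChartedSpace (EuclideanSpace ℝ (Fin n)) G]
  [Group G] {Q : BiinvariantProduct n G} {K : Subgroup G}

/-- Pythagoras: the complement `𝔨` of `𝔭` is its `Q`-orthogonal. -/
theorem norm_projection_le (Q : BiinvariantProduct n G) (K : Subgroup G) (X : LieAlg n G) :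
    Q.norm ((isotropyRep Q K).projectionOnto _ (isCompl_isotropyRep Q K) X : LieAlg n G) ≤
      Q.norm X := by
  set P : LieAlg n G := ((isotropyRep Q K).projectionOnto _ (isCompl_isotropyRep Q K) X :
    LieAlg n G) with hP
  have h1 : P ∈ isotropyRep Q K := Subtype.property _
  have h2 : X - P ∈ isotropyAlgebra n K := by
    rw [← Submodule.projectionOnto_apply_eq_zero_iff (isCompl_isotropyRep Q K), map_sub, hP,
      Submodule.projectionOnto_apply_left, sub_self]
  have h3 : Q.form (X - P) P = 0 := h1 _ h2
  have h4 : Q.form X X = Q.form P P + Q.form (X - P) (X - P) := by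
    have h5 : Q.form X X = Q.form (X - P + P) (X - P + P) := by rw [sub_add_cancel]
    rw [h5]
    simp only [map_add, LinearMap.add_apply]
    rw [h3, Q.symm P, h3]
    ring
  refine Real.sqrt_le_sqrt ?_
  rw [h4]
  linarith [Q.toScalarProduct.self_nonneg (X - P)]

theorem InvariantMetric.length_le {g : InvariantMetric Q K} {M C : ℝ} (hM : 0 ≤ M)
    (hg : ∀ X, g.form X X ≤ M * Q.form X X) {γ : ℝ → G}
    (hγ : ∀ t ∈ Icc (0 : ℝ) 1, Q.norm (InvariantMetric.velocity γ t) ≤ C) :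
    g.length γ ≤ ENNReal.ofReal (√M * C) := by
  have h1 : g.length γ ≤ ∫⁻ _ in Icc (0 : ℝ) 1, ENNReal.ofReal (√M * C) := by
    refine MeasureTheory.setLIntegral_mono' measurableSet_Icc fun t ht => ?_
    refine ENNReal.ofReal_le_ofReal ?_
    refine (Real.sqrt_le_sqrt (hg _)).trans ?_
    rw [Real.sqrt_mul hM]
    exact mul_le_mul_of_nonneg_left ((norm_projection_le Q K _).trans (hγ t ht)) (Real.sqrt_nonneg _)
  refine h1.trans (le_of_eq ?_)
  simp

variable [LieGroup (𝓡 n) ∞ G]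

/-- The points reached with speed at most `m * C` for some `m` form an open and closed set, hence
all of `G/K` by connectedness; compactness then selects one `m`. Only `G/K` is connected, so the
group itself could not be exhausted in this way. -/
theorem exists_isJoinedWithSpeed_mk_eq [CompactSpace G] [ConnectedSpace (G ⧸ K)]
    (Q : BiinvariantProduct n G) :
    ∃ C, 0 ≤ C ∧ ∀ p : G ⧸ K, ∃ a, IsJoinedWithSpeed Q C a ∧ QuotientGroup.mk a = p := by
  have : IsTopologicalGroup G := topologicalGroup_of_lieGroup (𝓡 n) ∞
  obtain ⟨C, hC, hev⟩ := exists_eventually_isJoinedWithSpeed Q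
  let A : ℕ → Set (G ⧸ K) := fun m => {p | ∃ a, IsJoinedWithSpeed Q (m * C) a ∧ QuotientGroup.mk a = p}
  have hA : ∀ m, A m = {p | ∃ a, IsJoinedWithSpeed Q (m * C) a ∧ QuotientGroup.mk a = p} :=
    fun m => rfl
  have hmono : ∀ m m', m ≤ m' → A m ⊆ A m' := by
    rintro m m' h p ⟨a, ha, rfl⟩
    exact ⟨a, ha.mono (by gcongr), rfl⟩
  -- Openness moves a reached point by v; closedness moves back by v⁻¹ from a reached point near a
  -- given one.
  have hV : {a : G | IsJoinedWithSpeed Q C a ∧ IsJoinedWithSpeed Q C a⁻¹} ∈ 𝓝 (1 : G) := by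
    have h1 : Tendsto (fun a : G => a⁻¹) (𝓝 1) (𝓝 1) := by
      simpa using (continuous_inv (G := G)).tendsto 1
    exact hev.and (h1.eventually hev)
  have hstep : ∀ m, ∀ p ∈ A m, ∀ᶠ q in 𝓝 p, q ∈ A (m + 1) := by
    rintro m p ⟨a, ha, rfl⟩
    filter_upwards [eventually_nhds_quotient_mk hV a] with q hq
    obtain ⟨v, hv, rfl⟩ := hq
    refine ⟨v * a, (hv.1.mul ha).mono ?_, rfl⟩
    push_cast
    linarith
  have hopen : IsOpen (⋃ m, A m) := by
    rw [isOpen_iff_mem_nhds]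
    intro p hp
    obtain ⟨m, hm⟩ := mem_iUnion.mp hp
    filter_upwards [hstep m p hm] with q hq
    exact mem_iUnion.mpr ⟨_, hq⟩
  have hclosed : IsClosed (⋃ m, A m) := by
    rw [← isOpen_compl_iff, isOpen_iff_mem_nhds]
    intro p hp
    obtain ⟨b, rfl⟩ := QuotientGroup.mk_surjective p
    filter_upwards [eventually_nhds_quotient_mk hV b] with q hq hq'
    obtain ⟨v, hv, rfl⟩ := hq
    obtain ⟨m, a, ha, hab⟩ := mem_iUnion.mp hq'
    refine hp (mem_iUnion.mpr ⟨m + 1, v⁻¹ * a, (hv.2.mul ha).mono (by push_cast; linarith), ?_⟩)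
    rw [QuotientGroup.eq] at hab ⊢
    simpa [mul_assoc] using hab
  have hone : IsJoinedWithSpeed Q ((0 : ℕ) * C + C) (1 : G) := by
    simpa using hev.self_of_nhds
  have huniv : (⋃ m, A m) = univ := by
    refine IsClopen.eq_univ ⟨hclosed, hopen⟩ ⟨QuotientGroup.mk 1, mem_iUnion.mpr ⟨1, 1, ?_, rfl⟩⟩
    simpa using hev.self_of_nhds
  obtain ⟨m, hm⟩ := isCompact_univ.elim_directed_cover (fun m => interior (A m))
    (fun m => isOpen_interior) (fun p _ => by
      obtain ⟨m, hm⟩ := mem_iUnion.mp (huniv ▸ mem_univ p : p ∈ ⋃ m, A m)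
      exact mem_iUnion.mpr ⟨m + 1, mem_interior_iff_mem_nhds.mpr (hstep m p hm)⟩)
    (directed_of_isDirected_le fun m m' h => interior_mono (hmono m m' h))
  exact ⟨m * C, by positivity, fun p => (interior_subset (hm (mem_univ p)) : p ∈ A m)⟩

/-- The diameter of `G/K` is controlled by the size of the metric. -/
theorem exists_diam_le [CompactSpace G] [ConnectedSpace (G ⧸ K)] (Q : BiinvariantProduct n G) :
    ∃ C, 0 ≤ C ∧ ∀ (g : InvariantMetric Q K) (M : ℝ), 0 ≤ M →
      (∀ X, g.form X X ≤ M * Q.form X X) → g.diam ≤ ENNReal.ofReal (√M * C) := by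
  obtain ⟨C, hC, h⟩ := exists_isJoinedWithSpeed_mk_eq (K := K) Q
  refine ⟨C, hC, fun g M hM hg => iSup_le fun p => iSup_le fun q => ?_⟩
  obtain ⟨a, rfl⟩ := QuotientGroup.mk_surjective p
  obtain ⟨b, rfl⟩ := QuotientGroup.mk_surjective q
  -- Left translation by `a` preserves velocities and carries a curve from the base point to a⁻¹bK
  -- into one from aK to bK.
  obtain ⟨u, ⟨γ, h1, h2, h3, h4⟩, hu⟩ := h (QuotientGroup.mk (a⁻¹ * b))
  have : LieGroup (𝓡 n) 1 G := LieGroup.of_le (n := ∞) (by norm_num)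
  have hsm : ContMDiff 𝓘(ℝ, ℝ) (𝓡 n) 1 fun s => a * γ s := contMDiff_const.mul h1
  have hc0 : (QuotientGroup.mk (a * γ 0) : G ⧸ K) = QuotientGroup.mk a := by rw [h2, mul_one]
  have hc1 : (QuotientGroup.mk (a * γ 1) : G ⧸ K) = QuotientGroup.mk b := by
    rw [h3]
    rw [QuotientGroup.eq] at hu ⊢
    simpa [mul_assoc] using hu
  have hd : g.dist (QuotientGroup.mk a) (QuotientGroup.mk b) ≤ g.length fun s => a * γ s :=
    (iInf_le _ _).trans ((iInf_le _ hsm).trans ((iInf_le _ hc0).trans (iInf_le _ hc1)))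
  refine hd.trans (InvariantMetric.length_le hM hg (C := C) fun t ht => ?_)
  have := velocity_const_mul (h1.mdifferentiable (by simp) t) a
  change Q.norm (coords (InvariantMetric.velocity (n := n) (fun s => a * γ s) t)) ≤ C
  rw [this]
  exact h4 t ht

end Diameter

/-! ### Orthogonal projections and traces -/

namespace ScalarProduct

variable {V : Type*} [AddCommGroup V] [Module ℝ V]

/-- `V = W₁ ⊕ W₂ ⊕ U` with orthogonal summands, and `W = W₁ ⊕ W₂`. -/
structure IsOrthDecomp (Q : ScalarProduct V) (W U W₁ W₂ : Submodule ℝ V) : Prop where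
  sup_eq : W₁ ⊔ W₂ = W
  orth : ∀ X ∈ W₁, ∀ Y ∈ W₂, Q.form X Y = 0
  eq_orthogonal : W = Q.form.orthogonal U

namespace IsOrthDecomp

variable {Q : ScalarProduct V} {W U W₁ W₂ : Submodule ℝ V} (D : Q.IsOrthDecomp W U W₁ W₂)
include D

theorem swap : Q.IsOrthDecomp W U W₂ W₁ :=
  ⟨by rw [sup_comm, D.sup_eq], fun X hX Y hY => by rw [Q.symm, D.orth Y hY X hX], D.eq_orthogonal⟩

theorem left_le : W₁ ≤ W := D.sup_eq ▸ le_sup_left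

theorem right_le : W₂ ≤ W := D.sup_eq ▸ le_sup_right

theorem form_eq_zero {X Y : V} (hX : X ∈ U) (hY : Y ∈ W) : Q.form X Y = 0 := by
  rw [D.eq_orthogonal] at hY
  exact hY X hX

end IsOrthDecomp

variable [FiniteDimensional ℝ V] (Q : ScalarProduct V)

theorem onb_apply (i j : Fin (Module.finrank ℝ V)) :
    Q.form (Q.onb i) (Q.onb j) = if i = j then 1 else 0 :=
  Q.exists_orthonormal_basis.choose_spec i j

theorem onb_repr (X : V) (i : Fin (Module.finrank ℝ V)) : Q.onb.repr X i = Q.form X (Q.onb i) := by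
  have h : Q.form X (Q.onb i) = ∑ j, Q.onb.repr X j * Q.form (Q.onb j) (Q.onb i) := by
    conv_lhs => rw [← Q.onb.sum_repr X]
    simp only [map_sum, map_smul, LinearMap.sum_apply, LinearMap.smul_apply, smul_eq_mul]
  rw [h]
  simp [onb_apply]

theorem trace_eq_sum (T : V →ₗ[ℝ] V) :
    LinearMap.trace ℝ V T = ∑ i, Q.form (T (Q.onb i)) (Q.onb i) := by
  rw [LinearMap.trace_eq_matrix_trace ℝ Q.onb, Matrix.trace]
  simp [LinearMap.toMatrix_apply, onb_repr]

/-- The hypothesis says that `T'` is the `Q`-adjoint of `T`; the next two lemmas then concern the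
Hilbert–Schmidt norm tr(T T*). -/
theorem trace_eq_of_adjoint {T T' : V →ₗ[ℝ] V} (h : ∀ X Y, Q.form (T X) Y = Q.form X (T' Y)) :
    LinearMap.trace ℝ V T = LinearMap.trace ℝ V T' := by
  rw [Q.trace_eq_sum, Q.trace_eq_sum]
  exact Finset.sum_congr rfl fun i _ => by rw [h, Q.symm]

theorem trace_adjoint_mul_nonneg {T T' : V →ₗ[ℝ] V}
    (h : ∀ X Y, Q.form (T X) Y = Q.form X (T' Y)) : 0 ≤ LinearMap.trace ℝ V (T ∘ₗ T') := by
  rw [Q.trace_eq_sum]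
  refine Finset.sum_nonneg fun i _ => ?_
  rw [LinearMap.comp_apply, h]
  exact Q.self_nonneg _

theorem eq_zero_of_trace_adjoint_mul {T T' : V →ₗ[ℝ] V}
    (h : ∀ X Y, Q.form (T X) Y = Q.form X (T' Y)) (h0 : LinearMap.trace ℝ V (T ∘ₗ T') = 0) :
    T' = 0 := by
  rw [Q.trace_eq_sum] at h0
  refine Q.onb.ext fun i => ?_
  have h1 := (Finset.sum_eq_zero_iff_of_nonneg fun i _ => ?_).mp h0 i (Finset.mem_univ i)
  · rw [LinearMap.comp_apply, h] at h1
    exact Q.eq_zero_of_self h1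
  · rw [LinearMap.comp_apply, h]
    exact Q.self_nonneg _

/-- The orthogonal projection onto `W`. -/
noncomputable def orthProj (W : Submodule ℝ V) : V →ₗ[ℝ] V :=
  W.projection (Q.form.orthogonal W) (Q.isCompl_orthogonal W).symm

variable {Q} {W W' : Submodule ℝ V}

theorem orthProj_mem (X : V) : Q.orthProj W X ∈ W := by
  rw [orthProj, ← Submodule.coe_projectionOnto_apply]
  exact Subtype.property _

theorem orthProj_of_mem {X : V} (h : X ∈ W) : Q.orthProj W X = X := by
  rw [orthProj, ← Submodule.coe_projectionOnto_apply]
  exact congrArg Subtype.val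
    (Submodule.projectionOnto_apply_left (Q.isCompl_orthogonal W).symm ⟨X, h⟩)

theorem orthProj_of_orthogonal {X : V} (h : ∀ Y ∈ W, Q.form Y X = 0) : Q.orthProj W X = 0 := by
  rw [orthProj, ← Submodule.coe_projectionOnto_apply,
    (Submodule.projectionOnto_apply_eq_zero_iff (Q.isCompl_orthogonal W).symm).mpr h]
  rfl

theorem form_sub_orthProj (X : V) {Y : V} (hY : Y ∈ W) : Q.form Y (X - Q.orthProj W X) = 0 := by
  have h : X - Q.orthProj W X ∈ Q.form.orthogonal W := by
    rw [← Submodule.projectionOnto_apply_eq_zero_iff (Q.isCompl_orthogonal W).symm, map_sub,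
      orthProj, Submodule.projectionOnto_projection, sub_self]
  exact h Y hY

theorem orthProj_symm (X Y : V) : Q.form (Q.orthProj W X) Y = Q.form X (Q.orthProj W Y) := by
  have h1 := form_sub_orthProj (Q := Q) Y (orthProj_mem (Q := Q) (W := W) X)
  have h2 := form_sub_orthProj (Q := Q) X (orthProj_mem (Q := Q) (W := W) Y)
  rw [map_sub, sub_eq_zero] at h1 h2
  rw [h1, Q.symm X, h2, Q.symm]

theorem orthProj_idem (X : V) : Q.orthProj W (Q.orthProj W X) = Q.orthProj W X :=
  orthProj_of_mem (orthProj_mem X)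

theorem orthProj_unique {X Y : V} (hY : Y ∈ W) (h : ∀ Z ∈ W, Q.form Z (X - Y) = 0) :
    Q.orthProj W X = Y := by
  have h1 := orthProj_of_orthogonal h
  rw [map_sub, orthProj_of_mem hY, sub_eq_zero] at h1
  exact h1

namespace IsOrthDecomp

variable {W U W₁ W₂ : Submodule ℝ V} (D : Q.IsOrthDecomp W U W₁ W₂)
include D

theorem proj_left_right (X : V) : Q.orthProj W₁ (Q.orthProj W₂ X) = 0 :=
  orthProj_of_orthogonal fun Y hY => D.orth Y hY _ (orthProj_mem X)

theorem proj_right_left (X : V) : Q.orthProj W₂ (Q.orthProj W₁ X) = 0 := D.swap.proj_left_right X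

theorem proj_add (X : V) : Q.orthProj W X = Q.orthProj W₁ X + Q.orthProj W₂ X := by
  refine orthProj_unique (W.add_mem (D.left_le (orthProj_mem X)) (D.right_le (orthProj_mem X))) ?_
  intro Z hZ
  rw [← D.sup_eq] at hZ
  obtain ⟨Z₁, h1, Z₂, h2, rfl⟩ := Submodule.mem_sup.mp hZ
  have e1 := form_sub_orthProj (Q := Q) X h1
  have e2 := form_sub_orthProj (Q := Q) X h2
  have e3 := D.orth _ h1 _ (orthProj_mem (Q := Q) X)
  have e4 := D.swap.orth _ h2 _ (orthProj_mem (Q := Q) X)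
  simp only [map_add, map_sub, LinearMap.add_apply] at *
  linarith

theorem proj_compl (X : V) : Q.orthProj U X = X - Q.orthProj W X := by
  have h : X - Q.orthProj U X ∈ W := by
    rw [D.eq_orthogonal]
    exact fun Y hY => form_sub_orthProj X hY
  have h2 : Q.orthProj W X = X - Q.orthProj U X :=
    orthProj_unique h fun Z hZ => by
      rw [sub_sub_cancel, Q.symm, D.form_eq_zero (orthProj_mem X) hZ]
  rw [h2, sub_sub_cancel]

theorem projectionOnto_eq (h : IsCompl W U) (X : V) :
    (W.projectionOnto U h X : V) = Q.orthProj W X := by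
  have h1 : X - Q.orthProj W X ∈ U := by
    rw [← D.proj_compl]
    exact orthProj_mem X
  have h2 := (Submodule.projectionOnto_apply_eq_zero_iff h).mpr h1
  rw [map_sub, sub_eq_zero] at h2
  rw [h2]
  exact congrArg Subtype.val (Submodule.projectionOnto_apply_left h ⟨_, orthProj_mem X⟩)

end IsOrthDecomp

end ScalarProduct

/-! ### The Ricci tensor of a diagonal metric -/

section TraceAlgebra

variable {R : Type*} [Ring R] [Algebra ℝ R]

/-- The noncommutative algebra behind the formula for the Ricci tensor. -/
theorem ricci_trace_identity (tr : R →ₗ[ℝ] ℝ) (hcomm : ∀ a b, tr (a * b) = tr (b * a))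
    {p q k D E : R} (hp : p * p = p) (hq : q * q = q) (hpq : p * q = 0) (hqp : q * p = 0)
    (hsymm : tr (q * (D * (p * E))) = tr (p * (D * (q * E))))
    {x₁ x₂ : ℝ} (hx₁ : x₁ ≠ 0) (hx₂ : x₂ ≠ 0) (xa xd : ℝ) :
    tr (((1 / 2 : ℝ) • ((p + q) * D + (x₁⁻¹ • p + x₂⁻¹ • q) * D * (x₁ • p + x₂ • q)
        - xa • ((x₁⁻¹ • p + x₂⁻¹ • q) * D)))
      * ((1 / 2 : ℝ) • ((p + q) * E * (p + q) + xd • ((x₁⁻¹ • p + x₂⁻¹ • q) * E * (p + q))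
        - (x₁⁻¹ • p + x₂⁻¹ • q) * E * (x₁ • p + x₂ • q))))
      - tr (((1 / 2 : ℝ) • ((p + q) * E * (p + q) + xd • ((x₁⁻¹ • p + x₂⁻¹ • q) * E * (p + q))
        - (x₁⁻¹ • p + x₂⁻¹ • q) * E * (x₁ • p + x₂ • q))) * D * (p + q))
      - tr ((p + q) * E * k * D * (p + q)) =
    -(xa * xd / (4 * x₁ ^ 2)) * tr (p * (D * (p * E)))
      - (xa * xd / (4 * x₂ ^ 2)) * tr (q * (D * (q * E)))
      + (((x₂ - x₁) ^ 2 - xa * xd) / (2 * x₁ * x₂)) * tr (p * (D * (q * E)))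
      - tr (p * (E * (k * D))) - tr (q * (E * (k * D))) := by
  have hpp : ∀ z, p * (p * z) = p * z := fun z => by rw [← mul_assoc, hp]
  have hqq : ∀ z, q * (q * z) = q * z := fun z => by rw [← mul_assoc, hq]
  have hpq' : ∀ z, p * (q * z) = 0 := fun z => by rw [← mul_assoc, hpq, zero_mul]
  have hqp' : ∀ z, q * (p * z) = 0 := fun z => by rw [← mul_assoc, hqp, zero_mul]
  -- Cyclicity brings a trailing projection to the front, where orthogonality and idempotence apply.
  -- All traces are thus reduced to a short list of normal forms and comparing coefficients is
  -- commutative algebra.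
  have c1 : ∀ r s t, tr (r * (D * (s * (E * t)))) = tr (t * (r * (D * (s * E)))) := fun r s t => by
    rw [hcomm t]; simp only [mul_assoc]
  have c2 : ∀ r s t, tr (r * (E * (s * (D * t)))) = tr (t * (r * (E * (s * D)))) := fun r s t => by
    rw [hcomm t]; simp only [mul_assoc]
  have c3 : ∀ r s, tr (r * (E * (s * D))) = tr (s * (D * (r * E))) := fun r s => by
    rw [← mul_assoc, hcomm, mul_assoc]
  have e1 := c3 p p
  have e2 := c3 q q
  have e3 := (c3 p q).trans hsymm
  have e4 := c3 q p
  simp only [mul_add, add_mul, mul_sub, sub_mul, smul_mul_assoc, mul_smul_comm, map_add, map_sub,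
    map_smul, smul_add, smul_sub, mul_assoc, hpp, hqq, hpq', hqp', mul_zero,
    smul_zero, add_zero, zero_add, smul_eq_mul, c1, c2, map_zero, e1, e2, e3, e4, hsymm]
  field_simp
  ring

end TraceAlgebra

/-! ### The block forms -tr(π ad π' ad) and their positivity -/

section DiagonalMetric

variable {𝔤 : Type*} [LieRing 𝔤] [LieAlgebra ℝ 𝔤]

/-- `Q` is `ad`-invariant. -/
def ScalarProduct.IsLieInvariant (Q : ScalarProduct 𝔤) : Prop :=
  ∀ X Y Z : 𝔤, Q.form ⁅X, Y⁆ Z = -Q.form Y ⁅X, Z⁆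

variable [FiniteDimensional ℝ 𝔤]

/-- The form `(Y, Z) ↦ -tr(π_W ad_Y π_W' ad_Z)`. -/
noncomputable def blockForm (Q : ScalarProduct 𝔤) (W W' : Submodule ℝ 𝔤) :
    LinearMap.BilinForm ℝ 𝔤 :=
  LinearMap.mk₂ ℝ (fun Y Z => -LinearMap.trace ℝ 𝔤
    (Q.orthProj W * (LieAlgebra.ad ℝ 𝔤 Y * (Q.orthProj W' * LieAlgebra.ad ℝ 𝔤 Z))))
    (by intros; simp [add_mul, mul_add]; ring) (by intros; simp)
    (by intros; simp [mul_add]; ring) (by intros; simp)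

theorem blockForm_apply (Q : ScalarProduct 𝔤) (W W' : Submodule ℝ 𝔤) (Y Z : 𝔤) :
    blockForm Q W W' Y Z = -LinearMap.trace ℝ 𝔤
      (Q.orthProj W * (LieAlgebra.ad ℝ 𝔤 Y * (Q.orthProj W' * LieAlgebra.ad ℝ 𝔤 Z))) := rfl

/-- When ad is `Q`-skew, the second factor is the adjoint of the first (`adjoint_block`). So this is
the square of a Hilbert–Schmidt norm: nonnegative, and zero only if the block of ad Y vanishes. -/
theorem blockForm_self_eq (Q : ScalarProduct 𝔤) (W W' : Submodule ℝ 𝔤) (Y : 𝔤) :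
    blockForm Q W W' Y Y = LinearMap.trace ℝ 𝔤
    ((Q.orthProj W * LieAlgebra.ad ℝ 𝔤 Y * Q.orthProj W') ∘ₗ
      (-(Q.orthProj W' * LieAlgebra.ad ℝ 𝔤 Y * Q.orthProj W))) := by
  have hp : ∀ (U : Submodule ℝ 𝔤) z, Q.orthProj U * (Q.orthProj U * z) = Q.orthProj U * z := by
    intro U z
    ext X
    simp [ScalarProduct.orthProj_idem]
  rw [blockForm_apply, ← Module.End.mul_eq_comp, mul_neg, map_neg]
  congr 1
  simp only [mul_assoc]
  rw [hp]
  have h : Q.orthProj W * (LieAlgebra.ad ℝ 𝔤 Y * (Q.orthProj W' * (LieAlgebra.ad ℝ 𝔤 Y *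
      Q.orthProj W))) = (Q.orthProj W * (LieAlgebra.ad ℝ 𝔤 Y * (Q.orthProj W' *
      LieAlgebra.ad ℝ 𝔤 Y))) * Q.orthProj W := by simp only [mul_assoc]
  rw [h, LinearMap.trace_mul_comm ℝ _ (Q.orthProj W), hp]

variable {Q : ScalarProduct 𝔤} (hQ : Q.IsLieInvariant) (W W' : Submodule ℝ 𝔤)
include hQ

/-- The adjoint of symmetric times skew is minus skew times symmetric, so the trace equals its own
negative. -/
theorem trace_symm_mul_ad {S : Module.End ℝ 𝔤} (hS : ∀ X Y, Q.form (S X) Y = Q.form X (S Y))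
    (V : 𝔤) : LinearMap.trace ℝ 𝔤 (S * LieAlgebra.ad ℝ 𝔤 V) = 0 := by
  have h : LinearMap.trace ℝ 𝔤 (S * LieAlgebra.ad ℝ 𝔤 V) =
      LinearMap.trace ℝ 𝔤 (-(LieAlgebra.ad ℝ 𝔤 V * S)) :=
    Q.trace_eq_of_adjoint fun X Y => by
      simp only [Module.End.mul_apply, LinearMap.neg_apply, LieAlgebra.ad_apply, map_neg]
      rw [hS, hQ]
  rw [map_neg, LinearMap.trace_mul_comm ℝ (LieAlgebra.ad ℝ 𝔤 V) S] at h
  linarith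

theorem blockForm_symm (Y Z : 𝔤) : blockForm Q W W' Y Z = blockForm Q W W' Z Y := by
  have h : LinearMap.trace ℝ 𝔤
      (Q.orthProj W * (LieAlgebra.ad ℝ 𝔤 Y * (Q.orthProj W' * LieAlgebra.ad ℝ 𝔤 Z))) =
      LinearMap.trace ℝ 𝔤
      (LieAlgebra.ad ℝ 𝔤 Z * (Q.orthProj W' * (LieAlgebra.ad ℝ 𝔤 Y * Q.orthProj W))) :=
    Q.trace_eq_of_adjoint fun X V => by
      simp only [Module.End.mul_apply, LieAlgebra.ad_apply]
      rw [ScalarProduct.orthProj_symm, hQ, ScalarProduct.orthProj_symm, hQ, neg_neg]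
  rw [blockForm_apply, h, blockForm_apply, ← mul_assoc, ← mul_assoc, LinearMap.trace_mul_comm]
  simp only [mul_assoc]

theorem blockForm_comm (Y Z : 𝔤) : blockForm Q W W' Y Z = blockForm Q W' W Y Z := by
  rw [blockForm_symm hQ W' W, blockForm_apply, blockForm_apply, ← mul_assoc,
    LinearMap.trace_mul_comm, mul_assoc]

theorem adjoint_block (Y X V : 𝔤) :
    Q.form ((Q.orthProj W * LieAlgebra.ad ℝ 𝔤 Y * Q.orthProj W') X) V =
      Q.form X ((-(Q.orthProj W' * LieAlgebra.ad ℝ 𝔤 Y * Q.orthProj W)) V) := by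
  simp only [Module.End.mul_apply, LieAlgebra.ad_apply, LinearMap.neg_apply, map_neg]
  rw [ScalarProduct.orthProj_symm, hQ, ScalarProduct.orthProj_symm]

theorem blockForm_self_nonneg (Y : 𝔤) : 0 ≤ blockForm Q W W' Y Y := by
  rw [blockForm_self_eq]
  exact Q.trace_adjoint_mul_nonneg (adjoint_block hQ W W' Y)

theorem orthProj_lie_eq_zero_of_blockForm {Y : 𝔤} (h : blockForm Q W W' Y Y = 0) {X : 𝔤}
    (hX : X ∈ W) : Q.orthProj W' ⁅Y, X⁆ = 0 := by
  rw [blockForm_self_eq] at h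
  have h1 := Q.eq_zero_of_trace_adjoint_mul (adjoint_block hQ W W' Y) h
  have h2 := congrArg (fun T : Module.End ℝ 𝔤 => T X) (neg_eq_zero.mp h1)
  simpa [ScalarProduct.orthProj_of_mem hX] using h2

end DiagonalMetric

/-! ### The Levi-Civita connection and Ricci tensor of a diagonal metric as operators on `𝔤` -/

section RicciDiagonal

variable {𝔤 : Type*} [LieRing 𝔤] [LieAlgebra ℝ 𝔤] [FiniteDimensional ℝ 𝔤]

theorem symmPart_form {𝔭 𝔨 : Submodule ℝ 𝔤} (h : IsCompl 𝔭 𝔨) (g : ScalarProduct 𝔭) (X Y Z : 𝔭) :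
    g.form (symmPart h g X Y) Z =
      (1 / 2) * (g.form Y (bracketP h Z X) + g.form X (bracketP h Z Y)) := by
  have h1 : g.form (symmPart h g X Y) = g.form.toDual g.nondegenerate (symmPart h g X Y) := by
    ext; rw [LinearMap.BilinForm.toDual_def]
  rw [h1]
  simp only [symmPart, LinearMap.mk₂_apply, LinearEquiv.apply_symm_apply]
  simp
  ring

variable {Q : ScalarProduct 𝔤} (hQ : Q.IsLieInvariant) {𝔭 𝔨 𝔭₁ 𝔭₂ : Submodule ℝ 𝔤}
  (D : Q.IsOrthDecomp 𝔭 𝔨 𝔭₁ 𝔭₂) (h : IsCompl 𝔭 𝔨) {g : ScalarProduct 𝔭} {x₁ x₂ : ℝ}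

/-- The operator `x₁` on `𝔭₁`, `x₂` on `𝔭₂`, `0` on the complement. -/
noncomputable def diagOp (Q : ScalarProduct 𝔤) (𝔭₁ 𝔭₂ : Submodule ℝ 𝔤) (x₁ x₂ : ℝ) :
    Module.End ℝ 𝔤 :=
  x₁ • Q.orthProj 𝔭₁ + x₂ • Q.orthProj 𝔭₂

/-- `g = x₁ Q|_{𝔭₁} ⊕ x₂ Q|_{𝔭₂}`, expressed by orthogonal projections. -/
def IsDiagonal (Q : ScalarProduct 𝔤) {𝔭 : Submodule ℝ 𝔤} (𝔭₁ 𝔭₂ : Submodule ℝ 𝔤)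
    (g : ScalarProduct 𝔭) (x₁ x₂ : ℝ) : Prop :=
  ∀ X Y : 𝔭, g.form X Y = Q.form (diagOp Q 𝔭₁ 𝔭₂ x₁ x₂ X) Y

theorem diagOp_apply (Q : ScalarProduct 𝔤) (𝔭₁ 𝔭₂ : Submodule ℝ 𝔤) (x₁ x₂ : ℝ) (X : 𝔤) :
    diagOp Q 𝔭₁ 𝔭₂ x₁ x₂ X = x₁ • Q.orthProj 𝔭₁ X + x₂ • Q.orthProj 𝔭₂ X := rfl

theorem diagOp_symm (Q : ScalarProduct 𝔤) (𝔭₁ 𝔭₂ : Submodule ℝ 𝔤) (x₁ x₂ : ℝ) (X Y : 𝔤) :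
    Q.form (diagOp Q 𝔭₁ 𝔭₂ x₁ x₂ X) Y = Q.form X (diagOp Q 𝔭₁ 𝔭₂ x₁ x₂ Y) := by
  simp [diagOp_apply, ScalarProduct.orthProj_symm]

include D in
theorem diagOp_mem (x₁ x₂ : ℝ) (X : 𝔤) : diagOp Q 𝔭₁ 𝔭₂ x₁ x₂ X ∈ 𝔭 :=
  𝔭.add_mem (𝔭.smul_mem _ (D.left_le (ScalarProduct.orthProj_mem X)))
    (𝔭.smul_mem _ (D.right_le (ScalarProduct.orthProj_mem X)))

include D in
theorem diagOp_diagOp (x₁ x₂ y₁ y₂ : ℝ) (X : 𝔤) :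
    diagOp Q 𝔭₁ 𝔭₂ x₁ x₂ (diagOp Q 𝔭₁ 𝔭₂ y₁ y₂ X) = diagOp Q 𝔭₁ 𝔭₂ (x₁ * y₁) (x₂ * y₂) X := by
  simp [diagOp_apply, ScalarProduct.orthProj_idem, D.proj_left_right, D.proj_right_left, smul_smul]

include D in
theorem diagOp_one_one (X : 𝔤) : diagOp Q 𝔭₁ 𝔭₂ 1 1 X = Q.orthProj 𝔭 X := by
  simp [diagOp_apply, D.proj_add]

include D in
theorem bracketP_eq (X Y : 𝔭) : (bracketP h X Y : 𝔤) = Q.orthProj 𝔭 ⁅(X : 𝔤), (Y : 𝔤)⁆ :=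
  D.projectionOnto_eq h _

include hQ D in
-- With A the diagonal operator of `g`, skewness of ad moves the test vector out of the brackets in
-- the definition of U and leaves 2AU as the `𝔭`-part of [X, AY] - [AX, Y]. Then A is inverted on
-- `𝔭`.
theorem symmPart_eq (hx₁ : x₁ ≠ 0) (hx₂ : x₂ ≠ 0) (hg : IsDiagonal Q 𝔭₁ 𝔭₂ g x₁ x₂) (X Y : 𝔭) :
    (symmPart h g X Y : 𝔤) = (1 / 2 : ℝ) • diagOp Q 𝔭₁ 𝔭₂ x₁⁻¹ x₂⁻¹
      (⁅(X : 𝔤), diagOp Q 𝔭₁ 𝔭₂ x₁ x₂ Y⁆ - ⁅diagOp Q 𝔭₁ 𝔭₂ x₁ x₂ X, (Y : 𝔤)⁆) := by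
  set A := diagOp Q 𝔭₁ 𝔭₂ x₁ x₂ with hA
  set V : 𝔤 := ⁅(X : 𝔤), A Y⁆ - ⁅A X, (Y : 𝔤)⁆ with hV
  have h1 : ∀ Z : 𝔭, Q.form (A (symmPart h g X Y)) Z = Q.form ((1 / 2 : ℝ) • V) Z := by
    intro Z
    rw [← hg, symmPart_form, hg, hg, bracketP_eq D, bracketP_eq D]
    have h2 : ∀ U V : 𝔤, Q.form (A U) (Q.orthProj 𝔭 V) = Q.form (A U) V := by
      intro U V
      rw [← ScalarProduct.orthProj_symm, ScalarProduct.orthProj_of_mem (diagOp_mem D _ _ _)]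
    rw [h2, h2, hV]
    have h3 := hQ (X : 𝔤) (A Y) Z
    have h4 := hQ (Y : 𝔤) (A X) Z
    rw [← lie_skew (A (X : 𝔤)), ← lie_skew (Z : 𝔤) (X : 𝔤), ← lie_skew (Z : 𝔤) (Y : 𝔤)]
    simp only [map_sub, map_smul, LinearMap.sub_apply, LinearMap.smul_apply, map_neg,
      LinearMap.neg_apply, smul_eq_mul]
    linarith
  have h5 : A (symmPart h g X Y) = Q.orthProj 𝔭 ((1 / 2 : ℝ) • V) := by
    refine (ScalarProduct.orthProj_unique (diagOp_mem D _ _ _) fun Z hZ => ?_).symm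
    rw [map_sub, sub_eq_zero, Q.symm, ← h1 ⟨Z, hZ⟩, Q.symm]
  have h6 := congrArg (diagOp Q 𝔭₁ 𝔭₂ x₁⁻¹ x₂⁻¹) h5
  rw [hA, diagOp_diagOp D, inv_mul_cancel₀ hx₁, inv_mul_cancel₀ hx₂, diagOp_one_one D,
    ScalarProduct.orthProj_of_mem (Subtype.property _), ← diagOp_one_one D, diagOp_diagOp D,
    mul_one, mul_one, map_smul] at h6
  exact h6

include hQ D in
theorem leviCivita_eq (hx₁ : x₁ ≠ 0) (hx₂ : x₂ ≠ 0) (hg : IsDiagonal Q 𝔭₁ 𝔭₂ g x₁ x₂) (X Y : 𝔭) :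
    (leviCivita h g X Y : 𝔤) = (1 / 2 : ℝ) • (Q.orthProj 𝔭 ⁅(X : 𝔤), (Y : 𝔤)⁆ +
      diagOp Q 𝔭₁ 𝔭₂ x₁⁻¹ x₂⁻¹
      (⁅(X : 𝔤), diagOp Q 𝔭₁ 𝔭₂ x₁ x₂ Y⁆ - ⁅diagOp Q 𝔭₁ 𝔭₂ x₁ x₂ X, (Y : 𝔤)⁆)) := by
  simp only [leviCivita, LinearMap.add_apply, LinearMap.smul_apply, Submodule.coe_add,
    Submodule.coe_smul, symmPart_eq hQ D h hx₁ hx₂ hg, bracketP_eq D, smul_add]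

/-- `X ↦ -Λ(X)W`, extended by zero. -/
noncomputable def negLeviCivitaRight (Q : ScalarProduct 𝔤) (𝔭₁ 𝔭₂ : Submodule ℝ 𝔤) (x₁ x₂ : ℝ)
    (W : 𝔤) : Module.End ℝ 𝔤 :=
  (1 / 2 : ℝ) • ((Q.orthProj 𝔭₁ + Q.orthProj 𝔭₂) * LieAlgebra.ad ℝ 𝔤 W *
      (Q.orthProj 𝔭₁ + Q.orthProj 𝔭₂)
    + diagOp Q 𝔭₁ 𝔭₂ x₁⁻¹ x₂⁻¹ * LieAlgebra.ad ℝ 𝔤 (diagOp Q 𝔭₁ 𝔭₂ x₁ x₂ W) *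
      (Q.orthProj 𝔭₁ + Q.orthProj 𝔭₂)
    - diagOp Q 𝔭₁ 𝔭₂ x₁⁻¹ x₂⁻¹ * LieAlgebra.ad ℝ 𝔤 W * diagOp Q 𝔭₁ 𝔭₂ x₁ x₂)

/-- `W ↦ Λ(Y)W` on `𝔭`. -/
noncomputable def leviCivitaLeft (Q : ScalarProduct 𝔤) (𝔭₁ 𝔭₂ : Submodule ℝ 𝔤) (x₁ x₂ : ℝ)
    (Y : 𝔤) : Module.End ℝ 𝔤 :=
  (1 / 2 : ℝ) • ((Q.orthProj 𝔭₁ + Q.orthProj 𝔭₂) * LieAlgebra.ad ℝ 𝔤 Y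
    + diagOp Q 𝔭₁ 𝔭₂ x₁⁻¹ x₂⁻¹ * LieAlgebra.ad ℝ 𝔤 Y * diagOp Q 𝔭₁ 𝔭₂ x₁ x₂
    - diagOp Q 𝔭₁ 𝔭₂ x₁⁻¹ x₂⁻¹ * LieAlgebra.ad ℝ 𝔤 (diagOp Q 𝔭₁ 𝔭₂ x₁ x₂ Y))

include hQ D in
theorem leviCivita_eq_left (hx₁ : x₁ ≠ 0) (hx₂ : x₂ ≠ 0) (hg : IsDiagonal Q 𝔭₁ 𝔭₂ g x₁ x₂)
    (Y W : 𝔭) : (leviCivita h g Y W : 𝔤) = leviCivitaLeft Q 𝔭₁ 𝔭₂ x₁ x₂ Y W := by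
  rw [leviCivita_eq hQ D h hx₁ hx₂ hg, D.proj_add]
  simp only [leviCivitaLeft, LinearMap.add_apply, LinearMap.smul_apply, LinearMap.sub_apply,
    Module.End.mul_apply, LieAlgebra.ad_apply, map_sub]
  congr 1
  abel

include hQ D in
theorem leviCivita_eq_right (hx₁ : x₁ ≠ 0) (hx₂ : x₂ ≠ 0) (hg : IsDiagonal Q 𝔭₁ 𝔭₂ g x₁ x₂)
    (X W : 𝔭) : (leviCivita h g X W : 𝔤) = -negLeviCivitaRight Q 𝔭₁ 𝔭₂ x₁ x₂ W X := by
  have hp : Q.orthProj 𝔭₁ (X : 𝔤) + Q.orthProj 𝔭₂ X = X := by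
    rw [← D.proj_add, ScalarProduct.orthProj_of_mem X.2]
  rw [leviCivita_eq hQ D h hx₁ hx₂ hg, D.proj_add]
  simp only [negLeviCivitaRight, LinearMap.add_apply, LinearMap.smul_apply, LinearMap.sub_apply,
    Module.End.mul_apply, LieAlgebra.ad_apply, hp]
  rw [← lie_skew (W : 𝔤), ← lie_skew (diagOp Q 𝔭₁ 𝔭₂ x₁ x₂ W),
    ← lie_skew (W : 𝔤) (diagOp Q 𝔭₁ 𝔭₂ x₁ x₂ X)]
  simp only [map_sub, map_neg, ← smul_neg]
  congr 1
  abel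

include hQ D in
-- Each summand is a diagonal operator, an ad, and another diagonal operator; cyclically this is
-- symmetric times skew. It removes the term Λ(X)Λ(Y)Z from the Ricci trace.
theorem trace_negLeviCivitaRight (x₁ x₂ : ℝ) (W : 𝔤) :
    LinearMap.trace ℝ 𝔤 (negLeviCivitaRight Q 𝔭₁ 𝔭₂ x₁ x₂ W) = 0 := by
  have hpi : ∀ X, (Q.orthProj 𝔭₁ + Q.orthProj 𝔭₂) X = diagOp Q 𝔭₁ 𝔭₂ 1 1 X := by
    intro X; simp [diagOp_apply]
  have hpi' : (Q.orthProj 𝔭₁ + Q.orthProj 𝔭₂) = diagOp Q 𝔭₁ 𝔭₂ 1 1 := LinearMap.ext hpi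
  have key : ∀ (a b c d : ℝ) (V : 𝔤), LinearMap.trace ℝ 𝔤
      (diagOp Q 𝔭₁ 𝔭₂ a b * LieAlgebra.ad ℝ 𝔤 V * diagOp Q 𝔭₁ 𝔭₂ c d) = 0 := by
    intro a b c d V
    rw [LinearMap.trace_mul_comm, ← mul_assoc]
    refine trace_symm_mul_ad hQ (fun X Y => ?_) V
    rw [Module.End.mul_apply, diagOp_diagOp D, Module.End.mul_apply, diagOp_diagOp D, diagOp_symm]
  rw [negLeviCivitaRight, hpi', map_smul, map_sub, map_add, key, key, key]
  simp

include D in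
theorem negLeviCivitaRight_proj (x₁ x₂ : ℝ) (W X : 𝔤) :
    negLeviCivitaRight Q 𝔭₁ 𝔭₂ x₁ x₂ W (Q.orthProj 𝔭₁ X + Q.orthProj 𝔭₂ X) =
      negLeviCivitaRight Q 𝔭₁ 𝔭₂ x₁ x₂ W X := by
  simp [negLeviCivitaRight, diagOp_apply, ScalarProduct.orthProj_idem, D.proj_left_right,
    D.proj_right_left]

include hQ D in
/-- The Ricci tensor of a diagonal metric. -/
theorem ricci_eq (hx₁ : x₁ ≠ 0) (hx₂ : x₂ ≠ 0) (hg : IsDiagonal Q 𝔭₁ 𝔭₂ g x₁ x₂) (Y Z : 𝔭)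
    {xa xd : ℝ} (hY : diagOp Q 𝔭₁ 𝔭₂ x₁ x₂ Y = xa • (Y : 𝔤))
    (hZ : diagOp Q 𝔭₁ 𝔭₂ x₁ x₂ Z = xd • (Z : 𝔤)) :
    ricci h g Y Z = (xa * xd / (4 * x₁ ^ 2)) * blockForm Q 𝔭₁ 𝔭₁ Y Z
      + (xa * xd / (4 * x₂ ^ 2)) * blockForm Q 𝔭₂ 𝔭₂ Y Z
      + ((xa * xd - (x₂ - x₁) ^ 2) / (2 * x₁ * x₂)) * blockForm Q 𝔭₁ 𝔭₂ Y Z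
      + blockForm Q 𝔭₁ 𝔨 Y Z + blockForm Q 𝔭₂ 𝔨 Y Z := by
  set p := Q.orthProj 𝔭₁ with hp
  set q := Q.orthProj 𝔭₂ with hq
  set k := Q.orthProj 𝔨 with hk
  set L := leviCivitaLeft Q 𝔭₁ 𝔭₂ x₁ x₂ Y with hL
  set N := negLeviCivitaRight Q 𝔭₁ 𝔭₂ x₁ x₂ Z with hN
  set N' := negLeviCivitaRight Q 𝔭₁ 𝔭₂ x₁ x₂ (leviCivita h g Y Z) with hN'
  set P := 𝔭.projectionOnto 𝔨 h with hP
  have hpi : ∀ X : 𝔤, (P X : 𝔤) = (p + q) X := fun X => by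
    rw [hP, D.projectionOnto_eq, D.proj_add]; rfl
  -- The map X ↦ R(X, Y)Z is extended to `𝔤` by precomposing with the projection to `𝔭`; the four
  -- summands correspond to the four terms of Nomizu's formula.
  have hR : ∀ X : 𝔤, (curvature h g (P X) Y Z : 𝔤) = (-N' + L * N
      - N * LieAlgebra.ad ℝ 𝔤 (Y : 𝔤) * (p + q)
      - (p + q) * LieAlgebra.ad ℝ 𝔤 (Z : 𝔤) * k * LieAlgebra.ad ℝ 𝔤 (Y : 𝔤) * (p + q)) X := by
    intro X
    have hN0 : N' (P X : 𝔤) = N' X := by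
      rw [hpi]; exact negLeviCivitaRight_proj D x₁ x₂ _ X
    have hN1 : N (P X : 𝔤) = N X := by
      rw [hpi]; exact negLeviCivitaRight_proj D x₁ x₂ _ X
    have hN3 : N (bracketP h (P X) Y : 𝔤) = -N ⁅(Y : 𝔤), (p + q) X⁆ := by
      rw [bracketP_eq D, D.proj_add, ← hpi, ← map_neg, lie_skew]
      exact negLeviCivitaRight_proj D x₁ x₂ _ _
    have hK : bracketK h (P X) Y = -k ⁅(Y : 𝔤), (p + q) X⁆ := by
      rw [bracketK, D.projectionOnto_eq h ⁅(P X : 𝔤), (Y : 𝔤)⁆, ← D.proj_compl, ← hpi, ← map_neg,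
        lie_skew]
    have h1 : (curvature h g (P X) Y Z : 𝔤) = (leviCivita h g (P X) (leviCivita h g Y Z) : 𝔤)
        - leviCivita h g Y (leviCivita h g (P X) Z) - leviCivita h g (bracketP h (P X) Y) Z
        - P ⁅bracketK h (P X) Y, (Z : 𝔤)⁆ := rfl
    have t1 := leviCivita_eq_right hQ D h hx₁ hx₂ hg (P X) (leviCivita h g Y Z)
    have t2 := leviCivita_eq_left hQ D h hx₁ hx₂ hg Y (leviCivita h g (P X) Z)
    have t3 := leviCivita_eq_right hQ D h hx₁ hx₂ hg (P X) Z
    have t4 := leviCivita_eq_right hQ D h hx₁ hx₂ hg (bracketP h (P X) Y) Z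
    rw [h1, t1, t2, t3, t4, ← hN', ← hN, ← hL, hN0, hN1, hN3, hK, hpi, neg_lie, lie_skew]
    simp only [LinearMap.sub_apply, LinearMap.add_apply, LinearMap.neg_apply, Module.End.mul_apply,
      LieAlgebra.ad_apply, map_neg, map_add, lie_add]
    abel
  have htr : ricci h g Y Z = LinearMap.trace ℝ 𝔤 (-N' + L * N
      - N * LieAlgebra.ad ℝ 𝔤 (Y : 𝔤) * (p + q)
      - (p + q) * LieAlgebra.ad ℝ 𝔤 (Z : 𝔤) * k * LieAlgebra.ad ℝ 𝔤 (Y : 𝔤) * (p + q)) := by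
    set f : 𝔭 →ₗ[ℝ] 𝔭 := LinearMap.applyₗ Z ∘ₗ (curvature h g).flip Y with hf
    have h1 : f = P ∘ₗ (𝔭.subtype ∘ₗ f) := by
      ext X
      simp [hP]
    have h2 : (𝔭.subtype ∘ₗ f) ∘ₗ P = _ := LinearMap.ext fun X => hR X
    rw [ricci, ← hf, h1, LinearMap.trace_comp_comm', h2]
  -- From here the computation takes place in the algebra generated by the projections, ad Y and ad
  -- Z; `xa` and `xd` replace the metric operator on Y and Z.
  have hpq : p * q = 0 := LinearMap.ext D.proj_left_right
  have hqp : q * p = 0 := LinearMap.ext D.proj_right_left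
  have hpp : p * p = p := LinearMap.ext fun X => ScalarProduct.orthProj_idem X
  have hqq : q * q = q := LinearMap.ext fun X => ScalarProduct.orthProj_idem X
  have hsymm := blockForm_comm hQ 𝔭₂ 𝔭₁ Y Z
  have hid := ricci_trace_identity (LinearMap.trace ℝ 𝔤) (LinearMap.trace_mul_comm ℝ)
    (k := k) hpp hqq hpq hqp (D := LieAlgebra.ad ℝ 𝔤 (Y : 𝔤)) (E := LieAlgebra.ad ℝ 𝔤 (Z : 𝔤))
    (by simpa [blockForm_apply] using hsymm) hx₁ hx₂ xa xd
  have hL2 : L = (1 / 2 : ℝ) • ((p + q) * LieAlgebra.ad ℝ 𝔤 (Y : 𝔤)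
      + (x₁⁻¹ • p + x₂⁻¹ • q) * LieAlgebra.ad ℝ 𝔤 (Y : 𝔤) * (x₁ • p + x₂ • q)
      - xa • ((x₁⁻¹ • p + x₂⁻¹ • q) * LieAlgebra.ad ℝ 𝔤 (Y : 𝔤))) := by
    rw [hL, leviCivitaLeft, hY, map_smul, mul_smul_comm]; rfl
  have hN2 : N = (1 / 2 : ℝ) • ((p + q) * LieAlgebra.ad ℝ 𝔤 (Z : 𝔤) * (p + q)
      + xd • ((x₁⁻¹ • p + x₂⁻¹ • q) * LieAlgebra.ad ℝ 𝔤 (Z : 𝔤) * (p + q))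
      - (x₁⁻¹ • p + x₂⁻¹ • q) * LieAlgebra.ad ℝ 𝔤 (Z : 𝔤) * (x₁ • p + x₂ • q)) := by
    rw [hN, negLeviCivitaRight, hZ, map_smul, mul_smul_comm, smul_mul_assoc]; rfl
  rw [htr, map_sub, map_sub, map_add, map_neg, trace_negLeviCivitaRight hQ D, neg_zero,
    zero_add, hL2, hN2, hid, blockForm_symm hQ 𝔭₁ 𝔨, blockForm_symm hQ 𝔭₂ 𝔨]
  simp only [blockForm_apply]
  ring

end RicciDiagonal

/-! ### Bounds for the curvature tensor -/

namespace ScalarProduct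

variable {V W : Type*} [AddCommGroup V] [Module ℝ V] [FiniteDimensional ℝ V]
  [AddCommGroup W] [Module ℝ W] (q : ScalarProduct V) (p : ScalarProduct W)

theorem norm_onb (i : Fin (Module.finrank ℝ V)) : q.norm (q.onb i) = 1 := by
  rw [norm, onb_apply, if_pos rfl, Real.sqrt_one]

theorem norm_sum_le {ι : Type*} (s : Finset ι) (f : ι → W) :
    p.norm (∑ i ∈ s, f i) ≤ ∑ i ∈ s, p.norm (f i) :=
  Finset.le_sum_of_subadditive p.norm (by simp [norm]) p.norm_add_le s f

theorem norm_map_le (T : V →ₗ[ℝ] W) (X : V) :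
    p.norm (T X) ≤ q.norm X * ∑ i, p.norm (T (q.onb i)) := by
  have h : T X = ∑ i, q.onb.repr X i • T (q.onb i) := by
    conv_lhs => rw [← q.onb.sum_repr X]
    simp only [map_sum, map_smul]
  rw [h, Finset.mul_sum]
  refine (p.norm_sum_le _ _).trans (Finset.sum_le_sum fun i _ => ?_)
  rw [norm_smul]
  refine mul_le_mul_of_nonneg_right ?_ (p.norm_nonneg _)
  rw [onb_repr]
  simpa [norm_onb] using q.abs_form_le X (q.onb i)

theorem exists_norm_map₂_le (T : V →ₗ[ℝ] V →ₗ[ℝ] W) :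
    ∃ c, 0 ≤ c ∧ ∀ X Y, p.norm (T X Y) ≤ c * q.norm X * q.norm Y := by
  refine ⟨∑ i, ∑ j, p.norm (T (q.onb i) (q.onb j)),
    Finset.sum_nonneg fun i _ => Finset.sum_nonneg fun j _ => p.norm_nonneg _, fun X Y => ?_⟩
  refine (q.norm_map_le p (T.flip Y) X).trans ?_
  rw [mul_assoc, mul_comm, Finset.sum_mul, Finset.sum_mul]
  refine Finset.sum_le_sum fun i _ => ?_
  have h := mul_le_mul_of_nonneg_right (q.norm_map_le p (T (q.onb i)) Y) (q.norm_nonneg X)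
  rw [LinearMap.flip_apply]
  linarith

theorem exists_norm_map₃_le (T : V →ₗ[ℝ] V →ₗ[ℝ] V →ₗ[ℝ] W) :
    ∃ c, 0 ≤ c ∧ ∀ X Y Z, p.norm (T X Y Z) ≤ c * q.norm X * q.norm Y * q.norm Z := by
  choose c hc hT using fun i => q.exists_norm_map₂_le p (T (q.onb i))
  refine ⟨∑ i, c i, Finset.sum_nonneg fun i _ => hc i, fun X Y Z => ?_⟩
  refine (q.norm_map_le p ((T.flip Y).flip Z) X).trans ?_
  rw [mul_assoc, mul_assoc, mul_comm, Finset.sum_mul, Finset.sum_mul]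
  refine Finset.sum_le_sum fun i _ => ?_
  have h := mul_le_mul_of_nonneg_right (hT i Y Z) (q.norm_nonneg X)
  rw [LinearMap.flip_apply, LinearMap.flip_apply]
  linarith

end ScalarProduct

section CurvatureBounds

variable {𝔤 : Type*} [LieRing 𝔤] [LieAlgebra ℝ 𝔤] [FiniteDimensional ℝ 𝔤]
  {𝔭 𝔨 : Submodule ℝ 𝔤} (h : IsCompl 𝔭 𝔨)

/-- A lower bound of the Ricci tensor bounds the norm of the curvature tensor from below. -/
theorem le_rmNorm_of_le_ricci (h𝔭 : 0 < Module.finrank ℝ 𝔭) (g : ScalarProduct 𝔭) {c : ℝ}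
    (hc : ∀ X, c * g.form X X ≤ ricci h g X X) :
    c ≤ Module.finrank ℝ 𝔭 * rmNorm h g := by
  -- One unit vector suffices: its Ricci curvature is a sum of dim `𝔭` components of the curvature
  -- tensor, each at most |Rm|.
  set e : Fin (Module.finrank ℝ 𝔭) := ⟨0, h𝔭⟩
  have h1 := hc (g.onb e)
  rw [g.onb_apply, if_pos rfl, mul_one, ricci, g.trace_eq_sum] at h1
  refine h1.trans ?_
  have h2 : ∀ i j k l, |g.form (curvature h g (g.onb i) (g.onb j) (g.onb k)) (g.onb l)| ≤
      rmNorm h g := by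
    intro i j k l
    rw [← Real.sqrt_sq_eq_abs]
    refine Real.sqrt_le_sqrt ?_
    have nn : ∀ i j k l,
      0 ≤ g.form (curvature h g (g.onb i) (g.onb j) (g.onb k)) (g.onb l) ^ 2 :=
      fun _ _ _ _ => sq_nonneg _
    refine (Finset.single_le_sum (f := fun l =>
      g.form (curvature h g (g.onb i) (g.onb j) (g.onb k)) (g.onb l) ^ 2)
      (fun l _ => nn i j k l) (Finset.mem_univ l)).trans ?_
    refine (Finset.single_le_sum (f := fun k => ∑ l,
      g.form (curvature h g (g.onb i) (g.onb j) (g.onb k)) (g.onb l) ^ 2)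
      (fun k _ => Finset.sum_nonneg fun l _ => nn i j k l) (Finset.mem_univ k)).trans ?_
    refine (Finset.single_le_sum (f := fun j => ∑ k, ∑ l,
      g.form (curvature h g (g.onb i) (g.onb j) (g.onb k)) (g.onb l) ^ 2)
      (fun j _ => Finset.sum_nonneg fun k _ => Finset.sum_nonneg fun l _ => nn i j k l)
      (Finset.mem_univ j)).trans ?_
    exact Finset.single_le_sum (f := fun i => ∑ j, ∑ k, ∑ l,
      g.form (curvature h g (g.onb i) (g.onb j) (g.onb k)) (g.onb l) ^ 2)
      (fun i _ => Finset.sum_nonneg fun j _ => Finset.sum_nonneg fun k _ =>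
        Finset.sum_nonneg fun l _ => nn i j k l) (Finset.mem_univ i)
  refine (Finset.sum_le_card_nsmul _ _ (rmNorm h g) fun i _ => ?_).trans (by simp)
  exact (le_abs_self _).trans (h2 i e e i)

/-- The norm of the curvature tensor scales like the inverse of the metric, as long as the metric
is uniformly equivalent to a multiple of a background metric. -/
theorem exists_rmNorm_le (q : ScalarProduct 𝔭) {κ : ℝ} (hκ : 0 ≤ κ) :
    ∃ C, 0 ≤ C ∧ ∀ (g : ScalarProduct 𝔭) (m M : ℝ), 0 < m → 0 ≤ M → M ≤ κ * m →
      (∀ X, m * q.form X X ≤ g.form X X) → (∀ X, g.form X X ≤ M * q.form X X) →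
      rmNorm h g ≤ C / m := by
  obtain ⟨c, hc, hb⟩ := q.exists_norm_map₂_le q (bracketP h)
  obtain ⟨d, hd, ha⟩ := q.exists_norm_map₃_le q (adBracketK h)
  -- In the background norm, `l` bounds the connection: c/2 from half the bracket, κc from U. Below,
  -- `r` bounds the curvature operator, one summand for each of its terms.
  set l := c / 2 + κ * c with hl
  have hl0 : 0 ≤ l := by positivity
  set r := l * l + l * l + l * c + d with hr
  have hr0 : 0 ≤ r := by positivity
  refine ⟨(Module.finrank ℝ 𝔭 : ℝ) ^ 2 * (κ * r), by positivity, fun g m M hm hM hκM h1 h2 => ?_⟩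
  have hgM : ∀ X Y, |g.form X Y| ≤ M * (q.norm X * q.norm Y) := by
    intro X Y
    have h3 : ∀ X, g.norm X ≤ √M * q.norm X := fun X => by
      rw [ScalarProduct.norm, ScalarProduct.norm, ← Real.sqrt_mul hM]
      exact Real.sqrt_le_sqrt (h2 X)
    refine (g.abs_form_le X Y).trans ((mul_le_mul (h3 X) (h3 Y) (g.norm_nonneg Y)
      (mul_nonneg (Real.sqrt_nonneg _) (q.norm_nonneg X))).trans (le_of_eq ?_))
    rw [mul_mul_mul_comm, Real.mul_self_sqrt hM]
  have hU : ∀ X Y, q.norm (symmPart h g X Y) ≤ κ * c * (q.norm X * q.norm Y) := by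
    intro X Y
    set U := symmPart h g X Y with hU
    have hX := q.norm_nonneg X
    have hY := q.norm_nonneg Y
    refine q.norm_le_of_form_le (by positivity) ?_
    have h3 := symmPart_form h g X Y U
    rw [← hU] at h3
    have h4 := (le_abs_self _).trans (hgM Y (bracketP h U X))
    have h5 := (le_abs_self _).trans (hgM X (bracketP h U Y))
    have h6 := mul_le_mul_of_nonneg_left (mul_le_mul_of_nonneg_left (hb U X) hY) hM
    have h7 := mul_le_mul_of_nonneg_left (mul_le_mul_of_nonneg_left (hb U Y) hX) hM
    have h8 := h1 U
    have h9 : m * q.form U U ≤ M * (c * (q.norm X * q.norm Y) * q.norm U) := by linarith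
    have h10 : M * (c * (q.norm X * q.norm Y) * q.norm U) ≤
        κ * m * (c * (q.norm X * q.norm Y) * q.norm U) :=
      mul_le_mul_of_nonneg_right hκM
        (mul_nonneg (mul_nonneg hc (mul_nonneg hX hY)) (q.norm_nonneg U))
    have h11 : m * q.form U U ≤ m * (κ * c * (q.norm X * q.norm Y) * q.norm U) := by linarith
    exact le_of_mul_le_mul_left h11 hm
  have hL : ∀ X Y, q.norm (leviCivita h g X Y) ≤ l * q.norm X * q.norm Y := by
    intro X Y
    have h3 : leviCivita h g X Y = (1 / 2 : ℝ) • bracketP h X Y + symmPart h g X Y := rfl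
    rw [h3]
    refine (q.norm_add_le _ _).trans ?_
    rw [q.norm_smul, abs_of_pos (by norm_num)]
    have h4 := hb X Y
    have h5 := hU X Y
    rw [hl]
    linarith
  have hLL : ∀ X Y Z, q.norm (leviCivita h g X (leviCivita h g Y Z)) ≤
      l * l * (q.norm X * q.norm Y * q.norm Z) := by
    intro X Y Z
    have h3 := mul_le_mul_of_nonneg_left (hL Y Z) (mul_nonneg hl0 (q.norm_nonneg X))
    have h4 := hL X (leviCivita h g Y Z)
    linarith
  have hR : ∀ X Y Z, q.norm (curvature h g X Y Z) ≤ r * (q.norm X * q.norm Y * q.norm Z) := by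
    intro X Y Z
    have h3 : curvature h g X Y Z = leviCivita h g X (leviCivita h g Y Z)
      - leviCivita h g Y (leviCivita h g X Z) - leviCivita h g (bracketP h X Y) Z
      - adBracketK h X Y Z := rfl
    have h4 := hLL X Y Z
    have h5 := hLL Y X Z
    have h6 := hL (bracketP h X Y) Z
    have h7 := mul_le_mul_of_nonneg_right (mul_le_mul_of_nonneg_left (hb X Y) hl0) (q.norm_nonneg Z)
    have h8 := ha X Y Z
    have h9 := q.norm_sub_le (leviCivita h g X (leviCivita h g Y Z)
      - leviCivita h g Y (leviCivita h g X Z) - leviCivita h g (bracketP h X Y) Z)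
      (adBracketK h X Y Z)
    have h10 := q.norm_sub_le (leviCivita h g X (leviCivita h g Y Z)
      - leviCivita h g Y (leviCivita h g X Z)) (leviCivita h g (bracketP h X Y) Z)
    have h11 := q.norm_sub_le (leviCivita h g X (leviCivita h g Y Z))
      (leviCivita h g Y (leviCivita h g X Z))
    rw [h3, hr]
    linarith
  have he : ∀ i, q.norm (g.onb i) ≤ √m⁻¹ := by
    intro i
    refine Real.sqrt_le_sqrt ?_
    have h3 := h1 (g.onb i)
    rw [g.onb_apply, if_pos rfl] at h3
    rw [← one_div, le_div_iff₀ hm]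
    linarith
  have hs : √m⁻¹ * √m⁻¹ = m⁻¹ := Real.mul_self_sqrt (by positivity)
  have hs0 : 0 ≤ √m⁻¹ := Real.sqrt_nonneg _
  -- A component involves four basis vectors of background norm at most m^(-1/2), and pairing with
  -- `g` costs a factor M ≤ κm, hence order 1/m. The (dim `𝔭`)⁴ components contribute (dim `𝔭`)²
  -- after the square root.
  have hent : ∀ i j k l, g.form (curvature h g (g.onb i) (g.onb j) (g.onb k)) (g.onb l) ^ 2 ≤
      (κ * r / m) ^ 2 := by
    intro i j k l
    refine sq_le_sq' ?_ ?_ <;> [refine neg_le_of_abs_le ?_; refine le_of_abs_le ?_]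
    all_goals
      refine (hgM _ _).trans ?_
      have e1 : q.norm (g.onb i) * q.norm (g.onb j) * q.norm (g.onb k) ≤
          √m⁻¹ * √m⁻¹ * √m⁻¹ :=
        mul_le_mul (mul_le_mul (he i) (he j) (q.norm_nonneg _) hs0) (he k) (q.norm_nonneg _)
          (by positivity)
      have e2 : q.norm (curvature h g (g.onb i) (g.onb j) (g.onb k)) ≤
          r * (√m⁻¹ * √m⁻¹ * √m⁻¹) :=
        (hR _ _ _).trans (mul_le_mul_of_nonneg_left e1 hr0)
      have e3 := mul_le_mul e2 (he l) (q.norm_nonneg _) (by positivity)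
      refine (mul_le_mul_of_nonneg_left e3 hM).trans ?_
      have e4 : r * (√m⁻¹ * √m⁻¹ * √m⁻¹) * √m⁻¹ = r * (m⁻¹ * m⁻¹) := by
        calc _ = r * ((√m⁻¹ * √m⁻¹) * (√m⁻¹ * √m⁻¹)) := by ring
          _ = _ := by rw [hs]
      rw [e4]
      refine (mul_le_mul_of_nonneg_right hκM (by positivity)).trans (le_of_eq ?_)
      field_simp
  have hsum : ∑ i, ∑ j, ∑ k, ∑ l,
      g.form (curvature h g (g.onb i) (g.onb j) (g.onb k)) (g.onb l) ^ 2 ≤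
      ((Module.finrank ℝ 𝔭 : ℝ) ^ 2 * (κ * r / m)) ^ 2 := by
    refine (Finset.sum_le_sum fun i _ => Finset.sum_le_sum fun j _ => Finset.sum_le_sum fun k _ =>
      Finset.sum_le_sum fun l _ => hent i j k l).trans (le_of_eq ?_)
    simp
    ring
  rw [rmNorm]
  refine (Real.sqrt_le_sqrt hsum).trans (le_of_eq ?_)
  rw [Real.sqrt_sq (by positivity)]
  ring

end CurvatureBounds

/-! ### Schur's lemma and the isotropy representation -/

/-- A symmetric bilinear form has an eigenvector relative to a scalar product. -/
theorem ScalarProduct.exists_eigenvector {V : Type*} [AddCommGroup V] [Module ℝ V]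
    [FiniteDimensional ℝ V] [Nontrivial V] (q : ScalarProduct V) (B : LinearMap.BilinForm ℝ V)
    (hB : ∀ X Y, B X Y = B Y X) : ∃ c : ℝ, ∃ X ≠ 0, ∀ Y, B X Y = c * q.form X Y := by
  let _ : NormedAddCommGroup V := q.core.toNormedAddCommGroup
  let _ : InnerProductSpace ℝ V := InnerProductSpace.ofCore q.core.toCore
  have hin : ∀ X Y : V, inner ℝ X Y = q.form X Y := fun _ _ => rfl
  let T : V →ₗ[ℝ] V := (q.form.toDual q.nondegenerate).symm.toLinearMap ∘ₗ B
  have hT : ∀ X Y, q.form (T X) Y = B X Y := fun X Y => by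
    rw [← LinearMap.BilinForm.toDual_def (b := q.nondegenerate)]
    simp [T]
  have hs : T.IsSymmetric := fun X Y => by
    rw [hin, hin, hT, q.symm, hT, hB]
  obtain ⟨c, hc⟩ : ∃ c : ℝ, Module.End.HasEigenvalue T c :=
    ⟨_, hs.hasEigenvalue_iSup_of_finiteDimensional⟩
  obtain ⟨X, hX⟩ := hc.exists_hasEigenvector
  refine ⟨c, X, hX.2, fun Y => ?_⟩
  rw [← hT, hX.apply_eq_smul, map_smul, LinearMap.smul_apply, smul_eq_mul]

section Schur

variable {n : ℕ} {G : Type*} [TopologicalSpace G] [ChartedSpace (EuclideanSpace ℝ (Fin n)) G]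
  [Group G] {K : Subgroup G} {W W₁ W₂ : Submodule ℝ (LieAlg n G)}

/-- The bilinear form `B` is invariant under `Ad(K)`. -/
def IsAdInvariant (K : Subgroup G) (B : LinearMap.BilinForm ℝ (LieAlg n G)) : Prop :=
  ∀ a ∈ K, ∀ X Y, B (Ad a X) (Ad a Y) = B X Y

theorem IsAdInvariant.flip {B : LinearMap.BilinForm ℝ (LieAlg n G)} (hB : IsAdInvariant K B) :
    IsAdInvariant K (LinearMap.flip B) := fun a ha X Y => hB a ha Y X

theorem BiinvariantProduct.isAdInvariant (Q : BiinvariantProduct n G) : IsAdInvariant K Q.form :=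
  fun a _ => Q.inv a

theorem exists_form_eq (Q : BiinvariantProduct n G) (B : LinearMap.BilinForm ℝ (LieAlg n G)) :
    ∃ φ : W₁ →ₗ[ℝ] W₂, ∀ (X : W₁) (Y : W₂), Q.form (φ X) Y = B X Y := by
  let q := Q.toScalarProduct.restrict W₂
  let φ : W₁ →ₗ[ℝ] W₂ := (q.form.toDual q.nondegenerate).symm.toLinearMap ∘ₗ
    (B.domRestrict₁₂ W₁ W₂)
  refine ⟨φ, fun X Y => ?_⟩
  have h1 : q.form (φ X) Y = B.domRestrict₁₂ W₁ W₂ X Y := by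
    rw [← LinearMap.BilinForm.toDual_def (b := q.nondegenerate)]
    simp [φ]
  exact h1

variable [LieGroup (𝓡 n) ∞ G]

theorem IsAdInvariant.left {B : LinearMap.BilinForm ℝ (LieAlg n G)} (hB : IsAdInvariant K B)
    {a : G} (ha : a ∈ K) (X Y : LieAlg n G) : B (Ad a X) Y = B X (Ad a⁻¹ Y) := by
  rw [← hB a ha X, Ad_Ad_inv]

/-- Schur's lemma for invariant symmetric forms. -/
theorem IsAdIrreducible.exists_eq_mul (hW : IsAdIrreducible K W) (Q : BiinvariantProduct n G)
    {B : LinearMap.BilinForm ℝ (LieAlg n G)} (hB : IsAdInvariant K B)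
    (hs : ∀ X Y, B X Y = B Y X) : ∃ c : ℝ, ∀ X ∈ W, ∀ Y ∈ W, B X Y = c * Q.form X Y := by
  obtain ⟨hne, hst, hmin⟩ := hW
  have : Nontrivial W := Submodule.nontrivial_iff_ne_bot.mpr hne
  obtain ⟨c, X₀, hX₀, hc⟩ := (Q.toScalarProduct.restrict W).exists_eigenvector (B.restrict W)
    fun X Y => hs X Y
  -- The eigenspace of `B` relative to `Q` for an existing real eigenvalue; it is stable and
  -- nonzero, hence all of `W`. Symmetry of `B` replaces the algebraically closed field of the usual
  -- Schur lemma.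
  let U : Submodule ℝ (LieAlg n G) := W ⊓ (B - c • Q.form).orthogonal W
  have hU : ∀ X, X ∈ U ↔ X ∈ W ∧ ∀ Y ∈ W, B X Y = c * Q.form X Y := by
    intro X
    refine and_congr_right fun _ => forall₂_congr fun Y _ => ?_
    change B Y X - c * Q.form Y X = 0 ↔ _
    rw [sub_eq_zero, hs, Q.symm]
  have hUst : IsAdStable K U := by
    intro a ha X hX
    rw [hU] at hX ⊢
    refine ⟨hst a ha X hX.1, fun Y hY => ?_⟩
    rw [hB.left ha, Q.isAdInvariant.left ha, hX.2 _ (hst _ (K.inv_mem ha) Y hY)]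
  rcases hmin U inf_le_left hUst with h | h
  · have h1 : (X₀ : LieAlg n G) ∈ U := (hU _).mpr ⟨X₀.2, fun Y hY => hc ⟨Y, hY⟩⟩
    rw [h, Submodule.mem_bot] at h1
    exact absurd (Subtype.ext h1) hX₀
  · exact ⟨c, fun X hX => ((hU X).mp (h ▸ hX)).2⟩

/-- The left kernel of `B` in `W₁` is stable, hence zero or everything. -/
theorem IsAdIrreducible.injective_or (h₁ : IsAdIrreducible K W₁) (h₂ : IsAdStable K W₂)
    {B : LinearMap.BilinForm ℝ (LieAlg n G)} (hB : IsAdInvariant K B) :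
    (∀ X ∈ W₁, (∀ Y ∈ W₂, B X Y = 0) → X = 0) ∨ ∀ X ∈ W₁, ∀ Y ∈ W₂, B X Y = 0 := by
  let U : Submodule ℝ (LieAlg n G) := W₁ ⊓ LinearMap.BilinForm.orthogonal (LinearMap.flip B) W₂
  have hU : ∀ X, X ∈ U ↔ X ∈ W₁ ∧ ∀ Y ∈ W₂, B X Y = 0 := fun X => Iff.rfl
  have hUst : IsAdStable K U := by
    intro a ha X hX
    rw [hU] at hX ⊢
    refine ⟨h₁.2.1 a ha X hX.1, fun Y hY => ?_⟩
    rw [hB.left ha, hX.2 _ (h₂ _ (K.inv_mem ha) Y hY)]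
  rcases h₁.2.2 U inf_le_left hUst with h | h
  · refine Or.inl fun X hX hY => ?_
    have h1 : X ∈ U := (hU X).mpr ⟨hX, hY⟩
    rwa [h, Submodule.mem_bot] at h1
  · exact Or.inr fun X hX => ((hU X).mp (h ▸ hX)).2

/-- Schur's lemma for inequivalent representations. -/
theorem IsAdIrreducible.eq_zero (h₁ : IsAdIrreducible K W₁) (h₂ : IsAdIrreducible K W₂)
    (hne : ¬ AreAdEquivalent K W₁ W₂) (Q : BiinvariantProduct n G)
    {B : LinearMap.BilinForm ℝ (LieAlg n G)} (hB : IsAdInvariant K B) :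
    ∀ X ∈ W₁, ∀ Y ∈ W₂, B X Y = 0 := by
  rcases h₁.injective_or h₂.2.1 hB with i₁ | h
  · rcases h₂.injective_or h₁.2.1 hB.flip with i₂ | h
    -- If both kernels vanish, the maps representing `B` inject each space into the other, so the
    -- dimensions agree and φ is an isomorphism; invariance of `B` makes it equivariant, against
    -- inequivalence.
    · obtain ⟨φ, hφ⟩ := exists_form_eq (W₁ := W₁) (W₂ := W₂) Q B
      obtain ⟨ψ, hψ⟩ := exists_form_eq (W₁ := W₂) (W₂ := W₁) Q (LinearMap.flip B)
      have hφi : Function.Injective φ := by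
        rw [injective_iff_map_eq_zero]
        intro X hX
        refine Subtype.ext (i₁ X X.2 fun Y hY => ?_)
        rw [← hφ X ⟨Y, hY⟩, hX]
        simp
      have hψi : Function.Injective ψ := by
        rw [injective_iff_map_eq_zero]
        intro X hX
        refine Subtype.ext (i₂ X X.2 fun Y hY => ?_)
        rw [← hψ X ⟨Y, hY⟩, hX]
        simp
      have hfin := le_antisymm (LinearMap.finrank_le_finrank_of_injective hφi)
        (LinearMap.finrank_le_finrank_of_injective hψi)
      refine absurd ⟨φ.linearEquivOfInjective hφi hfin, fun a ha X X' hX => ?_⟩ hne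
      change (φ X' : LieAlg n G) = Ad a (φ X : LieAlg n G)
      have h3 : (φ X' : LieAlg n G) - Ad a (φ X : LieAlg n G) ∈ W₂ :=
        W₂.sub_mem (φ X').2 (h₂.2.1 a ha _ (φ X).2)
      have h4 : ∀ Y ∈ W₂, Q.form ((φ X' : LieAlg n G) - Ad a (φ X : LieAlg n G)) Y = 0 := by
        intro Y hY
        have hY' := h₂.2.1 _ (K.inv_mem ha) Y hY
        rw [map_sub, LinearMap.sub_apply, hφ X' ⟨Y, hY⟩, hX, Q.isAdInvariant.left ha, hB.left ha,
          hφ X ⟨_, hY'⟩, sub_self]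
      exact sub_eq_zero.mp (Q.eq_zero_of_self (h4 _ h3))
    · exact fun X hX Y hY => h Y hY X hX
  · exact h

theorem orthProj_Ad (Q : BiinvariantProduct n G) (hW : IsAdStable K W) {a : G} (ha : a ∈ K)
    (X : LieAlg n G) :
    Q.toScalarProduct.orthProj W (Ad a X) = Ad a (Q.toScalarProduct.orthProj W X) := by
  refine ScalarProduct.orthProj_unique (hW a ha _ (ScalarProduct.orthProj_mem X)) fun Z hZ => ?_
  rw [← map_sub, Q.symm, Q.isAdInvariant.left ha, Q.symm]
  exact ScalarProduct.form_sub_orthProj X (hW _ (K.inv_mem ha) Z hZ)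

/-- Ad a is a Lie algebra automorphism commuting with the projections to stable subspaces, so it
conjugates the whole operator and leaves its trace unchanged. -/
theorem isAdInvariant_blockForm (Q : BiinvariantProduct n G) (h₁ : IsAdStable K W₁)
    (h₂ : IsAdStable K W₂) : IsAdInvariant K (blockForm Q.toScalarProduct W₁ W₂) := by
  intro a ha Y Z
  set A : Module.End ℝ (LieAlg n G) := (Ad a : LieAlg n G →L[ℝ] LieAlg n G).toLinearMap with hA
  set A' : Module.End ℝ (LieAlg n G) := (Ad a⁻¹ : LieAlg n G →L[ℝ] LieAlg n G).toLinearMap with hA'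
  have e1 : A' * A = 1 := LinearMap.ext fun X => Ad_inv_Ad a X
  have had : ∀ V, LieAlgebra.ad ℝ _ (Ad a V) = A * (LieAlgebra.ad ℝ _ V * A') := by
    intro V
    refine LinearMap.ext fun X => ?_
    change ⁅Ad a V, X⁆ = Ad a ⁅V, Ad a⁻¹ X⁆
    rw [Ad_lie, Ad_Ad_inv]
  have hp : ∀ U : Submodule ℝ (LieAlg n G), IsAdStable K U →
      (Q.toScalarProduct.orthProj U : Module.End ℝ (LieAlg n G)) * A =
      A * (Q.toScalarProduct.orthProj U : Module.End ℝ (LieAlg n G)) :=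
    fun U hU => LinearMap.ext fun X => orthProj_Ad Q hU ha X
  rw [blockForm_apply, blockForm_apply, had, had]
  set p : Module.End ℝ (LieAlg n G) := Q.toScalarProduct.orthProj W₁
  set q : Module.End ℝ (LieAlg n G) := Q.toScalarProduct.orthProj W₂
  set D := LieAlgebra.ad ℝ (LieAlg n G) Y
  set E := LieAlgebra.ad ℝ (LieAlg n G) Z
  have h3 : p * (A * (D * A') * (q * (A * (E * A')))) = A * ((p * (D * (q * E))) * A') := by
    calc _ = (p * A) * (D * (A' * ((q * A) * (E * A')))) := by simp only [mul_assoc]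
      _ = A * (p * (D * ((A' * A) * (q * (E * A'))))) := by
        rw [show p * A = A * p from hp _ h₁, show q * A = A * q from hp _ h₂]
        simp only [mul_assoc]
      _ = _ := by rw [e1, one_mul]; simp only [mul_assoc]
  rw [h3, LinearMap.trace_mul_comm, mul_assoc, e1, mul_one]

end Schur

/-! ### Isotropy representations with two inequivalent irreducible summands -/

section TwoSummands

variable {n : ℕ} {G : Type*} [TopologicalSpace G] [ChartedSpace (EuclideanSpace ℝ (Fin n)) G]
  [Group G] {K : Subgroup G} {𝔭₁ 𝔭₂ : Submodule ℝ (LieAlg n G)} {Q : BiinvariantProduct n G}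

theorem AreAdEquivalent.symm (h : AreAdEquivalent K 𝔭₁ 𝔭₂)
    (hst : IsAdStable K 𝔭₁) : AreAdEquivalent K 𝔭₂ 𝔭₁ := by
  obtain ⟨φ, hφ⟩ := h
  refine ⟨φ.symm, fun a ha X X' hX => ?_⟩
  have h1 := hφ a ha (φ.symm X) ⟨Ad a (φ.symm X : LieAlg n G), hst a ha _ (φ.symm X).2⟩ rfl
  rw [φ.apply_symm_apply, ← hX] at h1
  rw [← Subtype.ext h1, φ.symm_apply_apply]

/-- The isotropy representation is the sum of two inequivalent irreducible representations. -/
structure IsotropySplitting (Q : BiinvariantProduct n G) (K : Subgroup G)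
    (𝔭₁ 𝔭₂ : Submodule ℝ (LieAlg n G)) : Prop where
  sum : 𝔭₁ ⊔ 𝔭₂ = isotropyRep Q K
  irr₁ : IsAdIrreducible K 𝔭₁
  irr₂ : IsAdIrreducible K 𝔭₂
  ineq : ¬ AreAdEquivalent K 𝔭₁ 𝔭₂

theorem IsotropySplitting.swap (S : IsotropySplitting Q K 𝔭₁ 𝔭₂) :
    IsotropySplitting Q K 𝔭₂ 𝔭₁ :=
  ⟨by rw [sup_comm, S.sum], S.irr₂, S.irr₁, fun h => S.ineq (h.symm S.irr₂.2.1)⟩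

theorem InvariantMetric.ext_form {g g' : InvariantMetric Q K} (h : ∀ X Y, g.form X Y = g'.form X Y) :
    g = g' := by
  obtain ⟨⟨B, _, _⟩, _⟩ := g
  obtain ⟨⟨B', _, _⟩, _⟩ := g'
  obtain rfl : B = B' := LinearMap.ext₂ h
  rfl

namespace IsotropySplitting

variable [LieGroup (𝓡 n) ∞ G] (S : IsotropySplitting Q K 𝔭₁ 𝔭₂)
include S

theorem isOrthDecomp :
    Q.toScalarProduct.IsOrthDecomp (isotropyRep Q K) (isotropyAlgebra n K) 𝔭₁ 𝔭₂ :=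
  ⟨S.sum, S.irr₁.eq_zero S.irr₂ S.ineq Q Q.isAdInvariant, rfl⟩

theorem exists_decomp (X : isotropyRep Q K) : ∃ X₁ X₂ : isotropyRep Q K,
    (X₁ : LieAlg n G) = Q.toScalarProduct.orthProj 𝔭₁ X ∧
    (X₂ : LieAlg n G) = Q.toScalarProduct.orthProj 𝔭₂ X ∧ X = X₁ + X₂ := by
  refine ⟨⟨_, S.isOrthDecomp.left_le (ScalarProduct.orthProj_mem _)⟩,
    ⟨_, S.isOrthDecomp.right_le (ScalarProduct.orthProj_mem _)⟩, rfl, rfl, Subtype.ext ?_⟩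
  change (X : LieAlg n G) = _ + _
  rw [← S.isOrthDecomp.proj_add, ScalarProduct.orthProj_of_mem X.2]

theorem isDiagonal_of_hasComponents {g : InvariantMetric Q K} {x₁ x₂ : ℝ}
    (hg : g.HasComponents 𝔭₁ 𝔭₂ x₁ x₂) :
    IsDiagonal Q.toScalarProduct 𝔭₁ 𝔭₂ g.toScalarProduct x₁ x₂ := by
  intro X Y
  obtain ⟨X₁, X₂, hX₁, hX₂, hX⟩ := S.exists_decomp X
  obtain ⟨Y₁, Y₂, hY₁, hY₂, hY⟩ := S.exists_decomp Y
  have m₁ : ∀ Z, Q.toScalarProduct.orthProj 𝔭₁ Z ∈ 𝔭₁ := fun Z => ScalarProduct.orthProj_mem _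
  have m₂ : ∀ Z, Q.toScalarProduct.orthProj 𝔭₂ Z ∈ 𝔭₂ := fun Z => ScalarProduct.orthProj_mem _
  have e1 := hg.1 X₁ Y₁ (hX₁ ▸ m₁ _) (hY₁ ▸ m₁ _)
  have e2 := hg.2.1 X₂ Y₂ (hX₂ ▸ m₂ _) (hY₂ ▸ m₂ _)
  have e3 := hg.2.2 X₁ Y₂ (hX₁ ▸ m₁ _) (hY₂ ▸ m₂ _)
  have e4 := hg.2.2 Y₁ X₂ (hY₁ ▸ m₁ _) (hX₂ ▸ m₂ _)
  rw [g.symm] at e4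
  have o1 := S.isOrthDecomp.orth X₁ (hX₁ ▸ m₁ _) Y₂ (hY₂ ▸ m₂ _)
  have o2 := S.isOrthDecomp.orth Y₁ (hY₁ ▸ m₁ _) X₂ (hX₂ ▸ m₂ _)
  rw [Q.symm] at o2
  rw [diagOp_apply, ← hX₁, ← hX₂, hX, hY]
  simp only [map_add, LinearMap.add_apply, map_smul, LinearMap.smul_apply, smul_eq_mul,
    Submodule.coe_add, e1, e2, e3, e4, o1, o2]
  ring

/-- Every invariant metric is diagonal. -/
theorem exists_hasComponents (g : InvariantMetric Q K) :
    ∃ x₁ x₂ : ℝ, 0 < x₁ ∧ 0 < x₂ ∧ g.HasComponents 𝔭₁ 𝔭₂ x₁ x₂ := by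
  set D := S.isOrthDecomp
  let P := (isotropyRep Q K).projectionOnto _ (isCompl_isotropyRep Q K)
  -- Schur's lemma is available for forms on all of `𝔤`, so the metric is extended by zero along
  -- `𝔨`.
  let B : LinearMap.BilinForm ℝ (LieAlg n G) := LinearMap.BilinForm.comp g.form P P
  have hP : ∀ X : isotropyRep Q K, P X = X := Submodule.projectionOnto_apply_left _
  have hPc : ∀ X, (P X : LieAlg n G) = Q.toScalarProduct.orthProj (isotropyRep Q K) X :=
    D.projectionOnto_eq (isCompl_isotropyRep Q K)
  have hBP : ∀ X Y : isotropyRep Q K, B X Y = g.form X Y := fun X Y => by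
    change g.form (P X) (P Y) = _
    rw [hP, hP]
  have hB : IsAdInvariant K B := fun a ha X Y =>
    g.inv a ha _ _ _ _ (by rw [hPc, hPc, orthProj_Ad Q (isAdStable_isotropyRep Q) ha])
      (by rw [hPc, hPc, orthProj_Ad Q (isAdStable_isotropyRep Q) ha])
  have hs : ∀ X Y, B X Y = B Y X := fun X Y => g.symm _ _
  have key : ∀ W : Submodule ℝ (LieAlg n G), IsAdIrreducible K W → W ≤ isotropyRep Q K →
      ∃ c : ℝ, 0 < c ∧ ∀ X ∈ W, ∀ Y ∈ W, B X Y = c * Q.form X Y := by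
    intro W hW hle
    obtain ⟨c, hc⟩ := hW.exists_eq_mul Q hB hs
    obtain ⟨X, hX, hX0⟩ := Submodule.exists_mem_ne_zero_of_ne_bot hW.1
    refine ⟨c, ?_, hc⟩
    have h1 := hc X hX X hX
    rw [hBP ⟨X, hle hX⟩ ⟨X, hle hX⟩] at h1
    have h2 := g.pos ⟨X, hle hX⟩ fun h => hX0 (congrArg Subtype.val h)
    rw [h1] at h2
    exact pos_of_mul_pos_left h2 (Q.pos X hX0).le
  obtain ⟨x₁, h1, e1⟩ := key 𝔭₁ S.irr₁ D.left_le
  obtain ⟨x₂, h2, e2⟩ := key 𝔭₂ S.irr₂ D.right_le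
  refine ⟨x₁, x₂, h1, h2, fun X Y hX hY => ?_, fun X Y hX hY => ?_, fun X Y hX hY => ?_⟩
  · rw [← hBP, e1 X hX Y hY]
  · rw [← hBP, e2 X hX Y hY]
  · rw [← hBP, S.irr₁.eq_zero S.irr₂ S.ineq Q hB X hX Y hY]

theorem ext_components {g g' : InvariantMetric Q K} {x₁ x₂ : ℝ}
    (hg : g.HasComponents 𝔭₁ 𝔭₂ x₁ x₂) (hg' : g'.HasComponents 𝔭₁ 𝔭₂ x₁ x₂) : g = g' :=
  InvariantMetric.ext_form fun X Y =>
    (S.isDiagonal_of_hasComponents hg X Y).trans (S.isDiagonal_of_hasComponents hg' X Y).symm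

theorem exists_test_vector : ∃ X : isotropyRep Q K, (X : LieAlg n G) ∈ 𝔭₁ ∧ Q.form X X = 1 := by
  obtain ⟨X, hX, hX0⟩ := Submodule.exists_mem_ne_zero_of_ne_bot S.irr₁.1
  have hp := Q.pos X hX0
  have hm := 𝔭₁.smul_mem (√(Q.form X X))⁻¹ hX
  refine ⟨⟨_, S.isOrthDecomp.left_le hm⟩, hm, ?_⟩
  simp only [map_smul, LinearMap.smul_apply, smul_eq_mul]
  have := Real.mul_self_sqrt hp.le
  have := (Real.sqrt_pos.mpr hp).ne'
  field_simp
  nlinarith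

/-- The invariant metric `x₁ Q|_{𝔭₁} ⊕ x₂ Q|_{𝔭₂}`. -/
theorem exists_metric {x₁ x₂ : ℝ} (h₁ : 0 < x₁) (h₂ : 0 < x₂) :
    ∃ g : InvariantMetric Q K, g.HasComponents 𝔭₁ 𝔭₂ x₁ x₂ := by
  set D := S.isOrthDecomp
  let B : LinearMap.BilinForm ℝ (isotropyRep Q K) :=
    LinearMap.BilinForm.restrict (Q.form ∘ₗ diagOp Q.toScalarProduct 𝔭₁ 𝔭₂ x₁ x₂) (isotropyRep Q K)
  have hB : ∀ X Y : isotropyRep Q K,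
    B X Y = Q.form (diagOp Q.toScalarProduct 𝔭₁ 𝔭₂ x₁ x₂ X) Y := fun _ _ => rfl
  have hst : ∀ {a}, a ∈ K → ∀ X, diagOp Q.toScalarProduct 𝔭₁ 𝔭₂ x₁ x₂ (Ad a X) =
      Ad a (diagOp Q.toScalarProduct 𝔭₁ 𝔭₂ x₁ x₂ X) := by
    intro a ha X
    simp only [diagOp_apply, map_add, map_smul, orthProj_Ad Q S.irr₁.2.1 ha,
      orthProj_Ad Q S.irr₂.2.1 ha]
  refine ⟨⟨⟨B, fun X Y => ?_, fun X hX => ?_⟩, fun a ha X Y X' Y' hX hY => ?_⟩,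
    fun X Y hX hY => ?_, fun X Y hX hY => ?_, fun X Y hX hY => ?_⟩
  · rw [hB, hB, diagOp_symm, Q.symm]
  · obtain ⟨X₁, X₂, hX₁, hX₂, hXX⟩ := S.exists_decomp X
    have m₁ : (X₁ : LieAlg n G) ∈ 𝔭₁ := hX₁ ▸ ScalarProduct.orthProj_mem _
    have m₂ : (X₂ : LieAlg n G) ∈ 𝔭₂ := hX₂ ▸ ScalarProduct.orthProj_mem _
    have o1 := D.orth X₁ m₁ X₂ m₂
    have o2 := D.swap.orth X₂ m₂ X₁ m₁
    have e : B X X = x₁ * Q.form X₁ X₁ + x₂ * Q.form X₂ X₂ := by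
      rw [hB, diagOp_apply, ← hX₁, ← hX₂, hXX]
      simp only [map_add, LinearMap.add_apply, map_smul, LinearMap.smul_apply, smul_eq_mul,
        Submodule.coe_add, o1, o2]
      ring
    rw [e]
    have n1 : 0 ≤ Q.form X₁ X₁ := Q.self_nonneg _
    have n2 : 0 ≤ Q.form X₂ X₂ := Q.self_nonneg _
    by_contra hle
    have z1 : Q.form X₁ X₁ = 0 := by nlinarith [mul_nonneg h₁.le n1, mul_nonneg h₂.le n2]
    have z2 : Q.form X₂ X₂ = 0 := by nlinarith [mul_nonneg h₁.le n1, mul_nonneg h₂.le n2]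
    refine hX ?_
    have e1 : X₁ = 0 := Subtype.ext (Q.eq_zero_of_self z1)
    have e2 : X₂ = 0 := Subtype.ext (Q.eq_zero_of_self z2)
    rw [hXX, e1, e2, add_zero]
  · change B X' Y' = B X Y
    rw [hB, hB, hX, hY, hst ha, Q.inv]
  · change B X Y = _
    rw [hB, diagOp_apply, ScalarProduct.orthProj_of_mem hX, ScalarProduct.orthProj_of_orthogonal
      fun Z hZ => D.swap.orth Z hZ X hX]
    simp
  · change B X Y = _
    rw [hB, diagOp_apply, ScalarProduct.orthProj_of_mem hX, ScalarProduct.orthProj_of_orthogonal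
      fun Z hZ => D.orth Z hZ X hX]
    simp
  · change B X Y = _
    rw [hB, diagOp_apply, ScalarProduct.orthProj_of_mem hX, ScalarProduct.orthProj_of_orthogonal
      fun Z hZ => D.swap.orth Z hZ X hX]
    simp [D.orth X hX Y hY]

end IsotropySplitting

end TwoSummands

/-! ### The Ricci tensor of the diagonal metrics -/

/-- The coefficients of the Ricci curvatures `r₁ = α₁ - β₁ y⁻¹ + γ₁ y²` and
`r₂ = α₂ - β₂ y + γ₂ y⁻²` of the metrics `x₁ Q|_{𝔭₁} ⊕ x₂ Q|_{𝔭₂}`, `y = x₁ / x₂`. -/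
structure RicciCoeffs where
  (α₁ β₁ γ₁ α₂ β₂ γ₂ : ℝ)
  β₁_pos : 0 < β₁
  γ₁_pos : 0 < γ₁
  α₁_ge : 2 * β₁ ≤ α₁
  β₂_pos : 0 < β₂
  γ₂_pos : 0 < γ₂
  α₂_ge : 2 * β₂ ≤ α₂

namespace RicciCoeffs

/-- The Ricci curvature on the first summand. -/
noncomputable def r₁ (c : RicciCoeffs) (y : ℝ) : ℝ := c.α₁ - c.β₁ * y⁻¹ + c.γ₁ * y ^ 2

/-- The Ricci curvature on the second summand. -/
noncomputable def r₂ (c : RicciCoeffs) (y : ℝ) : ℝ := c.α₂ - c.β₂ * y + c.γ₂ * y⁻¹ ^ 2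

/-- The coefficients with the two summands exchanged. -/
def swap (c : RicciCoeffs) : RicciCoeffs where
  α₁ := c.α₂
  β₁ := c.β₂
  γ₁ := c.γ₂
  α₂ := c.α₁
  β₂ := c.β₁
  γ₂ := c.γ₁
  β₁_pos := c.β₂_pos
  γ₁_pos := c.γ₂_pos
  α₁_ge := c.α₂_ge
  β₂_pos := c.β₁_pos
  γ₂_pos := c.γ₁_pos
  α₂_ge := c.α₁_ge

theorem swap_r₁ (c : RicciCoeffs) (y : ℝ) : c.swap.r₁ y = c.r₂ y⁻¹ := by
  simp [swap, r₁, r₂]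

theorem swap_r₂ (c : RicciCoeffs) (y : ℝ) : c.swap.r₂ y = c.r₁ y⁻¹ := by
  simp [swap, r₁, r₂]

end RicciCoeffs

section RicciBilinear

variable {𝔤 : Type*} [LieRing 𝔤] [LieAlgebra ℝ 𝔤] [FiniteDimensional ℝ 𝔤]
  {𝔭 𝔨 : Submodule ℝ 𝔤} (h : IsCompl 𝔭 𝔨) (g : ScalarProduct 𝔭)

theorem ricci_add_left (Y Y' Z : 𝔭) : ricci h g (Y + Y') Z = ricci h g Y Z + ricci h g Y' Z := by
  rw [ricci, ricci, ricci, map_add, LinearMap.comp_add, map_add]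

theorem ricci_add_right (Y Z Z' : 𝔭) : ricci h g Y (Z + Z') = ricci h g Y Z + ricci h g Y Z' := by
  rw [ricci, ricci, ricci, map_add, LinearMap.add_comp, map_add]

end RicciBilinear

/-! ### Consequences of maximality and the Ricci coefficients -/

namespace IsotropySplitting

variable {n : ℕ} {G : Type*} [TopologicalSpace G] [ChartedSpace (EuclideanSpace ℝ (Fin n)) G]
  [Group G] {K : Subgroup G} {𝔭₁ 𝔭₂ : Submodule ℝ (LieAlg n G)} {Q : BiinvariantProduct n G}
  [LieGroup (𝓡 n) ∞ G] (S : IsotropySplitting Q K 𝔭₁ 𝔭₂)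
include S

/-- If `[𝔭₁, 𝔭₁]` has no component in `𝔭₂`, then `𝔨 ⊕ 𝔭₁` is an intermediate Lie algebra. -/
theorem exists_lie_right (hmax : IsMaximalIsotropy (n := n) K) :
    ∃ X ∈ 𝔭₁, ∃ Y ∈ 𝔭₁, Q.toScalarProduct.orthProj 𝔭₂ ⁅X, Y⁆ ≠ 0 := by
  by_contra! hcon
  set D := S.isOrthDecomp
  have hk : ∀ X ∈ isotropyAlgebra n K, Q.toScalarProduct.orthProj 𝔭₂ X = 0 := fun X hX =>
    ScalarProduct.orthProj_of_orthogonal fun Y hY => by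
      rw [Q.symm, D.form_eq_zero hX (D.right_le hY)]
  have h1 : ∀ X ∈ 𝔭₁, Q.toScalarProduct.orthProj 𝔭₂ X = 0 := fun X hX =>
    ScalarProduct.orthProj_of_orthogonal fun Y hY => D.swap.orth Y hY X hX
  have hdec : ∀ X, Q.toScalarProduct.orthProj 𝔭₂ X = 0 →
      ∃ X₀ ∈ isotropyAlgebra n K, ∃ X₁ ∈ 𝔭₁, X = X₀ + X₁ := by
    intro X hX
    refine ⟨Q.toScalarProduct.orthProj _ X, ScalarProduct.orthProj_mem X,
      Q.toScalarProduct.orthProj 𝔭₁ X, ScalarProduct.orthProj_mem X, ?_⟩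
    rw [D.proj_compl, D.proj_add, hX, add_zero, sub_add_cancel]
  -- The kernel of the projection to `𝔭₂` is `𝔨 ⊕ 𝔭₁`. Only the bracket of two elements of `𝔭₁`
  -- could leave it, and that is excluded by assumption. It differs from `𝔨` and from `𝔤` because
  -- both summands are nonzero.
  let 𝔥 : LieSubalgebra ℝ (LieAlg n G) :=
    { LinearMap.ker (Q.toScalarProduct.orthProj 𝔭₂) with
      lie_mem' := by
        intro X Y hX hY
        obtain ⟨X₀, hX₀, X₁, hX₁, rfl⟩ := hdec X hX
        obtain ⟨Y₀, hY₀, Y₁, hY₁, rfl⟩ := hdec Y hY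
        change Q.toScalarProduct.orthProj 𝔭₂ ⁅X₀ + X₁, Y₀ + Y₁⁆ = 0
        have m1 := isAdStable_isotropyAlgebra.lie_mem hX₀ hY₀
        have m2 := S.irr₁.2.1.lie_mem hX₀ hY₁
        have m3 := 𝔭₁.neg_mem (S.irr₁.2.1.lie_mem hY₀ hX₁)
        rw [lie_skew] at m3
        rw [add_lie, lie_add, lie_add, map_add, map_add, map_add, hk _ m1, h1 _ m2, h1 _ m3,
          hcon X₁ hX₁ Y₁ hY₁]
        simp }
  have hmem : ∀ X, X ∈ 𝔥.toSubmodule ↔ Q.toScalarProduct.orthProj 𝔭₂ X = 0 := fun X => Iff.rfl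
  rcases hmax 𝔥 (fun X hX => (hmem X).mpr (hk X hX)) (fun a ha X hX => by
      rw [hmem] at hX ⊢
      rw [orthProj_Ad Q S.irr₂.2.1 ha, hX, map_zero]) with h | h
  · refine S.irr₁.1 ((Submodule.eq_bot_iff _).mpr fun X hX => ?_)
    have h2 : X ∈ isotropyAlgebra n K := by
      rw [← h, hmem]
      exact h1 X hX
    exact Q.eq_zero_of_self (D.form_eq_zero h2 (D.left_le hX))
  · refine S.irr₂.1 ((Submodule.eq_bot_iff _).mpr fun X hX => ?_)
    have h2 : X ∈ 𝔥.toSubmodule := by rw [h]; trivial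
    rw [hmem, ScalarProduct.orthProj_of_mem hX] at h2
    exact h2

/-- By Schur each block form restricted to `𝔭₁` is a nonnegative multiple of `Q`. The factors 2 and
4 anticipate the formula of `ricci_eq`. The bound 2β ≤ α holds because the mixed block, equal to 2β,
is itself a summand of α; strict positivity comes from maximality. -/
theorem exists_blockForm_eq (hmax : IsMaximalIsotropy (n := n) K) : ∃ α β γ : ℝ,
    0 < β ∧ 0 < γ ∧ 2 * β ≤ α ∧ ∀ Y ∈ 𝔭₁, ∀ Z ∈ 𝔭₁,
      blockForm Q.toScalarProduct 𝔭₁ 𝔭₁ Y Z / 4 + blockForm Q.toScalarProduct 𝔭₁ 𝔭₂ Y Z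
        + blockForm Q.toScalarProduct 𝔭₁ (isotropyAlgebra n K) Y Z
        + blockForm Q.toScalarProduct 𝔭₂ (isotropyAlgebra n K) Y Z = α * Q.form Y Z ∧
      blockForm Q.toScalarProduct 𝔭₁ 𝔭₂ Y Z = 2 * β * Q.form Y Z ∧
      blockForm Q.toScalarProduct 𝔭₂ 𝔭₂ Y Z = 4 * γ * Q.form Y Z := by
  set D := S.isOrthDecomp
  have hQ : Q.toScalarProduct.IsLieInvariant := Q.lie_skew
  have hk := isAdStable_isotropyAlgebra (n := n) (K := K)
  have s1 := S.irr₁.2.1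
  have s2 := S.irr₂.2.1
  obtain ⟨X₀, hX₀, hX₀'⟩ := S.exists_test_vector
  have key : ∀ W W' : Submodule ℝ (LieAlg n G), IsAdStable K W → IsAdStable K W' →
      ∃ c : ℝ, 0 ≤ c ∧ ∀ Y ∈ 𝔭₁, ∀ Z ∈ 𝔭₁,
        blockForm Q.toScalarProduct W W' Y Z = c * Q.form Y Z := by
    intro W W' hW hW'
    obtain ⟨c, hc⟩ := S.irr₁.exists_eq_mul Q (isAdInvariant_blockForm Q hW hW')
      (blockForm_symm hQ W W')
    refine ⟨c, ?_, hc⟩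
    have h1 := blockForm_self_nonneg hQ W W' X₀
    rwa [hc _ hX₀ _ hX₀, hX₀', mul_one] at h1
  obtain ⟨c₁₁, n11, e11⟩ := key 𝔭₁ 𝔭₁ s1 s1
  obtain ⟨c₁₂, n12, e12⟩ := key 𝔭₁ 𝔭₂ s1 s2
  obtain ⟨c₂₂, n22, e22⟩ := key 𝔭₂ 𝔭₂ s2 s2
  obtain ⟨c₁, n1, e1⟩ := key 𝔭₁ _ s1 hk
  obtain ⟨c₂, n2, e2⟩ := key 𝔭₂ _ s2 hk
  have p12 : 0 < c₁₂ := by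
    refine n12.lt_of_ne fun h0 => ?_
    obtain ⟨X, hX, Y, hY, hne⟩ := S.exists_lie_right hmax
    refine hne (orthProj_lie_eq_zero_of_blockForm hQ 𝔭₁ 𝔭₂ ?_ hY)
    rw [e12 X hX X hX, ← h0, zero_mul]
  -- If this block vanished, `[𝔭₁, 𝔭₂]` would have no `𝔭₂`-part, hence by skewness `[𝔭₂, 𝔭₂]` no
  -- `𝔭₁`-part, contradicting maximality with the summands exchanged.
  have p22 : 0 < c₂₂ := by
    refine n22.lt_of_ne fun h0 => ?_
    obtain ⟨X, hX, Y, hY, hne⟩ := S.swap.exists_lie_right hmax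
    refine hne (ScalarProduct.orthProj_of_orthogonal fun Z hZ => ?_)
    have h1 := orthProj_lie_eq_zero_of_blockForm hQ 𝔭₂ 𝔭₂
      (by rw [e22 Z hZ Z hZ, ← h0, zero_mul]) hX
    have h2 := ScalarProduct.form_sub_orthProj (Q := Q.toScalarProduct) ⁅Z, X⁆ hY
    have h3 := Q.lie_skew X Z Y
    rw [h1, sub_zero, ← lie_skew, map_neg, Q.symm, h3, neg_neg] at h2
    exact h2
  refine ⟨c₁₁ / 4 + c₁₂ + c₁ + c₂, c₁₂ / 2, c₂₂ / 4, by linarith, by linarith, by linarith,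
    fun Y hY Z hZ => ⟨?_, ?_, ?_⟩⟩
  · rw [e11 Y hY Z hZ, e12 Y hY Z hZ, e1 Y hY Z hZ, e2 Y hY Z hZ]
    ring
  · rw [e12 Y hY Z hZ]
    ring
  · rw [e22 Y hY Z hZ]
    ring

/-- The Ricci tensor of the metric `x₁ Q|_{𝔭₁} ⊕ x₂ Q|_{𝔭₂}`. -/
theorem exists_ricciCoeffs (hmax : IsMaximalIsotropy (n := n) K) : ∃ c : RicciCoeffs,
    ∀ (g : InvariantMetric Q K) (x₁ x₂ : ℝ), 0 < x₁ → 0 < x₂ → g.HasComponents 𝔭₁ 𝔭₂ x₁ x₂ →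
      ∀ X Y, g.ric X Y = Q.form
        (diagOp Q.toScalarProduct 𝔭₁ 𝔭₂ (c.r₁ (x₁ / x₂)) (c.r₂ (x₁ / x₂)) X) Y := by
  set D := S.isOrthDecomp
  have hQ : Q.toScalarProduct.IsLieInvariant := Q.lie_skew
  obtain ⟨α₁, β₁, γ₁, hβ₁, hγ₁, hα₁, H₁⟩ := S.exists_blockForm_eq hmax
  obtain ⟨α₂, β₂, γ₂, hβ₂, hγ₂, hα₂, H₂⟩ := S.swap.exists_blockForm_eq hmax
  refine ⟨⟨α₁, β₁, γ₁, α₂, β₂, γ₂, hβ₁, hγ₁, hα₁, hβ₂, hγ₂, hα₂⟩, ?_⟩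
  intro g x₁ x₂ h₁ h₂ hg X Y
  have hd := S.isDiagonal_of_hasComponents hg
  have R := @ricci_eq _ _ _ _ _ hQ _ _ _ _ D (isCompl_isotropyRep Q K) _ _ _ h₁.ne' h₂.ne' hd
  obtain ⟨X₁, X₂, hX₁, hX₂, hX⟩ := S.exists_decomp X
  obtain ⟨Y₁, Y₂, hY₁, hY₂, hY⟩ := S.exists_decomp Y
  have mX₁ : (X₁ : LieAlg n G) ∈ 𝔭₁ := hX₁ ▸ ScalarProduct.orthProj_mem _
  have mX₂ : (X₂ : LieAlg n G) ∈ 𝔭₂ := hX₂ ▸ ScalarProduct.orthProj_mem _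
  have mY₁ : (Y₁ : LieAlg n G) ∈ 𝔭₁ := hY₁ ▸ ScalarProduct.orthProj_mem _
  have mY₂ : (Y₂ : LieAlg n G) ∈ 𝔭₂ := hY₂ ▸ ScalarProduct.orthProj_mem _
  have hp₁ : ∀ {Z}, Z ∈ 𝔭₁ → diagOp Q.toScalarProduct 𝔭₁ 𝔭₂ x₁ x₂ Z = x₁ • Z := by
    intro Z hZ
    rw [diagOp_apply, ScalarProduct.orthProj_of_mem hZ, ScalarProduct.orthProj_of_orthogonal
      fun V hV => D.swap.orth V hV Z hZ, smul_zero, add_zero]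
  have hp₂ : ∀ {Z}, Z ∈ 𝔭₂ → diagOp Q.toScalarProduct 𝔭₁ 𝔭₂ x₁ x₂ Z = x₂ • Z := by
    intro Z hZ
    rw [diagOp_apply, ScalarProduct.orthProj_of_mem hZ, ScalarProduct.orthProj_of_orthogonal
      fun V hV => D.orth V hV Z hZ, smul_zero, zero_add]
  have hk := isAdStable_isotropyAlgebra (n := n) (K := K)
  have s1 := S.irr₁.2.1
  have s2 := S.irr₂.2.1
  have Z₁₂ : ∀ W W' : Submodule ℝ (LieAlg n G), IsAdStable K W → IsAdStable K W' →
      ∀ Y ∈ 𝔭₁, ∀ Z ∈ 𝔭₂, blockForm Q.toScalarProduct W W' Y Z = 0 :=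
    fun W W' hW hW' => S.irr₁.eq_zero S.irr₂ S.ineq Q (isAdInvariant_blockForm Q hW hW')
  have Z₂₁ : ∀ W W' : Submodule ℝ (LieAlg n G), IsAdStable K W → IsAdStable K W' →
      ∀ Y ∈ 𝔭₂, ∀ Z ∈ 𝔭₁, blockForm Q.toScalarProduct W W' Y Z = 0 :=
    fun W W' hW hW' Y hY Z hZ => by rw [blockForm_symm hQ]; exact Z₁₂ W W' hW hW' Z hZ Y hY
  have R₁₁ := R X₁ Y₁ (hp₁ mX₁) (hp₁ mY₁)
  have R₁₂ := R X₁ Y₂ (hp₁ mX₁) (hp₂ mY₂)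
  have R₂₁ := R X₂ Y₁ (hp₂ mX₂) (hp₁ mY₁)
  have R₂₂ := R X₂ Y₂ (hp₂ mX₂) (hp₂ mY₂)
  rw [Z₁₂ _ _ s1 s1 _ mX₁ _ mY₂, Z₁₂ _ _ s2 s2 _ mX₁ _ mY₂, Z₁₂ _ _ s1 s2 _ mX₁ _ mY₂,
    Z₁₂ _ _ s1 hk _ mX₁ _ mY₂, Z₁₂ _ _ s2 hk _ mX₁ _ mY₂] at R₁₂
  rw [Z₂₁ _ _ s1 s1 _ mX₂ _ mY₁, Z₂₁ _ _ s2 s2 _ mX₂ _ mY₁, Z₂₁ _ _ s1 s2 _ mX₂ _ mY₁,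
    Z₂₁ _ _ s1 hk _ mX₂ _ mY₁, Z₂₁ _ _ s2 hk _ mX₂ _ mY₁] at R₂₁
  obtain ⟨a1, a2, a3⟩ := H₁ _ mX₁ _ mY₁
  obtain ⟨b1, b2, b3⟩ := H₂ _ mX₂ _ mY₂
  rw [blockForm_comm hQ 𝔭₂ 𝔭₁] at b1 b2
  have o1 := D.orth _ mX₁ _ mY₂
  have o2 := D.swap.orth _ mX₂ _ mY₁
  have e1 : ricci (isCompl_isotropyRep Q K) g.toScalarProduct X₁ Y₁ =
      (α₁ - β₁ * (x₁ / x₂)⁻¹ + γ₁ * (x₁ / x₂) ^ 2) * Q.form X₁ Y₁ := by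
    rw [R₁₁]
    rw [a2] at a1 ⊢
    rw [a3]
    have : x₁ * x₁ / (4 * x₁ ^ 2) = 1 / 4 := by field_simp
    rw [this]
    -- Only the combination α₁ of the blocks is known, so one isotropy block is eliminated in favour
    -- of it. The mixed block has coefficient 1 - 1/(2y): its 1 is part of α₁, the rest gives -β₁/y.
    have a4 : blockForm Q.toScalarProduct 𝔭₁ (isotropyAlgebra n K) X₁ Y₁ =
      α₁ * Q.form X₁ Y₁ - blockForm Q.toScalarProduct 𝔭₁ 𝔭₁ X₁ Y₁ / 4 - 2 * β₁ * Q.form X₁ Y₁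
      - blockForm Q.toScalarProduct 𝔭₂ (isotropyAlgebra n K) X₁ Y₁ := by linarith
    rw [a4]
    field_simp
    ring
  have e2 : ricci (isCompl_isotropyRep Q K) g.toScalarProduct X₂ Y₂ =
      (α₂ - β₂ * (x₁ / x₂) + γ₂ * (x₁ / x₂)⁻¹ ^ 2) * Q.form X₂ Y₂ := by
    rw [R₂₂]
    rw [b2] at b1 ⊢
    rw [b3]
    have : x₂ * x₂ / (4 * x₂ ^ 2) = 1 / 4 := by field_simp
    rw [this]
    have b4 : blockForm Q.toScalarProduct 𝔭₂ (isotropyAlgebra n K) X₂ Y₂ =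
      α₂ * Q.form X₂ Y₂ - blockForm Q.toScalarProduct 𝔭₂ 𝔭₂ X₂ Y₂ / 4 - 2 * β₂ * Q.form X₂ Y₂
      - blockForm Q.toScalarProduct 𝔭₁ (isotropyAlgebra n K) X₂ Y₂ := by linarith
    rw [b4]
    field_simp
    ring
  rw [InvariantMetric.ric, diagOp_apply, ← hX₁, ← hX₂, hX, hY, ricci_add_left, ricci_add_right,
    ricci_add_right, e1, e2, R₁₂, R₂₁]
  simp only [map_add, LinearMap.add_apply, map_smul, LinearMap.smul_apply, smul_eq_mul,
    Submodule.coe_add, o1, o2, RicciCoeffs.r₁, RicciCoeffs.r₂]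
  ring

end IsotropySplitting

/-! ### Autonomous equations on the line -/

section ScalarODE

open scoped NNReal

/-- A bounded Lipschitz vector field on the line has global integral curves. -/
theorem exists_global_solution {f : ℝ → ℝ} {k L : ℝ≥0} (hf : LipschitzWith k f)
    (hL : ∀ x, |f x| ≤ L) (x₀ : ℝ) : ∃ y : ℝ → ℝ, y 0 = x₀ ∧ ∀ s, HasDerivAt y (f (y s)) s := by
  have h1 : ∀ N : ℕ, ∃ α : ℝ → ℝ, α 0 = x₀ ∧
      ∀ t ∈ Ioo (-(N + 1 : ℝ)) (N + 1), HasDerivAt α (f (α t)) t := by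
    intro N
    have hN : (0 : ℝ) ≤ N := N.cast_nonneg
    have hP : IsPicardLindelof (fun _ => f)
        (⟨0, by constructor <;> linarith⟩ : Icc (-(N + 1 : ℝ)) (N + 1)) x₀
        -- Radius L(N+1): at speed at most L a curve cannot travel farther in time N+1, so each
        -- Picard interval is covered in full.
        (L * (N + 1)) 0 L k := by
      refine IsPicardLindelof.of_time_independent (fun x _ => hL x) hf.lipschitzOnWith ?_
      simp
    obtain ⟨α, h0, hα⟩ := hP.exists_eq_forall_mem_Icc_hasDerivWithinAt₀
    exact ⟨α, h0, fun t ht => (hα t (Ioo_subset_Icc_self ht)).hasDerivAt (Icc_mem_nhds ht.1 ht.2)⟩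
  choose α h0 hα using h1
  have huniq : ∀ (N M : ℕ) (s : ℝ), |s| < N + 1 → |s| < M + 1 → α N s = α M s := by
    intro N M s hN hM
    set c : ℝ := min (N + 1) (M + 1) with hc
    have hcp : 0 < c := lt_min (by positivity) (by positivity)
    have hcN : c ≤ N + 1 := min_le_left _ _
    have hcM : c ≤ M + 1 := min_le_right _ _
    refine ODE_solution_unique_of_mem_Ioo (v := fun _ => f) (s := fun _ => univ) (a := -c) (b := c)
      (fun t _ => hf.lipschitzOnWith) (t₀ := 0) ⟨by linarith, hcp⟩
      (fun t ht => ⟨hα N t ⟨by linarith [ht.1], by linarith [ht.2]⟩, trivial⟩)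
      (fun t ht => ⟨hα M t ⟨by linarith [ht.1], by linarith [ht.2]⟩, trivial⟩)
      (by rw [h0, h0]) (abs_lt.mp (lt_min hN hM))
  refine ⟨fun s => α ⌈|s|⌉₊ s, h0 _, fun s => ?_⟩
  have hs : |s| < ⌈|s|⌉₊ + 1 := (Nat.le_ceil _).trans_lt (lt_add_one _)
  refine (hα ⌈|s|⌉₊ s (abs_lt.mp hs)).congr_of_eventuallyEq ?_
  filter_upwards [continuous_abs.continuousAt.eventually_lt continuousAt_const hs] with u hu
  exact huniq _ _ _ ((Nat.le_ceil _).trans_lt (lt_add_one _)) hu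

/-- A solution of `y' = F(y)` that starts at `a` increases to the first zero `b` of `F`. -/
theorem exists_monotone_solution {F : ℝ → ℝ} {a b : ℝ} (hab : a ≤ b) {k : ℝ≥0}
    (hF : LipschitzOnWith k F (Icc a b)) (hb : F b = 0) (hpos : ∀ y ∈ Ico a b, 0 < F y) :
    ∃ y : ℝ → ℝ, y 0 = a ∧ Continuous y ∧ (∀ s, 0 ≤ s → y s ∈ Icc a b) ∧
      (∀ s, 0 ≤ s → HasDerivAt y (F (y s)) s) ∧ Tendsto y atTop (𝓝 b) := by
  -- Extending `F` by its endpoint values gives a bounded, globally Lipschitz, nonnegative field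
  -- that vanishes beyond `b`; its solution increases and stops if it reaches `b`.
  set f : ℝ → ℝ := fun x => F (projIcc a b hab x) with hf
  have hfl : LipschitzWith k f := by
    have h1 := (lipschitzOnWith_iff_restrict.mp hF).comp (LipschitzWith.projIcc hab)
    rwa [mul_one] at h1
  have hfF : ∀ x ∈ Icc a b, f x = F x := fun x hx => by
    simp only [hf, projIcc_of_mem hab hx]
  have hge : ∀ x, b ≤ x → f x = 0 := fun x hx => by
    simp only [hf, projIcc_of_right_le hab hx, hb]
  have hf0 : ∀ x, 0 ≤ f x := by
    intro x
    rcases (projIcc a b hab x).2.2.lt_or_eq with h | h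
    · exact (hpos _ ⟨(projIcc a b hab x).2.1, h⟩).le
    · simp only [hf, h, hb, le_refl]
  obtain ⟨L, hL⟩ := (isCompact_Icc (a := a) (b := b)).exists_bound_of_continuousOn hF.continuousOn
  obtain ⟨y, hy0, hy⟩ := exists_global_solution (L := L.toNNReal) hfl (fun x =>
    (hL _ (projIcc a b hab x).2).trans (Real.le_coe_toNNReal L)) a
  have hc : Continuous y := continuous_iff_continuousAt.mpr fun s => (hy s).continuousAt
  have hmono : Monotone y := monotone_of_hasDerivAt_nonneg hy fun s => hf0 _
  have hle : ∀ s, 0 ≤ s → y s ≤ b := by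
    intro s hs
    by_contra! hlt
    obtain ⟨u, hu, hub⟩ := intermediate_value_Icc hs hc.continuousOn
      (show b ∈ Icc (y 0) (y s) from ⟨hy0 ▸ hab, hlt.le⟩)
    have h2 : y s ≤ y u := by
      have h3 : ∀ x ∈ Icc u s, y x = y u := constant_of_has_deriv_right_zero hc.continuousOn
        fun x hx => by
          have h4 := (hy x).hasDerivWithinAt (s := Ici x)
          rwa [hge _ (hub ▸ hmono hx.1)] at h4
      exact (h3 s ⟨hu.2, le_rfl⟩).le
    rw [hub] at h2
    linarith
  have hmem : ∀ s, 0 ≤ s → y s ∈ Icc a b := fun s hs => ⟨hy0 ▸ hmono hs, hle s hs⟩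
  refine ⟨y, hy0, hc, hmem, fun s hs => hfF _ (hmem s hs) ▸ hy s, ?_⟩
  rcases hab.eq_or_lt with rfl | hab'
  · refine tendsto_const_nhds.congr' ?_
    filter_upwards [eventually_ge_atTop 0] with s hs
    exact le_antisymm (hmem s hs).1 (hmem s hs).2
  rw [tendsto_order]
  constructor
  · intro c hcb
    by_contra hcon
    have hall : ∀ s, 0 ≤ s → y s ≤ c := by
      intro s hs
      by_contra! hlt
      refine hcon ?_
      filter_upwards [eventually_ge_atTop s] with u hu
      exact hlt.trans_le (hmono hu)
    have hac : a ≤ c := hy0 ▸ hall 0 le_rfl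
    -- A solution staying below c < b would have speed at least the positive minimum of `F` on [a,
    -- c]; at time (b - a + 1)/F(z) it would be at least b + 1.
    obtain ⟨z, hz, hzmin⟩ := (isCompact_Icc (a := a) (b := c)).exists_isMinOn
      (nonempty_Icc.mpr hac) (hF.continuousOn.mono (Icc_subset_Icc_right hcb.le))
    have hFz : 0 < F z := hpos z ⟨hz.1, hz.2.trans_lt hcb⟩
    have hlow : ∀ s, 0 ≤ s → a + F z * s ≤ y s := by
      intro s hs
      have h1 : MonotoneOn (fun s => y s - F z * s) (Icc 0 s) := by
        refine monotoneOn_of_deriv_nonneg (convex_Icc 0 s) (by fun_prop) ?_ ?_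
        · exact fun x _ => ((hy x).sub ((hasDerivAt_id x).const_mul (F z))).differentiableAt
            |>.differentiableWithinAt
        · intro x hx
          rw [interior_Icc] at hx
          have h2 : deriv (fun s => y s - F z * s) x = f (y x) - F z * 1 :=
            ((hy x).sub ((hasDerivAt_id x).const_mul (F z))).deriv
          rw [h2, hfF _ (hmem x hx.1.le), mul_one, sub_nonneg]
          exact hzmin ⟨(hmem x hx.1.le).1, hall x hx.1.le⟩
      have h2 := h1 ⟨le_rfl, hs⟩ ⟨hs, le_rfl⟩ hs
      simp only [hy0, mul_zero, sub_zero] at h2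
      linarith
    have h3 := (hlow ((b - a + 1) / F z) (by positivity)).trans (hle _ (by positivity))
    rw [mul_div_cancel₀ _ hFz.ne'] at h3
    linarith
  · intro c hcb
    filter_upwards [eventually_ge_atTop 0] with s hs
    exact (hle s hs).trans_lt hcb

end ScalarODE

/-! ### The Ricci flow of diagonal metrics -/

namespace RicciCoeffs

variable (c : RicciCoeffs)

/-- The speed of the ratio `y = x₁ / x₂` is `2 F(y) / x₂`. -/
noncomputable def ratioField (y : ℝ) : ℝ := y * c.r₂ y - c.r₁ y

theorem contDiffOn_r₁ : ContDiffOn ℝ 1 c.r₁ (Ioi 0) := by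
  have h : ContDiffOn ℝ 1 (fun y : ℝ => y⁻¹) (Ioi 0) :=
    contDiffOn_id.inv fun x hx => (mem_Ioi.mp hx).ne'
  exact (contDiffOn_const.sub (contDiffOn_const.mul h)).add
    (contDiffOn_const.mul (contDiffOn_id.pow 2))

theorem contDiffOn_r₂ : ContDiffOn ℝ 1 c.r₂ (Ioi 0) := by
  have h : ContDiffOn ℝ 1 (fun y : ℝ => y⁻¹) (Ioi 0) :=
    contDiffOn_id.inv fun x hx => (mem_Ioi.mp hx).ne'
  exact (contDiffOn_const.sub (contDiffOn_const.mul contDiffOn_id)).add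
    (contDiffOn_const.mul (h.pow 2))

theorem contDiffOn_ratioField : ContDiffOn ℝ 1 c.ratioField (Ioi 0) :=
  (contDiffOn_id.mul c.contDiffOn_r₂).sub c.contDiffOn_r₁

/-- Here α₂ ≥ 2β₂ enters. Together with the mirror statement `r₁_pos` for y ≥ 1/2, at every ratio at
least one of r₁, r₂ is positive. -/
theorem r₂_pos {y : ℝ} (hy : 0 < y) (hy2 : y ≤ 2) : 0 < c.r₂ y := by
  have h1 : 0 < c.γ₂ * y⁻¹ ^ 2 := mul_pos c.γ₂_pos (by positivity)
  have h2 := mul_le_mul_of_nonneg_left hy2 c.β₂_pos.le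
  have h3 := c.α₂_ge
  rw [r₂]
  linarith

theorem r₁_pos {y : ℝ} (hy : 1 / 2 ≤ y) : 0 < c.r₁ y := by
  have hy0 : 0 < y := by linarith
  have h1 := c.swap.r₂_pos (inv_pos.mpr hy0) (by rw [inv_le_comm₀ hy0 two_pos]; linarith)
  rwa [swap_r₂, inv_inv] at h1

theorem swap_ratioField {y : ℝ} (hy : 0 < y) :
    c.swap.ratioField y = -(y * c.ratioField y⁻¹) := by
  rw [ratioField, ratioField, swap_r₁, swap_r₂]
  field_simp
  ring

/-- Near 0 the term (γ₂ + β₁)/y dominates. The witness satisfies z ≤ 1 and γ₂/z ≥ β₂ + α₁ + γ₁,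
which beats all negative terms. -/
theorem exists_ratioField_pos {y : ℝ} (hy : 0 < y) : ∃ z, 0 < z ∧ z ≤ y ∧ 0 < c.ratioField z := by
  have hα₁ : 0 < c.α₁ := lt_of_lt_of_le (by linarith [c.β₁_pos]) c.α₁_ge
  have hα₂ : 0 < c.α₂ := lt_of_lt_of_le (by linarith [c.β₂_pos]) c.α₂_ge
  have hβ₁ := c.β₁_pos
  have hβ₂ := c.β₂_pos
  have hγ₁ := c.γ₁_pos
  have hγ₂ := c.γ₂_pos
  set A := c.β₂ + c.α₁ + c.γ₁ with hA
  have hAp : 0 < A := by positivity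
  refine ⟨min y (min 1 (c.γ₂ / A)), by positivity, min_le_left _ _, ?_⟩
  set z := min y (min 1 (c.γ₂ / A)) with hz
  have hz0 : 0 < z := by positivity
  have hz1 : z ≤ 1 := (min_le_right _ _).trans (min_le_left _ _)
  have hz2 : z ≤ c.γ₂ / A := (min_le_right _ _).trans (min_le_right _ _)
  have h1 : A ≤ c.γ₂ * z⁻¹ := by
    rw [← div_eq_mul_inv, le_div_iff₀ hz0, mul_comm]
    exact (le_div_iff₀ hAp).mp hz2
  have h2 : c.ratioField z = c.α₂ * z - c.β₂ * z ^ 2 + c.γ₂ * z⁻¹ - c.α₁ + c.β₁ * z⁻¹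
      - c.γ₁ * z ^ 2 := by
    rw [ratioField, r₁, r₂]
    field_simp
    ring
  have h3 : 0 < c.α₂ * z := by positivity
  have h4 : 0 < c.β₁ * z⁻¹ := by positivity
  have h5 : z ^ 2 ≤ 1 := pow_le_one₀ hz0.le hz1
  have h6 := mul_le_mul_of_nonneg_left h5 hβ₂.le
  have h7 := mul_le_mul_of_nonneg_left h5 hγ₁.le
  rw [h2]
  linarith

/-- `yE` is the only positive zero of the ratio field. -/
structure IsUniqueZero (yE : ℝ) : Prop where
  pos : 0 < yE
  zero : c.ratioField yE = 0
  unique : ∀ y, 0 < y → c.ratioField y = 0 → y = yE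

namespace IsUniqueZero

variable {c} {yE : ℝ} (hE : c.IsUniqueZero yE)
include hE

theorem swap : c.swap.IsUniqueZero yE⁻¹ where
  pos := inv_pos.mpr hE.pos
  zero := by rw [c.swap_ratioField (inv_pos.mpr hE.pos), inv_inv, hE.zero, mul_zero, neg_zero]
  unique y hy h := by
    rw [c.swap_ratioField hy, neg_eq_zero, mul_eq_zero] at h
    rw [← hE.unique y⁻¹ (inv_pos.mpr hy) (h.resolve_left hy.ne'), inv_inv]

theorem ratioField_pos {y : ℝ} (hy : 0 < y) (hlt : y < yE) : 0 < c.ratioField y := by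
  by_contra! hle
  obtain ⟨z, hz, hzy, hpos⟩ := c.exists_ratioField_pos hy
  obtain ⟨u, hu, hu0⟩ := intermediate_value_Icc' hzy
    (c.contDiffOn_ratioField.continuousOn.mono fun x hx => hz.trans_le hx.1)
    (show (0 : ℝ) ∈ Icc (c.ratioField y) (c.ratioField z) from ⟨hle, hpos.le⟩)
  have := hE.unique u (hz.trans_le hu.1) hu0
  linarith [hu.2]

/-- At the zero, yE r₂ = r₁, so r₁ and r₂ have the same sign there, and one of them is positive.
This is positivity of the Einstein constant and the cause of finite extinction. -/
theorem r₂_pos : 0 < c.r₂ yE := by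
  rcases le_total yE 2 with h | h
  · exact c.r₂_pos hE.pos h
  · have h1 := c.r₁_pos (y := yE) (by linarith)
    have h2 := hE.zero
    rw [ratioField, sub_eq_zero] at h2
    rw [← h2] at h1
    exact (pos_iff_pos_of_mul_pos h1).mp hE.pos

end IsUniqueZero

/-- A solution of `x₁' = -2 r₁(x₁ / x₂)`, `x₂' = -2 r₂(x₁ / x₂)` on `[0, T)` that shrinks to zero
with ratio tending to `yE`. -/
structure IsShrinkingSolution (yE T : ℝ) (x₁ x₂ : ℝ → ℝ) : Prop where
  pos₁ : ∀ t ∈ Ico 0 T, 0 < x₁ t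
  pos₂ : ∀ t ∈ Ico 0 T, 0 < x₂ t
  deriv₁ : ∀ t ∈ Ico 0 T, HasDerivAt x₁ (-2 * c.r₁ (x₁ t / x₂ t)) t
  deriv₂ : ∀ t ∈ Ico 0 T, HasDerivAt x₂ (-2 * c.r₂ (x₁ t / x₂ t)) t
  lim₁ : Tendsto x₁ (𝓝[<] T) (𝓝 0)
  lim₂ : Tendsto x₂ (𝓝[<] T) (𝓝 0)
  lim_ratio : Tendsto (fun t => x₁ t / x₂ t) (𝓝[<] T) (𝓝 yE)
  ratio_bounds : ∃ m M, 0 < m ∧ ∀ t ∈ Ico 0 T, m ≤ x₁ t / x₂ t ∧ x₁ t / x₂ t ≤ M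
  typeI : ∃ C, ∀ t ∈ Ico 0 T, T - t ≤ C * x₂ t

variable {c}

theorem IsShrinkingSolution.swap {yE T : ℝ} {x₁ x₂ : ℝ → ℝ} (hyE : 0 < yE)
    (h : c.swap.IsShrinkingSolution yE⁻¹ T x₂ x₁) : c.IsShrinkingSolution yE T x₁ x₂ where
  pos₁ := h.pos₂
  pos₂ := h.pos₁
  deriv₁ t ht := by
    have h1 := h.deriv₂ t ht
    rwa [swap_r₂, inv_div] at h1
  deriv₂ t ht := by
    have h1 := h.deriv₁ t ht
    rwa [swap_r₁, inv_div] at h1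
  lim₁ := h.lim₂
  lim₂ := h.lim₁
  lim_ratio := by
    have h1 := h.lim_ratio.inv₀ (inv_pos.mpr hyE).ne'
    simpa only [inv_div, inv_inv] using h1
  ratio_bounds := by
    obtain ⟨m, M, hm, hb⟩ := h.ratio_bounds
    refine ⟨(max M 1)⁻¹, m⁻¹, by positivity, fun t ht => ?_⟩
    obtain ⟨h1, h2⟩ := hb t ht
    have hp := div_pos (h.pos₁ t ht) (h.pos₂ t ht)
    rw [← inv_div (x₂ t)]
    exact ⟨inv_anti₀ hp (h2.trans (le_max_left _ _)), inv_anti₀ hm h1⟩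
  typeI := by
    obtain ⟨m, M, hm, hb⟩ := h.ratio_bounds
    obtain ⟨C, hC⟩ := h.typeI
    refine ⟨max C 0 * m⁻¹, fun t ht => (hC t ht).trans ?_⟩
    have h1 := (hb t ht).1
    rw [le_div_iff₀ (h.pos₂ t ht)] at h1
    have h2 : x₁ t ≤ m⁻¹ * x₂ t := by
      rw [← div_eq_inv_mul, le_div_iff₀ hm]
      linarith
    have hp := (h.pos₂ t ht).le
    calc C * x₁ t ≤ max C 0 * x₁ t := mul_le_mul_of_nonneg_right (le_max_left _ _) hp
      _ ≤ max C 0 * (m⁻¹ * x₂ t) := mul_le_mul_of_nonneg_left h2 (le_max_right _ _)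
      _ = _ := by ring

end RicciCoeffs

/-! ### Existence of solutions that shrink in finite time -/

namespace RicciCoeffs

variable {c : RicciCoeffs}

/-- In the time s with dt = x₂ ds the system becomes triangular: y' = 2F(y) is autonomous, x₂ = X is
an explicit exponential, and t = τ(s) is the integral of X. Undoing the time change gives the
solution; starting above `yE` reduces to this by exchanging the summands. -/
theorem exists_isShrinkingSolution_of_le {yE : ℝ} (hE : c.IsUniqueZero yE) {a₁ a₂ : ℝ}
    (h₁ : 0 < a₁) (h₂ : 0 < a₂) (hle : a₁ / a₂ ≤ yE) : ∃ (T : ℝ) (x₁ x₂ : ℝ → ℝ),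
      0 < T ∧ x₁ 0 = a₁ ∧ x₂ 0 = a₂ ∧ c.IsShrinkingSolution yE T x₁ x₂ := by
  set a := a₁ / a₂ with ha
  have ha0 : 0 < a := div_pos h₁ h₂
  have hsub : Icc a yE ⊆ Ioi 0 := fun x hx => ha0.trans_le hx.1
  have hcd : ContDiffOn ℝ 1 (fun y => 2 * c.ratioField y) (Icc a yE) :=
    contDiffOn_const.mul (c.contDiffOn_ratioField.mono hsub)
  obtain ⟨k, hk⟩ := hcd.exists_lipschitzOnWith one_ne_zero (convex_Icc a yE) isCompact_Icc
  obtain ⟨y, hy0, hyc, hym, hyd, hyl⟩ := exists_monotone_solution hle hk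
    (by rw [hE.zero, mul_zero])
    (fun x hx => mul_pos two_pos (hE.ratioField_pos (ha0.trans_le hx.1) hx.2))
  -- The curve is known to lie in [a, yE] only for s ≥ 0; the absolute value makes the integrand
  -- continuous on the whole line, so τ is globally defined and strictly increasing.
  have hq : Continuous fun s => c.r₂ (y |s|) :=
    (c.contDiffOn_r₂.continuousOn.mono hsub).comp_continuous (hyc.comp continuous_abs)
      fun s => hym _ (abs_nonneg s)
  set X : ℝ → ℝ := fun s => a₂ * Real.exp (-2 * ∫ u in (0 : ℝ)..s, c.r₂ (y |u|)) with hX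
  have hXp : ∀ s, 0 < X s := fun s => mul_pos h₂ (Real.exp_pos _)
  have hX0 : X 0 = a₂ := by simp [hX]
  have hXd' : ∀ s, HasDerivAt X (-2 * c.r₂ (y |s|) * X s) s := by
    intro s
    have h1 := (((hq.integral_hasStrictDerivAt 0 s).hasDerivAt.const_mul (-2)).exp).const_mul a₂
    exact h1.congr_deriv (by simp only [hX]; ring)
  have hXd : ∀ s, 0 ≤ s → HasDerivAt X (-2 * c.r₂ (y s) * X s) s := fun s hs => by
    have h1 := hXd' s
    rwa [abs_of_nonneg hs] at h1
  have hXc : Continuous X := continuous_iff_continuousAt.mpr fun s => (hXd' s).continuousAt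
  set τ : ℝ → ℝ := fun s => ∫ u in (0 : ℝ)..s, X u with hτ
  have hτ0 : τ 0 = 0 := by simp [hτ]
  have hτd : ∀ s, HasStrictDerivAt τ (X s) s := fun s => hXc.integral_hasStrictDerivAt 0 s
  have hτc : Continuous τ := continuous_iff_continuousAt.mpr fun s => (hτd s).hasDerivAt.continuousAt
  have hτm : StrictMono τ := strictMono_of_hasDerivAt_pos (fun s => (hτd s).hasDerivAt) hXp
  -- decay of `X`
  obtain ⟨ρ, hρ, s₁, hs₁, hr⟩ : ∃ ρ > 0, ∃ s₁, 0 ≤ s₁ ∧ ∀ s, s₁ ≤ s → ρ ≤ c.r₂ (y s) := by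
    have h1 : Tendsto (fun s => c.r₂ (y s)) atTop (𝓝 (c.r₂ yE)) :=
      ((c.contDiffOn_r₂.continuousOn.continuousAt (Ioi_mem_nhds hE.pos)).tendsto).comp hyl
    obtain ⟨s, hs⟩ := eventually_atTop.mp
      (h1.eventually (eventually_gt_nhds (half_lt_self hE.r₂_pos)))
    exact ⟨_, half_pos hE.r₂_pos, max s 0, le_max_right _ _,
      fun u hu => (hs u ((le_max_left _ _).trans hu)).le⟩
  -- Since X' = -2 r₂ X ≤ -2ρX and τ' = X. This single monotonicity bounds τ, and in the limit it
  -- yields 2ρ(T - τ) ≤ X, the type I estimate.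
  have hanti : AntitoneOn (fun s => X s + 2 * ρ * τ s) (Ici s₁) := by
    refine antitoneOn_of_deriv_nonpos (convex_Ici s₁) (by fun_prop) ?_ ?_
    · exact fun s _ => ((hXd' s).add ((hτd s).hasDerivAt.const_mul (2 * ρ))).differentiableAt
        |>.differentiableWithinAt
    · intro s hs
      rw [interior_Ici] at hs
      have h1 : deriv (fun s => X s + 2 * ρ * τ s) s = _ :=
        ((hXd s (hs₁.trans hs.le)).add ((hτd s).hasDerivAt.const_mul (2 * ρ))).deriv
      rw [h1]
      have := mul_le_mul_of_nonneg_right (hr s hs.le) (hXp s).le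
      linarith
  have hexp : AntitoneOn (fun s => X s * Real.exp (2 * ρ * s)) (Ici s₁) := by
    have hd : ∀ s, HasDerivAt (fun s => Real.exp (2 * ρ * s)) (Real.exp (2 * ρ * s) * (2 * ρ)) s := by
      intro s
      have h1 := ((hasDerivAt_id s).const_mul (2 * ρ)).exp
      rwa [mul_one] at h1
    refine antitoneOn_of_deriv_nonpos (convex_Ici s₁) (by fun_prop) ?_ ?_
    · exact fun s _ => ((hXd' s).mul (hd s)).differentiableAt |>.differentiableWithinAt
    · intro s hs
      rw [interior_Ici] at hs
      have h1 : deriv (fun s => X s * Real.exp (2 * ρ * s)) s = _ :=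
        ((hXd s (hs₁.trans hs.le)).mul (hd s)).deriv
      rw [h1]
      have := mul_le_mul_of_nonneg_right (hr s hs.le)
        (mul_pos (hXp s) (Real.exp_pos (2 * ρ * s))).le
      linarith
  have hXlim : Tendsto X atTop (𝓝 0) := by
    have h1 : Tendsto (fun s => X s₁ * Real.exp (2 * ρ * s₁) * Real.exp (-(2 * ρ * s))) atTop
        (𝓝 (X s₁ * Real.exp (2 * ρ * s₁) * 0)) :=
      (Real.tendsto_exp_neg_atTop_nhds_zero.comp
        (tendsto_id.const_mul_atTop (by positivity : 0 < 2 * ρ))).const_mul _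
    rw [mul_zero] at h1
    refine tendsto_of_tendsto_of_tendsto_of_le_of_le' tendsto_const_nhds h1
      (Eventually.of_forall fun s => (hXp s).le) ?_
    filter_upwards [eventually_ge_atTop s₁] with s hs
    have h2 := mul_le_mul_of_nonneg_right (hexp (mem_Ici.mpr le_rfl) (mem_Ici.mpr hs) hs)
      (Real.exp_pos (-(2 * ρ * s))).le
    simpa only [mul_assoc, ← Real.exp_add, add_neg_cancel, Real.exp_zero, mul_one] using h2
  -- the extinction time
  have hbdd : BddAbove (range τ) := by
    refine ⟨(X s₁ + 2 * ρ * τ s₁) / (2 * ρ), ?_⟩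
    rintro _ ⟨s, rfl⟩
    refine (hτm.monotone (le_max_left s s₁)).trans ?_
    rw [le_div_iff₀ (by positivity)]
    have h1 := hanti (mem_Ici.mpr le_rfl) (mem_Ici.mpr (le_max_right s s₁)) (le_max_right s s₁)
    have h2 := hXp (max s s₁)
    simp only at h1
    linarith
  set T := ⨆ s, τ s with hT
  have hτT : Tendsto τ atTop (𝓝 T) := tendsto_atTop_ciSup hτm.monotone hbdd
  have hlt : ∀ s, τ s < T := fun s => (hτm (lt_add_one s)).trans_le (le_ciSup hbdd _)
  have hT0 : 0 < T := hτ0 ▸ hlt 0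
  have hsurj : ∀ t ∈ Ico 0 T, ∃ s, 0 ≤ s ∧ τ s = t := by
    intro t ht
    obtain ⟨s, hs⟩ := exists_lt_of_lt_ciSup ht.2
    have hs0 : 0 ≤ s := by
      rw [← hτm.le_iff_le, hτ0]
      exact ht.1.trans hs.le
    obtain ⟨u, hu, hut⟩ := intermediate_value_Icc hs0 hτc.continuousOn
      (show t ∈ Icc (τ 0) (τ s) from ⟨hτ0.le.trans ht.1, hs.le⟩)
    exact ⟨u, hu.1, hut⟩
  -- Off the range of τ this takes a default value, which is harmless: every t in [0, T) is a value
  -- τ(s) with s ≥ 0.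
  set σ := Function.invFun τ with hσ
  have hστ : ∀ s, σ (τ s) = s := Function.leftInverse_invFun hτm.injective
  have hσd : ∀ s, HasDerivAt σ (X s)⁻¹ (τ s) := fun s =>
    ((hτd s).to_local_left_inverse (hXp s).ne' (Eventually.of_forall hστ)).hasDerivAt
  have hσlim : Tendsto σ (𝓝[<] T) atTop := by
    rw [tendsto_atTop]
    intro S
    filter_upwards [Ioo_mem_nhdsLT (hlt (max S 0))] with t ht
    have h0 := hτm.monotone (le_max_right S 0)
    rw [hτ0] at h0
    obtain ⟨s, -, rfl⟩ := hsurj t ⟨h0.trans ht.1.le, ht.2⟩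
    rw [hστ]
    exact (le_max_left S 0).trans (hτm.lt_iff_lt.mp ht.1).le
  have hX2 : ∀ s, 0 ≤ s → HasDerivAt (fun t => X (σ t)) (-2 * c.r₂ (y s)) (τ s) := by
    intro s hs
    have h1 := hXd s hs
    rw [← hστ s] at h1
    have h2 := h1.comp (τ s) (hσd s)
    rw [hστ] at h2
    exact h2.congr_deriv (mul_inv_cancel_right₀ (hXp s).ne' _)
  have hX1 : ∀ s, 0 ≤ s → HasDerivAt (fun t => y (σ t) * X (σ t)) (-2 * c.r₁ (y s)) (τ s) := by
    intro s hs
    have h1 := hyd s hs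
    rw [← hστ s] at h1
    have h2 := (h1.comp (τ s) (hσd s)).mul (hX2 s hs)
    simp only [Function.comp_apply, hστ] at h2
    refine h2.congr_deriv ?_
    have := (hXp s).ne'
    simp only [ratioField]
    field_simp
    ring
  have hratio : ∀ t, y (σ t) * X (σ t) / X (σ t) = y (σ t) := fun t =>
    mul_div_cancel_right₀ _ (hXp _).ne'
  have hσ0 : σ 0 = 0 := by rw [← hτ0, hστ, hτ0]
  refine ⟨T, fun t => y (σ t) * X (σ t), fun t => X (σ t), hT0, ?_, ?_, ?_, ?_, ?_, ?_, ?_, ?_,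
    ?_, ?_, ?_⟩
  · simp only [hσ0, hy0, hX0, ha]
    exact div_mul_cancel₀ _ h₂.ne'
  · simp only [hσ0, hX0]
  · rintro t ht
    obtain ⟨s, hs, rfl⟩ := hsurj t ht
    simp only [hστ]
    exact mul_pos (hsub (hym s hs)) (hXp s)
  · exact fun t _ => hXp _
  · intro t ht
    obtain ⟨s, hs, rfl⟩ := hsurj t ht
    simp only [hratio]
    rw [hστ]
    exact hX1 s hs
  · intro t ht
    obtain ⟨s, hs, rfl⟩ := hsurj t ht
    simp only [hratio]
    rw [hστ]
    exact hX2 s hs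
  · have h1 := (hyl.mul hXlim).comp hσlim
    rwa [mul_zero] at h1
  · exact hXlim.comp hσlim
  · simp only [hratio]
    exact hyl.comp hσlim
  · refine ⟨a, yE, ha0, fun t ht => ?_⟩
    obtain ⟨s, hs, rfl⟩ := hsurj t ht
    simp only [hratio]
    rw [hστ]
    exact hym s hs
  -- Up to s₁, X has a positive minimum and T - t ≤ T; after s₁ the limit of `hanti` applies.
  · obtain ⟨z, hz, hzmin⟩ := (isCompact_Icc (a := 0) (b := s₁)).exists_isMinOn
      (nonempty_Icc.mpr hs₁) hXc.continuousOn
    refine ⟨max (2 * ρ)⁻¹ (T / X z), fun t ht => ?_⟩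
    obtain ⟨s, hs, rfl⟩ := hsurj t ht
    simp only [hστ]
    rcases le_total s s₁ with h | h
    · have h1 : X z ≤ X s := hzmin ⟨hs, h⟩
      calc T - τ s ≤ T := by linarith [ht.1]
        _ = T / X z * X z := (div_mul_cancel₀ _ (hXp z).ne').symm
        _ ≤ max (2 * ρ)⁻¹ (T / X z) * X s :=
          mul_le_mul (le_max_right _ _) h1 (hXp z).le (by positivity)
    · have h1 : 0 + 2 * ρ * T ≤ X s + 2 * ρ * τ s :=
        le_of_tendsto (hXlim.add (hτT.const_mul (2 * ρ)))
          ((eventually_ge_atTop s).mono fun u hu => hanti h (mem_Ici.mpr (h.trans hu)) hu)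
      have h2 : T - τ s ≤ (2 * ρ)⁻¹ * X s := by
        rw [← div_eq_inv_mul, le_div_iff₀ (by positivity)]
        linarith
      exact h2.trans (mul_le_mul_of_nonneg_right (le_max_left _ _) (hXp s).le)

theorem exists_isShrinkingSolution {yE : ℝ} (hE : c.IsUniqueZero yE) {a₁ a₂ : ℝ}
    (h₁ : 0 < a₁) (h₂ : 0 < a₂) : ∃ (T : ℝ) (x₁ x₂ : ℝ → ℝ),
      0 < T ∧ x₁ 0 = a₁ ∧ x₂ 0 = a₂ ∧ c.IsShrinkingSolution yE T x₁ x₂ := by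
  rcases le_total (a₁ / a₂) yE with h | h
  · exact exists_isShrinkingSolution_of_le hE h₁ h₂ h
  · obtain ⟨T, x₂, x₁, hT, e₂, e₁, hs⟩ := exists_isShrinkingSolution_of_le hE.swap h₂ h₁ (by
      rw [← inv_div]
      exact inv_anti₀ hE.pos h)
    exact ⟨T, x₁, x₂, hT, e₁, e₂, hs.swap hE.pos⟩

end RicciCoeffs

/-! ### Uniqueness, maximality, and absence of ancient solutions -/

namespace RicciCoeffs

variable {c : RicciCoeffs}

theorem exists_pos_bounds {f : ℝ → ℝ} {b : ℝ} (hb : 0 ≤ b) (hf : ContinuousOn f (Icc 0 b))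
    (hpos : ∀ t ∈ Icc 0 b, 0 < f t) : ∃ m M, 0 < m ∧ ∀ t ∈ Icc 0 b, f t ∈ Icc m M := by
  obtain ⟨u, hu, hmin⟩ := isCompact_Icc.exists_isMinOn (nonempty_Icc.mpr hb) hf
  obtain ⟨w, hw, hmax⟩ := isCompact_Icc.exists_isMaxOn (nonempty_Icc.mpr hb) hf
  exact ⟨f u, f w, hpos u hu, fun t ht => ⟨hmin ht, hmax ht⟩⟩

/-- Solutions of the Ricci flow equations are determined by their initial values. -/
theorem eqOn_of_solutions {x₁ x₂ z₁ z₂ : ℝ → ℝ} {b : ℝ} (hb : 0 ≤ b)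
    (px₁ : ∀ t ∈ Icc 0 b, 0 < x₁ t) (px₂ : ∀ t ∈ Icc 0 b, 0 < x₂ t)
    (pz₁ : ∀ t ∈ Icc 0 b, 0 < z₁ t) (pz₂ : ∀ t ∈ Icc 0 b, 0 < z₂ t)
    (dx₁ : ∀ t ∈ Icc 0 b, HasDerivWithinAt x₁ (-2 * c.r₁ (x₁ t / x₂ t)) (Icc 0 b) t)
    (dx₂ : ∀ t ∈ Icc 0 b, HasDerivWithinAt x₂ (-2 * c.r₂ (x₁ t / x₂ t)) (Icc 0 b) t)
    (dz₁ : ∀ t ∈ Icc 0 b, HasDerivWithinAt z₁ (-2 * c.r₁ (z₁ t / z₂ t)) (Icc 0 b) t)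
    (dz₂ : ∀ t ∈ Icc 0 b, HasDerivWithinAt z₂ (-2 * c.r₂ (z₁ t / z₂ t)) (Icc 0 b) t)
    (h₁ : z₁ 0 = x₁ 0) (h₂ : z₂ 0 = x₂ 0) : EqOn z₁ x₁ (Icc 0 b) ∧ EqOn z₂ x₂ (Icc 0 b) := by
  have cx₁ : ContinuousOn x₁ (Icc 0 b) := fun t ht => (dx₁ t ht).continuousWithinAt
  have cx₂ : ContinuousOn x₂ (Icc 0 b) := fun t ht => (dx₂ t ht).continuousWithinAt
  have cz₁ : ContinuousOn z₁ (Icc 0 b) := fun t ht => (dz₁ t ht).continuousWithinAt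
  have cz₂ : ContinuousOn z₂ (Icc 0 b) := fun t ht => (dz₂ t ht).continuousWithinAt
  obtain ⟨m₁, M₁, q₁, b₁⟩ := exists_pos_bounds hb cx₁ px₁
  obtain ⟨m₂, M₂, q₂, b₂⟩ := exists_pos_bounds hb cx₂ px₂
  obtain ⟨m₃, M₃, q₃, b₃⟩ := exists_pos_bounds hb cz₁ pz₁
  obtain ⟨m₄, M₄, q₄, b₄⟩ := exists_pos_bounds hb cz₂ pz₂
  -- A compact convex box in the open quadrant containing both solutions; on it the C¹ field is
  -- Lipschitz.
  let s : Set (ℝ × ℝ) := Icc (min m₁ m₃) (max M₁ M₃) ×ˢ Icc (min m₂ m₄) (max M₂ M₄)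
  have hs1 : ∀ p ∈ s, 0 < p.1 := fun p hp => (lt_min q₁ q₃).trans_le hp.1.1
  have hs2 : ∀ p ∈ s, 0 < p.2 := fun p hp => (lt_min q₂ q₄).trans_le hp.2.1
  let v : ℝ × ℝ → ℝ × ℝ := fun p => (-2 * c.r₁ (p.1 / p.2), -2 * c.r₂ (p.1 / p.2))
  have hdiv : ContDiffOn ℝ 1 (fun p : ℝ × ℝ => p.1 / p.2) s :=
    contDiff_fst.contDiffOn.div contDiff_snd.contDiffOn fun p hp => (hs2 p hp).ne'
  have hmaps : MapsTo (fun p : ℝ × ℝ => p.1 / p.2) s (Ioi 0) :=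
    fun p hp => div_pos (hs1 p hp) (hs2 p hp)
  have hv : ContDiffOn ℝ 1 v s :=
    (contDiffOn_const.mul (c.contDiffOn_r₁.comp hdiv hmaps)).prodMk
      (contDiffOn_const.mul (c.contDiffOn_r₂.comp hdiv hmaps))
  obtain ⟨k, hk⟩ := hv.exists_lipschitzOnWith one_ne_zero
    ((convex_Icc _ _).prod (convex_Icc _ _)) (isCompact_Icc.prod isCompact_Icc)
  have hright : ∀ {f : ℝ → ℝ} {f' t : ℝ}, t ∈ Ico 0 b → HasDerivWithinAt f f' (Icc 0 b) t →
      HasDerivWithinAt f f' (Ici t) t := fun {f f' t} ht hd =>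
    hd.mono_of_mem_nhdsWithin (mem_of_superset (Icc_mem_nhdsGE ht.2) (Icc_subset_Icc_left ht.1))
  have key : EqOn (fun t => (z₁ t, z₂ t)) (fun t => (x₁ t, x₂ t)) (Icc 0 b) := by
    refine ODE_solution_unique_of_mem_Icc_right (v := fun _ => v) (s := fun _ => s) (K := k)
      (fun _ _ => hk) (cz₁.prodMk cz₂) (fun t ht => ?_) (fun t ht => ?_) (cx₁.prodMk cx₂)
      (fun t ht => ?_) (fun t ht => ?_) (by simp only [h₁, h₂])
    · have ht' := Ico_subset_Icc_self ht
      exact (hright ht (dz₁ t ht')).prodMk (hright ht (dz₂ t ht'))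
    · have ht' := Ico_subset_Icc_self ht
      exact ⟨⟨(min_le_right _ _).trans (b₃ t ht').1, (b₃ t ht').2.trans (le_max_right _ _)⟩,
        ⟨(min_le_right _ _).trans (b₄ t ht').1, (b₄ t ht').2.trans (le_max_right _ _)⟩⟩
    · have ht' := Ico_subset_Icc_self ht
      exact (hright ht (dx₁ t ht')).prodMk (hright ht (dx₂ t ht'))
    · have ht' := Ico_subset_Icc_self ht
      exact ⟨⟨(min_le_left _ _).trans (b₁ t ht').1, (b₁ t ht').2.trans (le_max_left _ _)⟩,
        ⟨(min_le_left _ _).trans (b₂ t ht').1, (b₂ t ht').2.trans (le_max_left _ _)⟩⟩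
  exact ⟨fun t ht => congrArg Prod.fst (key ht), fun t ht => congrArg Prod.snd (key ht)⟩

/-- A shrinking solution is maximal, and contains every other solution with its initial values. -/
theorem IsShrinkingSolution.maximal {yE T : ℝ} {x₁ x₂ : ℝ → ℝ} (h : c.IsShrinkingSolution yE T x₁ x₂)
    (hT : 0 < T) {T' : ℝ} {z₁ z₂ : ℝ → ℝ} (pz₁ : ∀ t ∈ Ico 0 T', 0 < z₁ t)
    (pz₂ : ∀ t ∈ Ico 0 T', 0 < z₂ t)
    (dz₁ : ∀ t ∈ Ico 0 T', HasDerivWithinAt z₁ (-2 * c.r₁ (z₁ t / z₂ t)) (Ico 0 T') t)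
    (dz₂ : ∀ t ∈ Ico 0 T', HasDerivWithinAt z₂ (-2 * c.r₂ (z₁ t / z₂ t)) (Ico 0 T') t)
    (h₁ : z₁ 0 = x₁ 0) (h₂ : z₂ 0 = x₂ 0) :
    T' ≤ T ∧ ∀ t ∈ Ico 0 T', z₁ t = x₁ t ∧ z₂ t = x₂ t := by
  have key : ∀ b, 0 ≤ b → b < T → b < T' → z₁ b = x₁ b ∧ z₂ b = x₂ b := by
    intro b hb hbT hbT'
    have s : Icc 0 b ⊆ Ico 0 T := fun t ht => ⟨ht.1, ht.2.trans_lt hbT⟩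
    have s' : Icc 0 b ⊆ Ico 0 T' := fun t ht => ⟨ht.1, ht.2.trans_lt hbT'⟩
    obtain ⟨e1, e2⟩ := eqOn_of_solutions hb (fun t ht => h.pos₁ t (s ht))
      (fun t ht => h.pos₂ t (s ht)) (fun t ht => pz₁ t (s' ht)) (fun t ht => pz₂ t (s' ht))
      (fun t ht => (h.deriv₁ t (s ht)).hasDerivWithinAt)
      (fun t ht => (h.deriv₂ t (s ht)).hasDerivWithinAt)
      (fun t ht => (dz₁ t (s' ht)).mono s') (fun t ht => (dz₂ t (s' ht)).mono s') h₁ h₂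
    exact ⟨e1 ⟨hb, le_rfl⟩, e2 ⟨hb, le_rfl⟩⟩
  -- A longer solution would be continuous and positive at `T`, yet it agrees before `T` with one
  -- that tends to 0.
  have hle : T' ≤ T := by
    by_contra! hlt
    have h1 : ContinuousAt z₂ T := ((dz₂ T ⟨hT.le, hlt⟩).hasDerivAt
      (Ico_mem_nhds hT hlt)).continuousAt
    have h2 : Tendsto z₂ (𝓝[<] T) (𝓝 0) := by
      refine h.lim₂.congr' ?_
      filter_upwards [Ioo_mem_nhdsLT hT] with t ht
      exact ((key t ht.1.le ht.2 (ht.2.trans hlt)).2).symm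
    have h3 := tendsto_nhds_unique h2 (h1.tendsto.mono_left nhdsWithin_le_nhds)
    exact (pz₂ T ⟨hT.le, hlt⟩).ne h3
  exact ⟨hle, fun t ht => key t ht.1 (ht.2.trans_le hle) ht.2⟩

/-- The term -β₁/y dominates near 0, as β₁ > 0; δ makes β₁/y at least α₁ + γ₁ + 1. -/
theorem exists_r₁_le : ∃ δ > 0, ∀ y, 0 < y → y < δ → c.r₁ y ≤ -1 := by
  have hβ := c.β₁_pos
  have hγ := c.γ₁_pos
  have hα : 0 < c.α₁ := lt_of_lt_of_le (by linarith) c.α₁_ge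
  refine ⟨min 1 (c.β₁ / (c.α₁ + c.γ₁ + 1)), by positivity, fun y hy hlt => ?_⟩
  have h1 : y < 1 := hlt.trans_le (min_le_left _ _)
  have h2 : y < c.β₁ / (c.α₁ + c.γ₁ + 1) := hlt.trans_le (min_le_right _ _)
  rw [lt_div_iff₀ (by positivity), mul_comm] at h2
  have h3 : c.α₁ + c.γ₁ + 1 ≤ c.β₁ * y⁻¹ := by
    rw [← div_eq_mul_inv, le_div_iff₀ hy]
    exact h2.le
  have h4 := mul_le_mul_of_nonneg_left (pow_le_one₀ hy.le h1.le : y ^ 2 ≤ 1) hγ.le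
  rw [r₁]
  linarith

/-- There is no ancient solution whose ratio is somewhere less than `yE`. -/
theorem IsUniqueZero.not_lt_of_ancient {yE : ℝ} (hE : c.IsUniqueZero yE) {T : ℝ} {x₁ x₂ : ℝ → ℝ}
    (p₁ : ∀ t < T, 0 < x₁ t) (p₂ : ∀ t < T, 0 < x₂ t)
    (d₁ : ∀ t < T, HasDerivAt x₁ (-2 * c.r₁ (x₁ t / x₂ t)) t)
    (d₂ : ∀ t < T, HasDerivAt x₂ (-2 * c.r₂ (x₁ t / x₂ t)) t) {t₀ : ℝ} (ht₀ : t₀ < T) :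
    yE ≤ x₁ t₀ / x₂ t₀ := by
  by_contra! hlt
  set y : ℝ → ℝ := fun t => x₁ t / x₂ t with hy
  have py : ∀ t < T, 0 < y t := fun t ht => div_pos (p₁ t ht) (p₂ t ht)
  have dy : ∀ t < T, HasDerivAt y (2 * c.ratioField (y t) / x₂ t) t := by
    intro t ht
    refine ((d₁ t ht).div (d₂ t ht) (p₂ t ht).ne').congr_deriv ?_
    have h1 := (p₂ t ht).ne'
    have h2 : x₁ t = y t * x₂ t := (div_mul_cancel₀ _ h1).symm
    change (-2 * c.r₁ (y t) * x₂ t - x₁ t * (-2 * c.r₂ (y t))) / x₂ t ^ 2 = _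
    rw [h2, ratioField]
    field_simp
    ring
  have hcont : ∀ {f f' : ℝ → ℝ}, (∀ t < T, HasDerivAt f (f' t) t) → ContinuousOn f (Iic t₀) :=
    fun hd t ht => (hd t (ht.trans_lt ht₀)).continuousAt.continuousWithinAt
  -- A level v strictly between y(t₀) and both y(t₁) and `yE` is a lower barrier: y increases
  -- whenever it equals v, so it cannot descend from above v to y(t₀).
  have hbd : ∀ t ≤ t₀, y t ≤ y t₀ := by
    intro t₁ ht₁
    by_contra! hlt1
    obtain ⟨v, hv1, hv2⟩ := exists_between (lt_min hlt hlt1)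
    rw [lt_min_iff] at hv2
    have h1 := image_le_of_deriv_right_lt_deriv_boundary (f := fun t => -y t)
      (f' := fun t => -(2 * c.ratioField (y t) / x₂ t)) (a := t₁) (b := t₀) (B := fun _ => -v)
      (B' := fun _ => 0) ((hcont dy).neg.mono Icc_subset_Iic_self)
      (fun x hx => (dy x (hx.2.trans ht₀)).neg.hasDerivWithinAt) (neg_le_neg hv2.2.le)
      (fun x => hasDerivAt_const x _) (fun x hx hxv => by
        have hyv : y x = v := neg_injective hxv
        have hxT := hx.2.trans ht₀
        rw [neg_lt_zero, hyv]
        exact div_pos (mul_pos two_pos (hE.ratioField_pos (hyv ▸ py x hxT) hv2.1)) (p₂ x hxT))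
      ⟨ht₁, le_rfl⟩
    simp only [neg_le_neg_iff] at h1
    exact absurd hv1 (not_lt.mpr h1)
  have hmono : MonotoneOn y (Iic t₀) := by
    refine monotoneOn_of_deriv_nonneg (convex_Iic t₀) (hcont dy) ?_ ?_
    · intro t ht
      rw [interior_Iic] at ht
      exact (dy t (ht.trans ht₀)).differentiableAt.differentiableWithinAt
    · intro t ht
      rw [interior_Iic] at ht
      have htT := ht.trans ht₀
      rw [(dy t htT).deriv]
      exact (div_pos (mul_pos two_pos (hE.ratioField_pos (py t htT)
        ((hbd t ht.le).trans_lt hlt))) (p₂ t htT)).le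
  obtain ⟨δ, hδ, hr⟩ := c.exists_r₁_le
  -- In this case y < δ at all earlier times, so x₁' ≥ 2 there; going back by the time x₁(t₁) makes
  -- x₁ at most -x₁(t₁) < 0.
  by_cases hcase : ∃ t₁ ≤ t₀, y t₁ < δ
  · obtain ⟨t₁, ht₁, hy1⟩ := hcase
    have hm : MonotoneOn (fun t => x₁ t - 2 * t) (Iic t₁) := by
      refine monotoneOn_of_deriv_nonneg (convex_Iic t₁) ?_ ?_ ?_
      · exact ((hcont d₁).mono (Iic_subset_Iic.mpr ht₁)).sub (by fun_prop)
      · intro t ht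
        rw [interior_Iic] at ht
        exact ((d₁ t (ht.trans (ht₁.trans_lt ht₀))).sub
          ((hasDerivAt_id t).const_mul 2)).differentiableAt.differentiableWithinAt
      · intro t ht
        rw [interior_Iic] at ht
        have htT := ht.trans (ht₁.trans_lt ht₀)
        have h1 : deriv (fun t => x₁ t - 2 * t) t = _ :=
          ((d₁ t htT).sub ((hasDerivAt_id t).const_mul 2)).deriv
        rw [h1]
        have h2 := hr (y t) (py t htT) ((hmono (ht.le.trans ht₁) ht₁ ht.le).trans_lt hy1)
        change 0 ≤ -2 * c.r₁ (y t) - 2 * 1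
        linarith
    have hx := p₁ t₁ (ht₁.trans_lt ht₀)
    have h1 := hm (mem_Iic.mpr (by linarith : t₁ - x₁ t₁ ≤ t₁)) (mem_Iic.mpr le_rfl) (by linarith)
    have h2 := p₁ (t₁ - x₁ t₁) (by linarith)
    simp only at h1
    linarith
  · push Not at hcase
    have hyc : Icc δ (y t₀) ⊆ Ioi 0 := fun x hx => hδ.trans_le hx.1
    have hne : (Icc δ (y t₀)).Nonempty := nonempty_Icc.mpr (hcase t₀ le_rfl)
    obtain ⟨z, hz, hzmin⟩ := isCompact_Icc.exists_isMinOn hne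
      (c.contDiffOn_ratioField.continuousOn.mono hyc)
    have hf : 0 < c.ratioField z := hE.ratioField_pos (hδ.trans_le hz.1) (hz.2.trans_lt hlt)
    obtain ⟨w, hw, hwmax⟩ := isCompact_Icc.exists_isMaxOn hne
      (c.contDiffOn_r₂.continuousOn.mono hyc)
    set k := max (c.r₂ w) 1 with hk
    have hk0 : 0 < k := lt_max_of_lt_right one_pos
    set f := c.ratioField z with hfz
    have hmem : ∀ t ≤ t₀, y t ∈ Icc δ (y t₀) := fun t ht => ⟨hcase t ht, hbd t ht⟩
    -- A linear majorant of x₂ in the past, since x₂' ≥ -2k. Then y' ≥ 2f/L, so y + (f/k) log L is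
    -- increasing; its second term tends to +∞ in the past, which contradicts y > 0.
    set L : ℝ → ℝ := fun t => x₂ t₀ + 2 * k * (t₀ - t) with hL
    have hx0 := p₂ t₀ ht₀
    have hLp : ∀ t ≤ t₀, 0 < L t := fun t ht =>
      add_pos_of_pos_of_nonneg hx0 (mul_nonneg (by positivity) (sub_nonneg.mpr ht))
    have hLd : ∀ t, HasDerivAt L (-(2 * k)) t := fun t =>
      ((((hasDerivAt_id t).const_sub t₀).const_mul (2 * k)).const_add (x₂ t₀)).congr_deriv
        (by ring)
    have hxL : ∀ t ≤ t₀, x₂ t ≤ L t := by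
      have hm : MonotoneOn (fun t => x₂ t - L t) (Iic t₀) := by
        refine monotoneOn_of_deriv_nonneg (convex_Iic t₀) ?_ ?_ ?_
        · exact (hcont d₂).sub fun t _ => (hLd t).continuousAt.continuousWithinAt
        · intro t ht
          rw [interior_Iic] at ht
          exact ((d₂ t (ht.trans ht₀)).sub (hLd t)).differentiableAt.differentiableWithinAt
        · intro t ht
          rw [interior_Iic] at ht
          have h1 : deriv (fun t => x₂ t - L t) t = _ := ((d₂ t (ht.trans ht₀)).sub (hLd t)).deriv
          rw [h1]
          have h2 : c.r₂ (y t) ≤ k := (hwmax (hmem t ht.le)).trans (le_max_left _ _)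
          change 0 ≤ -2 * c.r₂ (y t) - -(2 * k)
          linarith
      intro t ht
      have h1 := hm (mem_Iic.mpr ht) (mem_Iic.mpr le_rfl) ht
      simp only [hL, sub_self, mul_zero, add_zero] at h1 ⊢
      linarith
    have hlog : ∀ t ≤ t₀, HasDerivAt (fun t => y t + f / k * Real.log (L t))
        (2 * c.ratioField (y t) / x₂ t + f / k * (-(2 * k) / L t)) t := fun t ht =>
      (dy t (ht.trans_lt ht₀)).add (((hLd t).log (hLp t ht).ne').const_mul (f / k))
    have hm : MonotoneOn (fun t => y t + f / k * Real.log (L t)) (Iic t₀) := by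
      refine monotoneOn_of_deriv_nonneg (convex_Iic t₀)
        (fun t ht => (hlog t ht).continuousAt.continuousWithinAt) ?_ ?_
      · intro t ht
        rw [interior_Iic] at ht
        exact (hlog t ht.le).differentiableAt.differentiableWithinAt
      · intro t ht
        rw [interior_Iic] at ht
        rw [(hlog t ht.le).deriv]
        have h1 : f ≤ c.ratioField (y t) := hzmin (hmem t ht.le)
        have h2 : 2 * f / L t ≤ 2 * c.ratioField (y t) / x₂ t :=
          div_le_div₀ (by linarith) (by linarith) (p₂ t (ht.trans ht₀)) (hxL t ht.le)
        have h3 : f / k * (-(2 * k) / L t) = -(2 * f / L t) := by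
          field_simp
        rw [h3]
        linarith
    have hlim : Tendsto (fun t => f / k * Real.log (L t)) atBot atTop := by
      refine (Real.tendsto_log_atTop.comp ?_).const_mul_atTop (by positivity)
      refine tendsto_atTop_add_const_left _ _ (Tendsto.const_mul_atTop (by positivity) ?_)
      exact tendsto_atTop_add_const_left _ _ tendsto_neg_atBot_atTop
    obtain ⟨t, ht, ht'⟩ := ((hlim.eventually_gt_atTop (y t₀ + f / k * Real.log (L t₀))).and
      (eventually_le_atBot t₀)).exists
    have h1 := hm (mem_Iic.mpr ht') (mem_Iic.mpr le_rfl) ht'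
    have h2 := py t (ht'.trans_lt ht₀)
    simp only at h1
    linarith

/-- Ancient solutions have constant ratio. -/
theorem IsUniqueZero.eq_of_ancient {yE : ℝ} (hE : c.IsUniqueZero yE) {T : ℝ} {x₁ x₂ : ℝ → ℝ}
    (p₁ : ∀ t < T, 0 < x₁ t) (p₂ : ∀ t < T, 0 < x₂ t)
    (d₁ : ∀ t < T, HasDerivAt x₁ (-2 * c.r₁ (x₁ t / x₂ t)) t)
    (d₂ : ∀ t < T, HasDerivAt x₂ (-2 * c.r₂ (x₁ t / x₂ t)) t) {t₀ : ℝ} (ht₀ : t₀ < T) :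
    x₁ t₀ / x₂ t₀ = yE := by
  refine le_antisymm ?_ (hE.not_lt_of_ancient p₁ p₂ d₁ d₂ ht₀)
  have h1 := hE.swap.not_lt_of_ancient p₂ p₁ (fun t ht => by rw [swap_r₁, inv_div]; exact d₂ t ht)
    (fun t ht => by rw [swap_r₂, inv_div]; exact d₁ t ht) ht₀
  rw [← inv_div] at h1
  exact (inv_le_inv₀ hE.pos (div_pos (p₁ t₀ ht₀) (p₂ t₀ ht₀))).mp h1

end RicciCoeffs

/-! ### Homogeneous Ricci flow with two summands -/

section

variable {n : ℕ} {G : Type*} [TopologicalSpace G] [ChartedSpace (EuclideanSpace ℝ (Fin n)) G]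
  [Group G] {𝔭₁ 𝔭₂ : Submodule ℝ (LieAlg n G)} (Q : BiinvariantProduct n G) [LieGroup (𝓡 n) ∞ G]

theorem BiinvariantProduct.form_diagOp (a b : ℝ) (X Y : LieAlg n G) :
    Q.form (diagOp Q.toScalarProduct 𝔭₁ 𝔭₂ a b X) Y =
      a * Q.form (Q.toScalarProduct.orthProj 𝔭₁ X) Y +
        b * Q.form (Q.toScalarProduct.orthProj 𝔭₂ X) Y := by
  simp [diagOp_apply]

/-- A diagonal form that is coefficientwise smaller is smaller. -/
theorem BiinvariantProduct.form_diagOp_le {a b a' b' : ℝ} (ha : a ≤ a') (hb : b ≤ b') (X : LieAlg n G) :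
    Q.form (diagOp Q.toScalarProduct 𝔭₁ 𝔭₂ a b X) X ≤
      Q.form (diagOp Q.toScalarProduct 𝔭₁ 𝔭₂ a' b' X) X := by
  have h : ∀ W : Submodule ℝ (LieAlg n G), 0 ≤ Q.form (Q.toScalarProduct.orthProj W X) X := by
    intro W
    rw [← ScalarProduct.orthProj_idem, ScalarProduct.orthProj_symm]
    exact Q.self_nonneg _
  rw [Q.form_diagOp, Q.form_diagOp]
  exact add_le_add (mul_le_mul_of_nonneg_right ha (h _)) (mul_le_mul_of_nonneg_right hb (h _))

theorem BiinvariantProduct.form_smul_diagOp (r a b : ℝ) (X Y : LieAlg n G) :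
    Q.form (diagOp Q.toScalarProduct 𝔭₁ 𝔭₂ (r * a) (r * b) X) Y =
      r * Q.form (diagOp Q.toScalarProduct 𝔭₁ 𝔭₂ a b X) Y := by
  rw [Q.form_diagOp, Q.form_diagOp]
  ring

end

namespace IsotropySplitting

variable {n : ℕ} {G : Type*} [TopologicalSpace G] [ChartedSpace (EuclideanSpace ℝ (Fin n)) G]
  [Group G] {K : Subgroup G} {𝔭₁ 𝔭₂ : Submodule ℝ (LieAlg n G)} {Q : BiinvariantProduct n G}
  [LieGroup (𝓡 n) ∞ G] (S : IsotropySplitting Q K 𝔭₁ 𝔭₂)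
include S

theorem form_diagOp_left {X : LieAlg n G} (hX : X ∈ 𝔭₁) (a b : ℝ) (Y : LieAlg n G) :
    Q.form (diagOp Q.toScalarProduct 𝔭₁ 𝔭₂ a b X) Y = a * Q.form X Y := by
  rw [diagOp_apply, ScalarProduct.orthProj_of_mem hX, ScalarProduct.orthProj_of_orthogonal
    fun V hV => S.swap.isOrthDecomp.orth V hV X hX, smul_zero, add_zero, map_smul]
  rfl

theorem form_diagOp_right {X : LieAlg n G} (hX : X ∈ 𝔭₂) (a b : ℝ) (Y : LieAlg n G) :
    Q.form (diagOp Q.toScalarProduct 𝔭₁ 𝔭₂ a b X) Y = b * Q.form X Y := by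
  rw [diagOp_apply, add_comm]
  exact S.swap.form_diagOp_left hX b a Y

theorem form_diagOp_same (a : ℝ) (X : isotropyRep Q K) (Y : LieAlg n G) :
    Q.form (diagOp Q.toScalarProduct 𝔭₁ 𝔭₂ a a X) Y = a * Q.form X Y := by
  rw [Q.form_diagOp, ← mul_add, ← LinearMap.add_apply, ← map_add, ← S.isOrthDecomp.proj_add,
    ScalarProduct.orthProj_of_mem X.2]

theorem hasComponents_unique {g : InvariantMetric Q K} {x₁ x₂ z₁ z₂ : ℝ}
    (hx : g.HasComponents 𝔭₁ 𝔭₂ x₁ x₂) (hz : g.HasComponents 𝔭₁ 𝔭₂ z₁ z₂) :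
    x₁ = z₁ ∧ x₂ = z₂ := by
  obtain ⟨X, hX, hX1⟩ := S.exists_test_vector
  obtain ⟨Y, hY, hY1⟩ := S.swap.exists_test_vector
  constructor
  · have h := (hx.1 X X hX hX).symm.trans (hz.1 X X hX hX)
    rwa [hX1, mul_one, mul_one] at h
  · have h := (hx.2.1 Y Y hY hY).symm.trans (hz.2.1 Y Y hY hY)
    rwa [hY1, mul_one, mul_one] at h

variable {c : RicciCoeffs} (hc : ∀ (g : InvariantMetric Q K) (x₁ x₂ : ℝ), 0 < x₁ → 0 < x₂ →
  g.HasComponents 𝔭₁ 𝔭₂ x₁ x₂ → ∀ X Y, g.ric X Y = Q.form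
    (diagOp Q.toScalarProduct 𝔭₁ 𝔭₂ (c.r₁ (x₁ / x₂)) (c.r₂ (x₁ / x₂)) X) Y)
include hc

/-- If there is only one invariant Einstein metric up to scaling, its ratio is the only zero of
the ratio field. -/
theorem isUniqueZero {gE : InvariantMetric Q K} (hE : gE.IsEinstein)
    (huniq : ∀ g : InvariantMetric Q K, g.IsEinstein →
      ∃ c : ℝ, 0 < c ∧ ∀ X Y, g.form X Y = c * gE.form X Y)
    {yE : ℝ} (hyE : gE.HasRatio 𝔭₁ 𝔭₂ yE) : c.IsUniqueZero yE := by
  obtain ⟨x₁, x₂, h₁, h₂, hg, rfl⟩ := hyE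
  obtain ⟨X, hX, hX1⟩ := S.exists_test_vector
  obtain ⟨Y, hY, hY1⟩ := S.swap.exists_test_vector
  refine ⟨div_pos h₁ h₂, ?_, fun y hy h => ?_⟩
  · obtain ⟨e, he⟩ := hE
    have e1 := he X X
    have e2 := he Y Y
    rw [hc gE x₁ x₂ h₁ h₂ hg, S.form_diagOp_left hX, hg.1 X X hX hX, hX1] at e1
    rw [hc gE x₁ x₂ h₁ h₂ hg, S.form_diagOp_right hY, hg.2.1 Y Y hY hY, hY1] at e2
    rw [mul_one, mul_one] at e1 e2
    rw [RicciCoeffs.ratioField, e1, e2]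
    field_simp
    ring
  -- Conversely, a zero y of the ratio field makes the metric with components (y, 1) Einstein with
  -- constant r₂(y), so it is a multiple of the given one and has the same ratio.
  · obtain ⟨g, hgc⟩ := S.exists_metric hy one_pos
    obtain ⟨k, hk, hgk⟩ := huniq g ⟨c.r₂ y, fun V W => by
      rw [RicciCoeffs.ratioField, sub_eq_zero] at h
      have h1 := Q.form_smul_diagOp (𝔭₁ := 𝔭₁) (𝔭₂ := 𝔭₂) (c.r₂ y) y 1 V W
      rw [mul_one, mul_comm (c.r₂ y) y, h] at h1
      rw [hc g y 1 hy one_pos hgc, div_one, h1, S.isDiagonal_of_hasComponents hgc V W]⟩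
    have e1 := hgk X X
    have e2 := hgk Y Y
    rw [hgc.1 X X hX hX, hg.1 X X hX hX, hX1, mul_one, mul_one] at e1
    rw [hgc.2.1 Y Y hY hY, hg.2.1 Y Y hY hY, hY1, mul_one, mul_one] at e2
    rw [eq_div_iff h₂.ne', e1, mul_right_comm, ← e2, one_mul]

/-- The components of a homogeneous Ricci flow solve the Ricci flow equations. -/
theorem hasDerivWithinAt_components {g : ℝ → InvariantMetric Q K} {s : Set ℝ} {x₁ x₂ : ℝ → ℝ}
    (h₁ : ∀ t ∈ s, 0 < x₁ t) (h₂ : ∀ t ∈ s, 0 < x₂ t)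
    (hg : ∀ t ∈ s, (g t).HasComponents 𝔭₁ 𝔭₂ (x₁ t) (x₂ t)) (hf : IsRicciFlowOn g s) {t : ℝ}
    (ht : t ∈ s) : HasDerivWithinAt x₁ (-2 * c.r₁ (x₁ t / x₂ t)) s t ∧
      HasDerivWithinAt x₂ (-2 * c.r₂ (x₁ t / x₂ t)) s t := by
  obtain ⟨X, hX, hX1⟩ := S.exists_test_vector
  obtain ⟨Y, hY, hY1⟩ := S.swap.exists_test_vector
  constructor
  · have h := hf t ht X X
    rw [hc (g t) _ _ (h₁ t ht) (h₂ t ht) (hg t ht), S.form_diagOp_left hX, hX1, mul_one] at h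
    refine h.congr_of_mem (fun u hu => ?_) ht
    rw [(hg u hu).1 X X hX hX, hX1, mul_one]
  · have h := hf t ht Y Y
    rw [hc (g t) _ _ (h₁ t ht) (h₂ t ht) (hg t ht), S.form_diagOp_right hY, hY1, mul_one] at h
    refine h.congr_of_mem (fun u hu => ?_) ht
    rw [(hg u hu).2.1 Y Y hY hY, hY1, mul_one]

theorem isRicciFlowOn {g : ℝ → InvariantMetric Q K} {s : Set ℝ} {x₁ x₂ : ℝ → ℝ}
    (h₁ : ∀ t ∈ s, 0 < x₁ t) (h₂ : ∀ t ∈ s, 0 < x₂ t)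
    (hg : ∀ t ∈ s, (g t).HasComponents 𝔭₁ 𝔭₂ (x₁ t) (x₂ t))
    (d₁ : ∀ t ∈ s, HasDerivWithinAt x₁ (-2 * c.r₁ (x₁ t / x₂ t)) s t)
    (d₂ : ∀ t ∈ s, HasDerivWithinAt x₂ (-2 * c.r₂ (x₁ t / x₂ t)) s t) : IsRicciFlowOn g s := by
  intro t ht X Y
  have h := ((d₁ t ht).mul_const (Q.form (Q.toScalarProduct.orthProj 𝔭₁ X) Y)).add
    ((d₂ t ht).mul_const (Q.form (Q.toScalarProduct.orthProj 𝔭₂ X) Y))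
  refine (h.congr_deriv ?_).congr_of_mem (fun u hu => ?_) ht
  · rw [hc (g t) _ _ (h₁ t ht) (h₂ t ht) (hg t ht), Q.form_diagOp]
    ring
  · exact (S.isDiagonal_of_hasComponents (hg u hu) X Y).trans (Q.form_diagOp _ _ _ _)

end IsotropySplitting

/-! ### Curvature and diameter along the flow -/

namespace IsotropySplitting

variable {n : ℕ} {G : Type*} [TopologicalSpace G] [ChartedSpace (EuclideanSpace ℝ (Fin n)) G]
  [Group G] {K : Subgroup G} {𝔭₁ 𝔭₂ : Submodule ℝ (LieAlg n G)} {Q : BiinvariantProduct n G}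
  [LieGroup (𝓡 n) ∞ G] (S : IsotropySplitting Q K 𝔭₁ 𝔭₂)
include S

theorem mul_form_le {g : InvariantMetric Q K} {x₁ x₂ k : ℝ} (hg : g.HasComponents 𝔭₁ 𝔭₂ x₁ x₂)
    (h₁ : k ≤ x₁) (h₂ : k ≤ x₂) (X : isotropyRep Q K) : k * Q.form X X ≤ g.form X X := by
  rw [S.isDiagonal_of_hasComponents hg, ← S.form_diagOp_same]
  exact Q.form_diagOp_le h₁ h₂ X

theorem form_le_mul {g : InvariantMetric Q K} {x₁ x₂ k : ℝ} (hg : g.HasComponents 𝔭₁ 𝔭₂ x₁ x₂)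
    (h₁ : x₁ ≤ k) (h₂ : x₂ ≤ k) (X : isotropyRep Q K) : g.form X X ≤ k * Q.form X X := by
  rw [S.isDiagonal_of_hasComponents hg, ← S.form_diagOp_same]
  exact Q.form_diagOp_le h₁ h₂ X

/-- The two inequalities say Ric ≥ k g on each summand, which forces |Rm| to be large. -/
theorem le_rm {c : RicciCoeffs} (hc : ∀ (g : InvariantMetric Q K) (x₁ x₂ : ℝ), 0 < x₁ → 0 < x₂ →
      g.HasComponents 𝔭₁ 𝔭₂ x₁ x₂ → ∀ X Y, g.ric X Y = Q.form
        (diagOp Q.toScalarProduct 𝔭₁ 𝔭₂ (c.r₁ (x₁ / x₂)) (c.r₂ (x₁ / x₂)) X) Y)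
    {g : InvariantMetric Q K} {x₁ x₂ k : ℝ} (p₁ : 0 < x₁) (p₂ : 0 < x₂)
    (hg : g.HasComponents 𝔭₁ 𝔭₂ x₁ x₂)
    (h₁ : k * x₁ ≤ c.r₁ (x₁ / x₂)) (h₂ : k * x₂ ≤ c.r₂ (x₁ / x₂)) :
    k ≤ Module.finrank ℝ (isotropyRep Q K) * g.rm := by
  have hne : isotropyRep Q K ≠ ⊥ := fun h =>
    S.irr₁.1 (eq_bot_iff.mpr (h ▸ S.isOrthDecomp.left_le))
  refine le_rmNorm_of_le_ricci _ ?_ _ fun X => ?_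
  · exact Nat.pos_of_ne_zero fun h => hne (Submodule.finrank_eq_zero.mp h)
  · have h3 := hc g x₁ x₂ p₁ p₂ hg X X
    rw [InvariantMetric.ric] at h3
    rw [h3, S.isDiagonal_of_hasComponents hg, ← Q.form_smul_diagOp]
    exact Q.form_diagOp_le h₁ h₂ X

/-- Blow-up: the Ricci eigenvalues rᵢ/xᵢ are unbounded because the rᵢ tend to positive limits and
the xᵢ to 0. Rate: bounded ratio makes g(t) uniformly equivalent to x₂ Q, so |Rm| is O(1/x₂), while
T - t is O(x₂). -/
theorem isTypeISingularity {c : RicciCoeffs}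
    (hc : ∀ (g : InvariantMetric Q K) (x₁ x₂ : ℝ), 0 < x₁ → 0 < x₂ →
      g.HasComponents 𝔭₁ 𝔭₂ x₁ x₂ → ∀ X Y, g.ric X Y = Q.form
        (diagOp Q.toScalarProduct 𝔭₁ 𝔭₂ (c.r₁ (x₁ / x₂)) (c.r₂ (x₁ / x₂)) X) Y)
    {yE T : ℝ} (hE : c.IsUniqueZero yE) (hT : 0 < T) {x₁ x₂ : ℝ → ℝ}
    (hx : c.IsShrinkingSolution yE T x₁ x₂) {g : ℝ → InvariantMetric Q K}
    (hg : ∀ t ∈ Ico 0 T, (g t).HasComponents 𝔭₁ 𝔭₂ (x₁ t) (x₂ t)) : IsTypeISingularity g T := by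
  constructor
  · intro C
    set k : ℝ := Module.finrank ℝ (isotropyRep Q K) * (|C| + 1) with hk
    have l₁ : Tendsto (fun t => c.r₁ (x₁ t / x₂ t)) (𝓝[<] T) (𝓝 (c.r₁ yE)) :=
      (c.contDiffOn_r₁.continuousOn.continuousAt (Ioi_mem_nhds hE.pos)).tendsto.comp hx.lim_ratio
    have l₂ : Tendsto (fun t => c.r₂ (x₁ t / x₂ t)) (𝓝[<] T) (𝓝 (c.r₂ yE)) :=
      (c.contDiffOn_r₂.continuousOn.continuousAt (Ioi_mem_nhds hE.pos)).tendsto.comp hx.lim_ratio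
    have hr₁ : 0 < c.r₁ yE := by
      rw [← sub_eq_zero.mp hE.zero]
      exact mul_pos hE.pos hE.r₂_pos
    have e₁ := (hx.lim₁.const_mul k).eventually_lt l₁ (by rwa [mul_zero])
    have e₂ := (hx.lim₂.const_mul k).eventually_lt l₂ (by rw [mul_zero]; exact hE.r₂_pos)
    obtain ⟨t, ⟨h1, h2⟩, ht⟩ := ((e₁.and e₂).and (Ioo_mem_nhdsLT hT)).exists
    have ht' : t ∈ Ico 0 T := ⟨ht.1.le, ht.2⟩
    have h3 := S.le_rm hc (hx.pos₁ t ht') (hx.pos₂ t ht') (hg t ht') h1.le h2.le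
    refine ⟨t, ht', ?_⟩
    by_contra! hle
    have h4 : (0 : ℝ) < Module.finrank ℝ (isotropyRep Q K) := by
      have hne : isotropyRep Q K ≠ ⊥ := fun h =>
        S.irr₁.1 (eq_bot_iff.mpr (h ▸ S.isOrthDecomp.left_le))
      exact Nat.cast_pos.mpr
        (Nat.pos_of_ne_zero fun h => hne (Submodule.finrank_eq_zero.mp h))
    have h5 := le_of_mul_le_mul_left h3 h4
    linarith [le_abs_self C]
  · obtain ⟨m, M, hm, hb⟩ := hx.ratio_bounds
    obtain ⟨C, hC⟩ := hx.typeI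
    set a := min m 1 with ha
    set b := max M 1 with hbdef
    have ha0 : 0 < a := lt_min hm one_pos
    have hb0 : 0 < b := lt_max_of_lt_right one_pos
    obtain ⟨D, hD, hrm⟩ := exists_rmNorm_le (isCompl_isotropyRep Q K)
      (Q.toScalarProduct.restrict (isotropyRep Q K)) (div_pos hb0 ha0).le
    refine ⟨C * (D / a), fun t ht => ?_⟩
    have p₂ := hx.pos₂ t ht
    obtain ⟨h1, h2⟩ := hb t ht
    rw [le_div_iff₀ p₂] at h1
    rw [div_le_iff₀ p₂] at h2
    have q1 : a * x₂ t ≤ x₁ t :=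
      (mul_le_mul_of_nonneg_right (min_le_left _ _) p₂.le).trans h1
    have q2 : a * x₂ t ≤ x₂ t :=
      (mul_le_mul_of_nonneg_right (min_le_right _ _) p₂.le).trans (one_mul _).le
    have q3 : x₁ t ≤ b * x₂ t :=
      h2.trans (mul_le_mul_of_nonneg_right (le_max_left _ _) p₂.le)
    have q4 : x₂ t ≤ b * x₂ t :=
      (one_mul _).ge.trans (mul_le_mul_of_nonneg_right (le_max_right _ _) p₂.le)
    have h3 : (g t).rm ≤ D / (a * x₂ t) :=
      hrm (g t).toScalarProduct (a * x₂ t) (b * x₂ t) (by positivity) (by positivity)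
        (le_of_eq (by field_simp)) (S.mul_form_le (hg t ht) q1 q2) (S.form_le_mul (hg t ht) q3 q4)
    calc (T - t) * (g t).rm ≤ (T - t) * (D / (a * x₂ t)) :=
          mul_le_mul_of_nonneg_left h3 (sub_nonneg.mpr ht.2.le)
      _ ≤ C * x₂ t * (D / (a * x₂ t)) := mul_le_mul_of_nonneg_right (hC t ht) (by positivity)
      _ = C * (D / a) := by field_simp

theorem shrinksToPoint [CompactSpace G] [ConnectedSpace (G ⧸ K)] {T : ℝ} (hT : 0 < T)
    {x₁ x₂ : ℝ → ℝ} (hp₁ : ∀ t ∈ Ico 0 T, 0 < x₁ t)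
    (l₁ : Tendsto x₁ (𝓝[<] T) (𝓝 0)) (l₂ : Tendsto x₂ (𝓝[<] T) (𝓝 0))
    {g : ℝ → InvariantMetric Q K}
    (hg : ∀ t ∈ Ico 0 T, (g t).HasComponents 𝔭₁ 𝔭₂ (x₁ t) (x₂ t)) : ShrinksToPoint g T := by
  obtain ⟨C, hC, hdiam⟩ := exists_diam_le (K := K) Q
  have h1 : Tendsto (fun t => ENNReal.ofReal (√(max (x₁ t) (x₂ t)) * C)) (𝓝[<] T) (𝓝 0) := by
    have h2 := ENNReal.tendsto_ofReal (((l₁.max l₂).sqrt).mul_const C)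
    simpa using h2
  refine tendsto_of_tendsto_of_tendsto_of_le_of_le' tendsto_const_nhds h1
    (Eventually.of_forall fun t => zero_le) ?_
  filter_upwards [Ioo_mem_nhdsLT hT] with t ht
  have ht' : t ∈ Ico 0 T := ⟨ht.1.le, ht.2⟩
  exact hdiam (g t) _ ((hp₁ t ht').le.trans (le_max_left _ _))
    (S.form_le_mul (hg t ht') (le_max_left _ _) (le_max_right _ _))

end IsotropySplitting

theorem mainTheorem10 {n : ℕ} {G : Type*} [TopologicalSpace G]
    [ChartedSpace (EuclideanSpace ℝ (Fin n)) G] [Group G] [LieGroup (𝓡 n) ∞ G]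
    [CompactSpace G] [T2Space G]
    (K : Subgroup G) (hK : IsClosed (K : Set G)) (hconn : ConnectedSpace (G ⧸ K))
    (Q : BiinvariantProduct n G)
    (𝔭₁ 𝔭₂ : Submodule ℝ (LieAlg n G))
    (hsum : 𝔭₁ ⊔ 𝔭₂ = isotropyRep Q K) (hdisj : Disjoint 𝔭₁ 𝔭₂)
    (hirr₁ : IsAdIrreducible K 𝔭₁) (hirr₂ : IsAdIrreducible K 𝔭₂)
    (hineq : ¬ AreAdEquivalent K 𝔭₁ 𝔭₂)
    (hmax : IsMaximalIsotropy (n := n) K)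
    (gE : InvariantMetric Q K) (hE : gE.IsEinstein)
    (huniq : ∀ g : InvariantMetric Q K, g.IsEinstein →
      ∃ c : ℝ, 0 < c ∧ ∀ X Y, g.form X Y = c * gE.form X Y)
    (yE : ℝ) (hyE : gE.HasRatio 𝔭₁ 𝔭₂ yE) :
    (∀ g₀ : InvariantMetric Q K, ∃ T : ℝ, 0 < T ∧ ∃ g : ℝ → InvariantMetric Q K,
      g 0 = g₀ ∧ IsRicciFlowOn g (Ico 0 T) ∧
      (∀ (T' : ℝ) (h : ℝ → InvariantMetric Q K), h 0 = g₀ → IsRicciFlowOn h (Ico 0 T') →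
        T' ≤ T ∧ ∀ t ∈ Ico 0 T', h t = g t) ∧
      IsTypeISingularity g T ∧
      ShrinksToPoint g T ∧
      ∃ x₁ x₂ : ℝ → ℝ,
        (∀ t ∈ Ico 0 T, 0 < x₁ t ∧ 0 < x₂ t ∧ (g t).HasComponents 𝔭₁ 𝔭₂ (x₁ t) (x₂ t)) ∧
        Tendsto x₁ (𝓝[<] T) (𝓝 0) ∧ Tendsto x₂ (𝓝[<] T) (𝓝 0) ∧
        Tendsto (fun t => x₁ t / x₂ t) (𝓝[<] T) (𝓝 yE)) ∧
    ¬ ∃ (T : ℝ) (h : ℝ → InvariantMetric Q K), IsRicciFlowOn h (Iio T) ∧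
      ∃ t < T, ∃ y : ℝ, y ≠ yE ∧ (h t).HasRatio 𝔭₁ 𝔭₂ y := by
  have S : IsotropySplitting Q K 𝔭₁ 𝔭₂ := ⟨hsum, hirr₁, hirr₂, hineq⟩
  obtain ⟨c, hc⟩ := S.exists_ricciCoeffs hmax
  have hZ := S.isUniqueZero hc hE huniq hyE
  refine ⟨fun g₀ => ?_, ?_⟩
  · obtain ⟨a₁, a₂, h₁, h₂, hg₀⟩ := S.exists_hasComponents g₀
    obtain ⟨T, x₁, x₂, hT, e₁, e₂, hx⟩ := RicciCoeffs.exists_isShrinkingSolution hZ h₁ h₂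
    -- The family must be defined for every real time; outside [0, T) the metric is an irrelevant
    -- default.
    have hex : ∀ t, ∃ g : InvariantMetric Q K,
        t ∈ Ico 0 T → g.HasComponents 𝔭₁ 𝔭₂ (x₁ t) (x₂ t) := by
      intro t
      by_cases ht : t ∈ Ico 0 T
      · obtain ⟨g, hg⟩ := S.exists_metric (hx.pos₁ t ht) (hx.pos₂ t ht)
        exact ⟨g, fun _ => hg⟩
      · exact ⟨g₀, fun h => absurd h ht⟩
    choose g hg using hex
    refine ⟨T, hT, g, ?_, ?_, ?_, S.isTypeISingularity hc hZ hT hx hg,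
      S.shrinksToPoint hT hx.pos₁ hx.lim₁ hx.lim₂ hg,
      x₁, x₂, fun t ht => ⟨hx.pos₁ t ht, hx.pos₂ t ht, hg t ht⟩, hx.lim₁, hx.lim₂, hx.lim_ratio⟩
    · have h0 := hg 0 ⟨le_rfl, hT⟩
      rw [e₁, e₂] at h0
      exact S.ext_components h0 hg₀
    · exact S.isRicciFlowOn hc hx.pos₁ hx.pos₂ hg (fun t ht => (hx.deriv₁ t ht).hasDerivWithinAt)
        fun t ht => (hx.deriv₂ t ht).hasDerivWithinAt
    · intro T' h h0 hf
      -- By Schur an arbitrary competing flow is diagonal at every time, so uniqueness among all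
      -- homogeneous flows reduces to uniqueness for the planar system.
      choose z₁ z₂ p₁ p₂ hz using fun t => S.exists_hasComponents (h t)
      have hd := fun t (ht : t ∈ Ico 0 T') =>
        S.hasDerivWithinAt_components hc (fun u _ => p₁ u) (fun u _ => p₂ u) (fun u _ => hz u) hf ht
      have h00 := hz 0
      rw [h0] at h00
      obtain ⟨i₁, i₂⟩ := S.hasComponents_unique h00 hg₀
      obtain ⟨hle, heq⟩ := hx.maximal hT (fun t _ => p₁ t) (fun t _ => p₂ t)
        (fun t ht => (hd t ht).1) (fun t ht => (hd t ht).2) (i₁.trans e₁.symm) (i₂.trans e₂.symm)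
      refine ⟨hle, fun t ht => ?_⟩
      have h3 := hz t
      rw [(heq t ht).1, (heq t ht).2] at h3
      exact S.ext_components h3 (hg t ⟨ht.1, ht.2.trans_le hle⟩)
  · rintro ⟨T, h, hf, t, ht, y, hy, x₁, x₂, -, -, hcomp, rfl⟩
    choose z₁ z₂ p₁ p₂ hz using fun t => S.exists_hasComponents (h t)
    have hd := fun u (hu : u < T) => S.hasDerivWithinAt_components hc (fun u _ => p₁ u)
      (fun u _ => p₂ u) (fun u _ => hz u) hf (mem_Iio.mpr hu)
    have h1 := hZ.eq_of_ancient (fun u _ => p₁ u) (fun u _ => p₂ u)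
      (fun u hu => (hd u hu).1.hasDerivAt (Iio_mem_nhds hu))
      (fun u hu => (hd u hu).2.hasDerivAt (Iio_mem_nhds hu)) ht
    obtain ⟨i₁, i₂⟩ := S.hasComponents_unique hcomp (hz t)
    exact hy (by rw [i₁, i₂, h1])
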